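/- For a partition $\lambda=(\lambda_1\ge\lambda_2\ge\cdots)$ of $n$ let $\chi^\lambda$ be the corresponding irreducible complex character of $S_n$ (so that $\chi^{(n)}$ is the trivial character) and $f^\lambda=\chi^\lambda(1)$. Let $\lambda'$ be the conjugate partition, let $m$ be the length of the diagonal of the diagram of $\lambda$, and for $1\le i\le m$ put $$a_i=\lambda_i-i+\tfrac12,\qquad b_i=\lambda_i'-i+\tfrac12 .$$ Write $z^{\underline{k}}=z(z-1)\cdots(z-k+1)$. Let $2\le k\le n$ be integers, let $C$ be the class of $k$-cycles in $S_n$, and let $\lambda$ be a partition of $n$. (a) (Long first row) Let $0<\epsilon<\frac12$. There is a constant $K=K(\epsilon)>0$ such that for all $n$, $k$, $\lambda$ as above for which $r=n-\lambda_1$ satisfies $r+k+1<(\frac12-\epsilon)n$, $$\frac{\chi^\lambda(C)}{f^\lambda}=\frac{(a_1-\frac12)^{\underline{k}}}{n^{\underline{k}}}\prod_{j=2}^m\frac{a_1-a_j-k}{a_1-a_j}\prod_{j=1}^m\frac{a_1+b_j}{a_1+b_j-k}+E,$$ where $E=0$ if $r<k$, and if $r\ge k$ then $$|E|\le K\exp\left(k\left[\log\frac{(1+\epsilon)(k+1+r)}{n-k}+K\,r^{-1/2}\right]\right).$$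 (b) (Large $k$, short first row and column) Let $\theta>\frac23$. There are $\epsilon=\epsilon(\theta)>0$ and $N$ such that for all $n\ge N$, all $k$ with $6\log n\le k\le\epsilon n$ and all partitions $\lambda$ of $n$ with $b_1\le a_1\le e^{-\theta}n$, $$\left|\frac{\chi^\lambda(C)}{f^\lambda}\right|\le e^{-k/2}.$$ (c) (Asymptotic expansion) Let $0<\epsilon<\frac12$. There is a constant $K=K(\epsilon)>0$ such that for all $n$, $k$, $\lambda$ as above with $k<n^{\frac12-\epsilon}$, $$\frac{\chi^\lambda(C)}{f^\lambda}=\sum_{a_i>kn^{1/2}}\frac{a_i^k}{n^k}(1+\alpha_i)+(-1)^{k-1}\sum_{b_i>kn^{1/2}}\frac{b_i^k}{n^k}(1+\beta_i)+E$$ for some real numbers $\alpha_i$, $\beta_i$, $E$ with $$|\alpha_i|\le K\frac{k\,n^{\frac34+\epsilon}}{a_i},\qquad |\beta_i|\le K\frac{k\,n^{\frac34+\epsilon}}{b_i},\qquad |E|\le K\,n^{\frac12}(\log n)^2\left(\frac{k(\log n)^2}{\sqrt n}\right)^k .$$ -/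

import Mathlib

noncomputable section

/-- A bijective numbering by `Fin n` of the `n` cells of a Young diagram `μ`, i.e. a Young tableau
of shape `μ`. Another numbering would change the left ideal below only by an inner automorphism
of the group algebra, so it gives an isomorphic representation. -/
def cellNumbering (μ : YoungDiagram) {n : ℕ} (h : μ.card = n) : Fin n ≃ μ.cells :=
  (Finset.equivFinOfCardEq h).symm

/-- The row group: permutations that keep every entry in its row (first coordinate). -/
def rowGroup (μ : YoungDiagram) {n : ℕ} (h : μ.card = n) : Finset (Equiv.Perm (Fin n)) :=
  Finset.univ.filter fun p =>
    ∀ x, (cellNumbering μ h (p x)).1.1 = (cellNumbering μ h x).1.1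

/-- The column group: permutations that keep every entry in its column (second coordinate). -/
def columnGroup (μ : YoungDiagram) {n : ℕ} (h : μ.card = n) : Finset (Equiv.Perm (Fin n)) :=
  Finset.univ.filter fun q =>
    ∀ x, (cellNumbering μ h (q x)).1.2 = (cellNumbering μ h x).1.2

/-- The Young symmetrizer `∑ sgn(q) p q` over the row group (`p`) and the column group (`q`). -/
def youngSymmetrizer (μ : YoungDiagram) {n : ℕ} (h : μ.card = n) :
    MonoidAlgebra ℂ (Equiv.Perm (Fin n)) :=
  ∑ p ∈ rowGroup μ h, ∑ q ∈ columnGroup μ h,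
    MonoidAlgebra.single (p * q) ((Equiv.Perm.sign q : ℤ) : ℂ)

/-- The left ideal of `ℂ[Sₙ]` generated by the Young symmetrizer. -/
def spechtIdeal (μ : YoungDiagram) {n : ℕ} (h : μ.card = n) :
    Submodule (MonoidAlgebra ℂ (Equiv.Perm (Fin n))) (MonoidAlgebra ℂ (Equiv.Perm (Fin n))) :=
  Submodule.span (MonoidAlgebra ℂ (Equiv.Perm (Fin n))) {youngSymmetrizer μ h}

/-- The irreducible representation `ρ^λ` of `Sₙ`: left multiplication on `ℂ[Sₙ] c_λ`.
A single row gives the trivial representation, a single column the sign representation. -/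
def spechtRep (μ : YoungDiagram) {n : ℕ} (h : μ.card = n) :
    Representation ℂ (Equiv.Perm (Fin n)) (spechtIdeal μ h) :=
  Representation.ofModule' (spechtIdeal μ h)

/-- The irreducible character `χ^λ`. -/
def spechtChar (μ : YoungDiagram) {n : ℕ} (h : μ.card = n) (σ : Equiv.Perm (Fin n)) : ℂ :=
  (spechtRep μ h).character σ

/-- The dimension `f^λ = χ^λ(1)`. -/
def spechtDim (μ : YoungDiagram) {n : ℕ} (h : μ.card = n) : ℂ := spechtChar μ h 1

/-- `σ` belongs to the class of `k`-cycles of `Sₙ`. -/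
def IsKCycle {n : ℕ} (k : ℕ) (σ : Equiv.Perm (Fin n)) : Prop :=
  σ.IsCycle ∧ σ.support.card = k

/-- The length `m` of the diagonal of the diagram. -/
def diagLen (μ : YoungDiagram) : ℕ := (μ.cells.filter fun c => c.1 = c.2).card

/-- Frobenius coordinate `a_{i+1} = λ_{i+1} - (i+1) + 1/2`, for `0 ≤ i < m` (rows from `0`). -/
def frobA (μ : YoungDiagram) (i : ℕ) : ℝ := (μ.rowLen i : ℝ) - ((i : ℝ) + 1) + 1 / 2

/-- Frobenius coordinate `b_{i+1} = λ'_{i+1} - (i+1) + 1/2`, for `0 ≤ i < m` (columns from `0`). -/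
def frobB (μ : YoungDiagram) (i : ℕ) : ℝ := (μ.colLen i : ℝ) - ((i : ℝ) + 1) + 1 / 2

/-- The falling power `z (z - 1) ⋯ (z - k + 1)`. -/
def fallingPow (z : ℝ) (k : ℕ) : ℝ := ∏ i ∈ Finset.range k, (z - i)

/-- The residue main term for a long first row (`a_1` is `frobA μ 0`). -/
def residueTerm (μ : YoungDiagram) (n k : ℕ) : ℝ :=
  fallingPow (frobA μ 0 - 1 / 2) k / fallingPow n k
    * (∏ j ∈ Finset.Ico 1 (diagLen μ), (frobA μ 0 - frobA μ j - k) / (frobA μ 0 - frobA μ j))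
    * ∏ j ∈ Finset.range (diagLen μ), (frobA μ 0 + frobB μ j) / (frobA μ 0 + frobB μ j - k)

end

/-! The proof has an algebraic half, which writes the normalized character at a k-cycle as one
coefficient of an explicit rational function, and an analytic half, which estimates that coefficient
in the three regimes.

Algebra. For beads `μ i = λ_i + L - 1 - i`, the alternating sum of permutation characters on words
(`alternantChar`) has an explicit value at a k-cycle: a fixed word is constant on the cycle, so the
cycle lowers one bead by k, and a Vandermonde quotient gives Frobenius' bead sum
(`descFactorial_mul_alternantChar_cycle`). To know that this class function is the character of the
Specht ideal, three inner products suffice. The virtual character has norm one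
(`sum_sq_alternantChar`, a triangularity argument for complete homogeneous polynomials). The Specht
character has norm one (von Neumann's lemma). Their inner product is one
(`sum_coeff_mul_alternantChar`, by dominance). Hence their difference has norm zero
(`spechtChar_eq_alternantChar`).

The bead sum is a sum of residues. In the variable X = 1/z, centred at half the cycle length, it
equals up to sign the coefficient of X^(k+1) in a product over Frobenius coordinates, divided by k
times the falling factorial of n (`spechtChar_div_spechtDim_eq_coeff`). A row coordinate a gives the
factor (z - a - k/2)/(z - a + k/2), with pole a - k/2, and a column coordinate b gives (z + b +
k/2)/(z + b - k/2), with pole k/2 - b.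

Analysis. Contour integrals over |z| = R are replaced by the weighted norm of coefficients with
weight R⁻¹ (`NormLE`), which is submultiplicative. A paired factor for a and b is 1 -
k(a+b)/((z-p)(z-q)), and the sums a + b add up to n, so the whole product is bounded as soon as R
exceeds all poles by a margin of order √(kn).

For long cycles with short first row and column, one radius R = ρn beyond all poles bounds the
coefficient directly. For a long first row, the pole of a_1 is split off. Its residue is the main
term, and what remains is measured at the much smaller radius (1+ε)(r+1); if r < k it vanishes,
because all other residues do. For short cycles the product is telescoped in increasing order of
coordinates (`exists_prod_eq_add_sum`): every coordinate beyond k√n contributes its own k-th power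
up to a small relative error, and the product of the small ones is bounded at radius 2k√n. -/

noncomputable section

open Finset

/-! ### Words, their contents, and permutations fixing them. -/

/-- The content of a word: how often each letter occurs. -/
def letterCount {Y T : Type*} [Fintype Y] [DecidableEq T] (u : Y → T) (t : T) : ℕ :=
  #{y | u y = t}

lemma sum_letterCount {Y T : Type*} [Fintype Y] [Fintype T] [DecidableEq T] (u : Y → T) :
    ∑ t, letterCount u t = Fintype.card Y := by
  unfold letterCount
  rw [← Finset.card_univ, Finset.card_eq_sum_card_fiberwise (f := u) (t := univ)]
  simp

lemma letterCount_cons {n : ℕ} {T : Type*} [DecidableEq T] (t : T) (u : Fin n → T) :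
    letterCount (Fin.cons t u : Fin (n + 1) → T) = letterCount u + Pi.single t 1 := by
  ext s
  simp only [letterCount, Fin.univ_succ, Finset.filter_cons, Fin.cons_zero, Pi.add_apply,
    Pi.single_apply]
  have h : #(filter (fun y => (Fin.cons t u : Fin (n + 1) → T) y = s)
      (univ.map ⟨Fin.succ, Fin.succ_injective n⟩)) = #{y | u y = s} := by
    rw [Finset.filter_map, Finset.card_map]; rfl
  split_ifs with h1 h2 h2
  · rw [Finset.card_cons]; simpa using h
  · exact absurd h1.symm h2
  · exact absurd h2.symm h1
  · simpa using h

lemma letterCount_comp_equiv {Y Z T : Type*} [Fintype Y] [Fintype Z] [DecidableEq T]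
    (e : Y ≃ Z) (u : Z → T) : letterCount (u ∘ e) = letterCount u := by
  ext t
  unfold letterCount
  refine Finset.card_bij (fun y _ => e y) ?_ ?_ ?_
  · simp
  · intro a _ b _ h; exact e.injective h
  · intro b hb; exact ⟨e.symm b, by simpa using hb, by simp⟩

lemma prod_factorial_add_single {T : Type*} [Fintype T] [DecidableEq T] (c : T → ℕ) (t : T) :
    ∏ s, ((c + Pi.single t 1 : T → ℕ) s).factorial = (c t + 1) * ∏ s, (c s).factorial := by
  rw [← Finset.mul_prod_erase univ _ (mem_univ t), ← Finset.mul_prod_erase univ (fun s => (c s).factorial) (mem_univ t)]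
  have : ∏ x ∈ univ.erase t, ((c + Pi.single t 1 : T → ℕ) x).factorial
      = ∏ x ∈ univ.erase t, (c x).factorial := by
    refine Finset.prod_congr rfl fun x hx => ?_
    simp [Finset.ne_of_mem_erase hx]
  rw [this]
  simp [Nat.factorial_succ, mul_assoc]

/-- Adding one letter t is a bijection onto the contents that contain t. The others carry the weight
`c t = 0`, and the weight cancels against the factorial of `c t`. This is the inductive step for
counting words by their first letter. -/
lemma sum_piAntidiag_succ_mul {T : Type*} [Fintype T] [DecidableEq T] (n : ℕ) (t : T)
    (g : (T → ℕ) → ℝ) :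
    ∑ c ∈ piAntidiag univ (n + 1), (c t : ℝ) * (g c / ∏ s, ((c s).factorial : ℝ))
      = ∑ c ∈ piAntidiag univ n, g (c + Pi.single t 1) / ∏ s, ((c s).factorial : ℝ) := by
  symm
  refine Finset.sum_of_injOn (fun c => c + Pi.single t 1) ?_ ?_ ?_ ?_
  · intro a _ b _ h; simpa using h
  · intro c hc
    simp only [mem_univ, implies_true, and_true, mem_coe, mem_piAntidiag] at hc ⊢
    simp [Finset.sum_add_distrib, hc]
  · intro c hc hn
    have : c t = 0 := by
      by_contra h0
      apply hn
      refine ⟨c - Pi.single t 1, ?_, ?_⟩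
      · simp only [mem_coe, mem_piAntidiag, mem_univ, implies_true, and_true] at hc ⊢
        have h2 : c - Pi.single t 1 + Pi.single t 1 = c := by
          ext s; simp only [Pi.add_apply, Pi.sub_apply, Pi.single_apply]; split_ifs with h
          · subst h; omega
          · simp
        have h3 := congrArg (fun f => ∑ s, f s) h2
        simp only [Pi.add_apply, Finset.sum_add_distrib] at h3
        simp at h3
        have : univ.sum (c - Pi.single t 1) = ∑ s, (c s - (Pi.single t 1 : T → ℕ) s) := rfl
        rw [this]
        have h4 : univ.sum c = ∑ s, c s := rfl
        omega
      · ext s; simp only [Pi.add_apply, Pi.sub_apply, Pi.single_apply]; split_ifs with h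
        · subst h; omega
        · simp
    simp [this]
  · intro c _
    have h := prod_factorial_add_single c t
    have h' : ∏ s, (((c + Pi.single t 1 : T → ℕ) s).factorial : ℝ)
        = ((c t : ℝ) + 1) * ∏ s, ((c s).factorial : ℝ) := by exact_mod_cast h
    have hp : (∏ s, ((c s).factorial : ℝ)) ≠ 0 :=
      Finset.prod_ne_zero_iff.2 fun s _ => by positivity
    have h1 : ((c t : ℝ) + 1) ≠ 0 := by positivity
    rw [h']
    simp only [Pi.add_apply, Pi.single_eq_same, Nat.cast_add, Nat.cast_one]
    field_simp

/-- Summation over words grouped by content. -/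
lemma sum_words_eq_sum_contents_fin {T : Type*} [Fintype T] [DecidableEq T] (n : ℕ)
    (g : (T → ℕ) → ℝ) :
    ∑ u : Fin n → T, g (letterCount u)
      = n.factorial * ∑ c ∈ piAntidiag univ n, g c / ∏ t, ((c t).factorial : ℝ) := by
  induction n generalizing g with
  | zero =>
    have : letterCount (default : Fin 0 → T) = 0 := by ext t; simp [letterCount]
    simp [this]
  | succ n ih =>
    rw [← (Fin.consEquiv (fun _ => T)).sum_comp, Fintype.sum_prod_type]
    have e : ∀ (t : T) (u : Fin n → T),
        (Fin.consEquiv (fun _ => T)) (t, u) = (Fin.cons t u : Fin (n + 1) → T) := fun _ _ => rfl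
    simp only [e, letterCount_cons]
    simp only [fun t => ih (fun c => g (c + Pi.single t 1)), ← sum_piAntidiag_succ_mul]
    rw [← Finset.mul_sum, Finset.sum_comm, Nat.factorial_succ, mul_comm (n + 1), Nat.cast_mul,
      mul_assoc]
    congr 1
    rw [Finset.mul_sum]
    -- The weights `c t`, summed over the possible first letters, give the length n + 1.
    refine Finset.sum_congr rfl fun c hc => ?_
    rw [← Finset.sum_mul]
    congr 1
    rw [mem_piAntidiag] at hc
    exact_mod_cast hc.1

lemma sum_words_eq_sum_contents {Y T : Type*} [Fintype Y] [DecidableEq Y] [Fintype T]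
    [DecidableEq T] (g : (T → ℕ) → ℝ) :
    ∑ u : Y → T, g (letterCount u)
      = (Fintype.card Y).factorial *
        ∑ c ∈ piAntidiag univ (Fintype.card Y), g c / ∏ t, ((c t).factorial : ℝ) := by
  rw [← sum_words_eq_sum_contents_fin]
  let e := Fintype.equivFin Y
  rw [← (e.arrowCongr (Equiv.refl T)).symm.sum_comp]
  refine Finset.sum_congr rfl fun u _ => ?_
  congr 1
  exact letterCount_comp_equiv e u

lemma card_perm_fixing_word {n : ℕ} {T : Type*} [Fintype T] [DecidableEq T] (u : Fin n → T) :
    #{σ : Equiv.Perm (Fin n) | u ∘ σ = u} = ∏ t, (letterCount u t).factorial := by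
  have := DomMulAct.stabilizer_card u
  rw [Fintype.card_subtype] at this
  rw [this]
  refine Finset.prod_congr rfl fun t _ => ?_
  rw [Fintype.card_subtype]; rfl

/-- Burnside-type evaluation: summing over pairs of a permutation and a word fixed by it. -/
lemma sum_perm_sum_fixed_words {n : ℕ} {T : Type*} [Fintype T] [DecidableEq T]
    (g : (T → ℕ) → ℝ) :
    ∑ σ : Equiv.Perm (Fin n), ∑ u : Fin n → T with u ∘ σ = u, g (letterCount u)
      = n.factorial * ∑ c ∈ piAntidiag univ n, g c := by
  simp only [Finset.sum_filter]
  rw [Finset.sum_comm]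
  have h : ∀ u : Fin n → T, (∑ σ : Equiv.Perm (Fin n), if u ∘ σ = u then g (letterCount u) else 0)
      = (fun c : T → ℕ => (∏ t, ((c t).factorial : ℝ)) * g c) (letterCount u) := by
    intro u
    rw [← Finset.sum_filter, Finset.sum_const, card_perm_fixing_word, nsmul_eq_mul]
    push_cast; rfl
  refine (Finset.sum_congr rfl fun u _ => h u).trans
    -- The order of the stabilizer of a word cancels the denominator of the multinomial coefficient,
    -- so each content is counted n! times.
    ((sum_words_eq_sum_contents_fin n fun c : T → ℕ => (∏ t, ((c t).factorial : ℝ)) * g c).trans ?_)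
  congr 1
  refine Finset.sum_congr rfl fun c _ => ?_
  have hp : (∏ s, ((c s).factorial : ℝ)) ≠ 0 :=
    Finset.prod_ne_zero_iff.2 fun s _ => by positivity
  field_simp

/-! ### Alternating polynomials and multiplication by complete homogeneous polynomials, on
coefficients. -/

/-- The exponent vector `(L-1, …, 1, 0)`. -/
def staircase (L : ℕ) (i : Fin L) : ℕ := (Fin.rev i : ℕ)

lemma staircase_strictAnti (L : ℕ) : StrictAnti (staircase L) := by
  intro i j h
  simp only [staircase, Fin.val_rev]
  have := i.2; have := j.2; have : (i : ℕ) < j := h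
  omega

/-- The coefficient function of the Vandermonde alternant. -/
def altSign {L : ℕ} (ν : Fin L → ℕ) : ℝ :=
  ∑ w : Equiv.Perm (Fin L), ((Equiv.Perm.sign w : ℤ) : ℝ) * if staircase L ∘ w = ν then 1 else 0

/-- A function of integer vectors is alternating when permuting the entries multiplies it by the
sign. -/
def IsAlternating {L : ℕ} (b : (Fin L → ℕ) → ℝ) : Prop :=
  ∀ (ν : Fin L → ℕ) (π : Equiv.Perm (Fin L)), b (ν ∘ π) = ((Equiv.Perm.sign π : ℤ) : ℝ) * b ν

lemma altSign_isAlternating {L : ℕ} : IsAlternating (altSign (L := L)) := by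
  intro ν π
  unfold altSign
  rw [← Equiv.sum_comp (Equiv.mulRight π), Finset.mul_sum]
  refine Finset.sum_congr rfl fun w _ => ?_
  have : (staircase L ∘ ⇑((Equiv.mulRight π) w) = ν ∘ ⇑π) ↔ (staircase L ∘ ⇑w = ν) := by
    simp only [Equiv.coe_mulRight, Equiv.Perm.coe_mul, ← Function.comp_assoc]
    exact ⟨fun h => π.surjective.injective_comp_right h, fun h => by rw [h]⟩
  simp only [this]
  simp only [Equiv.coe_mulRight, map_mul]
  push_cast
  ring

lemma IsAlternating.injective {L : ℕ} {b : (Fin L → ℕ) → ℝ} (hb : IsAlternating b)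
    {ν : Fin L → ℕ} (h : b ν ≠ 0) : Function.Injective ν := by
  intro i j hij
  by_contra hne
  have h1 := hb ν (Equiv.swap i j)
  have h2 : ν ∘ Equiv.swap i j = ν := by
    ext x
    simp only [Function.comp_apply, Equiv.swap_apply_def]
    split_ifs with h3 h4
    · rw [h3, hij]
    · rw [h4, hij]
    · rfl
  rw [h2, Equiv.Perm.sign_swap hne] at h1
  apply h
  push_cast at h1
  linarith

/-- Multiplication by the complete homogeneous polynomial of degree `r`, on coefficients. -/
def completeMul {L : ℕ} (r : ℕ) (b : (Fin L → ℕ) → ℝ) (ν : Fin L → ℕ) : ℝ :=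
  ∑ η ∈ Finset.Iic ν with ∑ i, η i + r = ∑ i, ν i, b η

lemma IsAlternating.completeMul {L : ℕ} {b : (Fin L → ℕ) → ℝ} (hb : IsAlternating b) (r : ℕ) :
    IsAlternating (completeMul r b) := by
  intro ν π
  unfold _root_.completeMul
  rw [Finset.mul_sum]
  symm
  refine Finset.sum_nbij' (fun η => η ∘ π) (fun η => η ∘ π.symm) ?_ ?_ ?_ ?_ ?_
  · intro η hη
    simp only [mem_filter, mem_Iic] at hη ⊢
    refine ⟨fun i => hη.1 (π i), ?_⟩
    have h1 := Equiv.sum_comp π η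
    have h2 := Equiv.sum_comp π ν
    simp only [Function.comp_apply]
    omega
  · intro η hη
    simp only [mem_filter, mem_Iic] at hη ⊢
    refine ⟨fun i => by simpa using hη.1 (π.symm i), ?_⟩
    have h1 := Equiv.sum_comp π.symm η
    have h2 := Equiv.sum_comp π ν
    have h3 := hη.2
    simp only [Function.comp_apply] at h3 ⊢
    omega
  · intro η _; ext; simp
  · intro η _; ext; simp
  · intro η _; rw [hb]

/-- `b` is supported on vectors in which all the values below `t` occur. -/
def SupportedAbove {L : ℕ} (t : ℕ) (b : (Fin L → ℕ) → ℝ) : Prop :=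
  ∀ ν, b ν ≠ 0 → ∀ s < t, ∃ i, ν i = s

lemma altSign_supportedAbove {L : ℕ} : SupportedAbove L (altSign (L := L)) := by
  intro ν hν s hs
  obtain ⟨w, -, hw⟩ := Finset.exists_ne_zero_of_sum_ne_zero hν
  have h : staircase L ∘ w = ν := by
    by_contra hc; simp [hc] at hw
  refine ⟨w.symm (Fin.rev ⟨s, hs⟩), ?_⟩
  rw [← h]
  simp [staircase]

lemma IsAlternating.swap_values {L : ℕ} {b : (Fin L → ℕ) → ℝ} (hb : IsAlternating b)
    {η : Fin L → ℕ} (h : b η ≠ 0) {s t : ℕ} (hst : s ≠ t) (hs : ∃ i, η i = s) (ht : ∃ i, η i = t) :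
    b (Equiv.swap s t ∘ η) = -b η ∧ ∑ i, (Equiv.swap s t ∘ η) i = ∑ i, η i := by
  obtain ⟨i, hi⟩ := hs
  obtain ⟨j, hj⟩ := ht
  have hinj := hb.injective h
  have hij : i ≠ j := by rintro rfl; exact hst (hi.symm.trans hj)
  have e : Equiv.swap s t ∘ η = η ∘ Equiv.swap i j := by
    ext x
    simp only [Function.comp_apply]
    by_cases hxi : x = i
    · subst hxi; simp [hi, hj]
    · by_cases hxj : x = j
      · subst hxj; simp [hi, hj]
      · rw [Equiv.swap_apply_of_ne_of_ne hxi hxj, Equiv.swap_apply_of_ne_of_ne]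
        · rw [← hi]; exact fun hc => hxi (hinj hc)
        · rw [← hj]; exact fun hc => hxj (hinj hc)
  rw [e]
  refine ⟨?_, Equiv.sum_comp (Equiv.swap i j) η⟩
  rw [hb, Equiv.Perm.sign_swap hij]
  simp

/-- If ν misses a value s < t, then an entry of η ≤ ν equal to s lies strictly below the entry of ν,
so the values s and s + 1 of η may be exchanged without leaving η ≤ ν. This is a sign-reversing
involution and the terms cancel. Each multiplication therefore loses only one of the guaranteed
values. -/
lemma SupportedAbove.completeMul {L t : ℕ} {b : (Fin L → ℕ) → ℝ} (hb : IsAlternating b)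
    (hs : SupportedAbove (t + 1) b) (r : ℕ) : SupportedAbove t (completeMul r b) := by
  intro ν hν s hst
  by_contra hno
  push Not at hno
  apply hν
  unfold _root_.completeMul
  rw [← Finset.sum_filter_ne_zero]
  have hsw : ∀ η, b η ≠ 0 → b (Equiv.swap s (s + 1) ∘ η) = -b η ∧
      ∑ i, (Equiv.swap s (s + 1) ∘ η) i = ∑ i, η i := fun η hη =>
    hb.swap_values hη (by omega) (hs η hη s (by omega)) (hs η hη (s + 1) (by omega))
  refine Finset.sum_involution (fun η _ => Equiv.swap s (s + 1) ∘ η) ?_ ?_ ?_ ?_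
  · intro η hη
    simp only [mem_filter] at hη
    rw [(hsw η hη.2).1]; ring
  · intro η hη hne heq
    have h1 := (hsw η hne).1
    rw [heq] at h1
    apply hne; linarith
  · intro η hη
    simp only [mem_filter, mem_Iic] at hη ⊢
    obtain ⟨⟨h1, h2⟩, h3⟩ := hη
    refine ⟨⟨fun i => ?_, ?_⟩, ?_⟩
    · have h4 : η i ≤ ν i := h1 i
      have h5 := hno i
      simp only [Function.comp_apply, Equiv.swap_apply_def]
      split_ifs <;> omega
    · rw [(hsw η h3).2]; exact h2
    · rw [(hsw η h3).1]; simpa using h3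
  · intro η _
    ext i; simp

/-- Iterated multiplication of the alternant by complete homogeneous polynomials. -/
def completeIter {L : ℕ} (β : ℕ → ℕ) : ℕ → (Fin L → ℕ) → ℝ
  | 0 => altSign
  | l + 1 => completeMul (β l) (completeIter β l)

lemma completeIter_isAlternating {L : ℕ} (β : ℕ → ℕ) (l : ℕ) :
    IsAlternating (completeIter (L := L) β l) := by
  induction l with
  | zero => exact altSign_isAlternating
  | succ l ih => exact ih.completeMul _

lemma completeIter_supportedAbove {L : ℕ} (β : ℕ → ℕ) {l t : ℕ} (h : t + l = L) :
    SupportedAbove t (completeIter (L := L) β l) := by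
  induction l generalizing t with
  | zero => obtain rfl : t = L := by omega
            exact altSign_supportedAbove
  | succ l ih =>
    exact SupportedAbove.completeMul (completeIter_isAlternating β l) (ih (by omega)) _

/-- The first `l` entries of `μ` followed by the staircase. -/
def truncatedBeads {L : ℕ} (μ : Fin L → ℕ) (l : ℕ) (i : Fin L) : ℕ :=
  if (i : ℕ) < l then μ i else staircase L i

lemma eq_of_le_of_sum_le {L : ℕ} {η ν : Fin L → ℕ} (h : ∀ i, η i ≤ ν i)
    (hs : ∑ i, ν i ≤ ∑ i, η i) : η = ν := by
  have := (Finset.sum_eq_sum_iff_of_le (fun i (_ : i ∈ univ) => h i)).1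
    (le_antisymm (Finset.sum_le_sum fun i _ => h i) hs)
  ext i; exact this i (mem_univ i)

/-- Triangularity. If entry l of η is at most the staircase, η is dominated termwise and the sums
force equality. Otherwise pigeonhole puts a small value at a position before l, and exchanging it
with entry l leads to a contradiction. -/
lemma eq_truncatedBeads {L : ℕ} {μ : Fin L → ℕ} (hμ : StrictAnti μ) (l : Fin L) {η : Fin L → ℕ}
    (hle : ∀ i, η i ≤ truncatedBeads μ (l + 1) i)
    (hsupp : ∀ s < L - l, ∃ i, η i = s)
    (hsum : ∑ i, truncatedBeads μ l i ≤ ∑ i, η i) : η = truncatedBeads μ l := by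
  have hlt : ∀ i : Fin L, i < l → η i ≤ μ i := by
    intro i hi
    have := hle i
    have h2 : (i : ℕ) < l := hi
    rwa [truncatedBeads, if_pos (by omega)] at this
  have hl : η l ≤ μ l := by
    have := hle l
    rwa [truncatedBeads, if_pos (by omega)] at this
  have hgt : ∀ i : Fin L, l < i → η i ≤ staircase L i := by
    intro i hi
    have := hle i
    have h2 : (l : ℕ) < i := hi
    rwa [truncatedBeads, if_neg (by omega)] at this
  by_cases hc : η l ≤ staircase L l
  · refine eq_of_le_of_sum_le (fun i => ?_) hsum
    unfold truncatedBeads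
    rcases lt_trichotomy i l with h | h | h
    · rw [if_pos (by exact h)]; exact hlt i h
    · subst h; simpa using hc
    · rw [if_neg (by have : (l : ℕ) < i := h; omega)]; exact hgt i h
  · exfalso
    obtain ⟨j, hj, hjs⟩ : ∃ j, j < l ∧ η j ≤ staircase L l := by
      by_contra hno
      push Not at hno
      -- If no earlier position held a small value, the L - l values below L - l would have to occur
      -- in the L - l - 1 positions after l.
      choose f hf using fun s : Fin (L - l) => hsupp s s.2
      have hmem : ∀ s, f s ∈ Finset.Ioi l := by
        intro s
        rw [mem_Ioi]
        by_contra hn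
        have h1 : η (f s) ≤ staircase L l := by
          rw [hf]; simp only [staircase, Fin.val_rev]; have := s.2; omega
        rcases lt_or_eq_of_le (not_lt.1 hn) with h2 | h2
        · exact absurd (hno _ h2) (not_lt.2 h1)
        · rw [h2] at h1; exact hc h1
      have hinj : Function.Injective f := by
        intro s t hst
        have := hf s
        rw [hst, hf t] at this
        exact Fin.ext this.symm
      have := Finset.card_le_card_of_injOn f (s := univ) (t := Finset.Ioi l)
        (fun s _ => hmem s) hinj.injOn
      rw [Fin.card_Ioi, Finset.card_univ, Fintype.card_fin] at this
      have := l.2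
      omega
    have hne : j ≠ l := hj.ne
    have key : η ∘ Equiv.swap j l = truncatedBeads μ l := by
      refine eq_of_le_of_sum_le (fun i => ?_) ?_
      · unfold truncatedBeads
        simp only [Function.comp_apply]
        by_cases hij : i = j
        · subst hij
          rw [Equiv.swap_apply_left, if_pos (by exact hj)]
          exact hl.trans (hμ hj).le
        · by_cases hil : i = l
          · subst hil; simpa using hjs
          · rw [Equiv.swap_apply_of_ne_of_ne hij hil]
            rcases lt_or_gt_of_ne hil with h | h
            · rw [if_pos (by exact h)]; exact hlt i h
            · rw [if_neg (by have : (l : ℕ) < i := h; omega)]; exact hgt i h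
      · have := Equiv.sum_comp (Equiv.swap j l) η
        simp only [Function.comp_apply]
        omega
    -- After the exchange the vectors agree, so `η l = μ j`. But `η l ≤ μ l < μ j`.
    have h3 := congrFun key j
    simp only [Function.comp_apply, Equiv.swap_apply_left, truncatedBeads] at h3
    rw [if_pos (by exact hj)] at h3
    have := hμ hj
    omega

lemma sum_truncatedBeads_succ {L : ℕ} {μ : Fin L → ℕ} (l : Fin L) :
    ∑ i, truncatedBeads μ (l + 1) i + staircase L l = ∑ i, truncatedBeads μ l i + μ l := by
  rw [← Finset.add_sum_erase univ _ (mem_univ l), ← Finset.add_sum_erase univ (truncatedBeads μ l) (mem_univ l)]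
  have : ∑ x ∈ univ.erase l, truncatedBeads μ (l + 1) x = ∑ x ∈ univ.erase l, truncatedBeads μ l x := by
    refine Finset.sum_congr rfl fun x hx => ?_
    have hx : (x : ℕ) ≠ l := fun h => Finset.ne_of_mem_erase hx (Fin.ext h)
    unfold truncatedBeads
    by_cases h : (x : ℕ) < l
    · rw [if_pos h, if_pos (by omega)]
    · rw [if_neg h, if_neg (by omega)]
  rw [this]
  simp [truncatedBeads]
  ring

/-- The factors are peeled off from the last one. At each stage at most one exponent vector
survives, the truncated one, and its degree is right only if w fixes the current index. In classical
terms, Kostka numbers vanish unless the content is dominated by the shape, and only w = 1 gives such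
a content. -/
lemma completeIter_truncatedBeads {L : ℕ} {μ : Fin L → ℕ} (hμ : StrictAnti μ)
    (w : Equiv.Perm (Fin L)) {β : ℕ → ℕ} (hβ : ∀ i : Fin L, β i + staircase L (w i) = μ i) (l : ℕ)
    (hl : l ≤ L) (hfix : ∀ i : Fin L, l ≤ i → w i = i) :
    completeIter β l (truncatedBeads μ l) = if w = 1 then 1 else 0 := by
  induction l with
  | zero =>
    have hw : w = 1 := by ext i; simp [hfix i]
    have ht : truncatedBeads μ 0 = staircase L := by ext i; simp [truncatedBeads]
    rw [if_pos hw, ht, completeIter, altSign, Finset.sum_eq_single 1]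
    · simp
    · intro v _ hv
      rw [if_neg, mul_zero]
      intro h
      apply hv
      ext i
      have := (staircase_strictAnti L).injective (congrFun h i)
      simp [this]
    · simp
  | succ l ih =>
    have hlL : l < L := hl
    set k : Fin L := ⟨l, hlL⟩ with hk
    have hwk : w k ≤ k := by
      by_contra hc
      have h1 : w (w k) = w k := hfix _ (by
        have : (k : ℕ) < w k := not_le.1 hc
        simpa [hk] using this)
      have := w.injective h1
      rw [this] at hc
      exact hc le_rfl
    have hst : staircase L k ≤ staircase L (w k) := (staircase_strictAnti L).antitone hwk
    have hsum := sum_truncatedBeads_succ (μ := μ) k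
    have hβk := hβ k
    have hβl : β (k : ℕ) = β l := rfl
    rw [completeIter, completeMul]
    have hall : ∀ η ∈ (Finset.Iic (truncatedBeads μ (l + 1))).filter
        (fun η => ∑ i, η i + β l = ∑ i, truncatedBeads μ (l + 1) i),
        completeIter β l η ≠ 0 → η = truncatedBeads μ l := by
      intro η hη hne
      simp only [mem_filter, mem_Iic] at hη
      refine eq_truncatedBeads hμ k (fun i => hη.1 i) (fun s hs => ?_) ?_
      · exact completeIter_supportedAbove β (t := L - l) (by omega) η hne s hs
      · have h2 := hη.2
        have h3 : ∑ i, truncatedBeads μ (↑k + 1) i = ∑ i, truncatedBeads μ (l + 1) i := rfl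
        have h4 : ∑ i, truncatedBeads μ ↑k i = ∑ i, truncatedBeads μ l i := rfl
        change ∑ i, truncatedBeads μ l i ≤ _
        omega
    have h3 : ∑ i, truncatedBeads μ (↑k + 1) i = ∑ i, truncatedBeads μ (l + 1) i := rfl
    have h4 : ∑ i, truncatedBeads μ ↑k i = ∑ i, truncatedBeads μ l i := rfl
    by_cases hwkk : w k = k
    · rw [Finset.sum_eq_single (truncatedBeads μ l)]
      · refine ih (by omega) fun i hi => ?_
        rcases eq_or_lt_of_le hi with h | h
        · have : i = k := Fin.ext h.symm
          rw [this, hwkk]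
        · exact hfix i h
      · intro η hη hne
        by_contra h0
        exact hne (hall η hη h0)
      · intro hn
        exfalso
        apply hn
        simp only [mem_filter, mem_Iic]
        constructor
        · intro i
          unfold truncatedBeads
          by_cases h : (i : ℕ) < l
          · rw [if_pos h, if_pos (by omega)]
          · rw [if_neg h]
            by_cases h' : (i : ℕ) < l + 1
            · rw [if_pos h']
              have := hβ i
              have hik : i = k := Fin.ext (by have : (k : ℕ) = l := rfl
                                              omega)
              rw [hik] at this ⊢
              rw [hwkk] at this
              change staircase L k ≤ μ k
              omega
            · rw [if_neg h']
        · rw [hwkk] at hβk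
          omega
    · rw [if_neg (by rintro rfl; exact hwkk rfl)]
      refine Finset.sum_eq_zero fun η hη => ?_
      by_contra h0
      have h5 := hall η hη h0
      subst h5
      simp only [mem_filter] at hη
      have h6 := hη.2
      have h7 : staircase L (w k) = staircase L k := by omega
      exact hwkk ((staircase_strictAnti L).injective h7)

lemma completeIter_eq {L : ℕ} {μ : Fin L → ℕ} (hμ : StrictAnti μ)
    (w : Equiv.Perm (Fin L)) {β : ℕ → ℕ} (hβ : ∀ i : Fin L, β i + staircase L (w i) = μ i) :
    completeIter β L μ = if w = 1 then 1 else 0 := by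
  have h : truncatedBeads μ L = μ := by ext i; simp [truncatedBeads]
  rw [← completeIter_truncatedBeads hμ w hβ L le_rfl (fun i hi => absurd i.2 (by omega)), h]

lemma completeMul_eq_sum_piAntidiag {L : ℕ} (r : ℕ) (b : (Fin L → ℕ) → ℝ) (ν : Fin L → ℕ) :
    completeMul r b ν = ∑ γ ∈ piAntidiag univ r, if ∀ i, γ i ≤ ν i then b (ν - γ) else 0 := by
  rw [← Finset.sum_filter, completeMul]
  have hsub : ∀ γ : Fin L → ℕ, γ ≤ ν → ∑ i, (ν - γ) i + ∑ i, γ i = ∑ i, ν i := by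
    intro γ h
    rw [← Finset.sum_add_distrib]
    exact Finset.sum_congr rfl fun i _ => Nat.sub_add_cancel (h i)
  have hss : ∀ γ : Fin L → ℕ, γ ≤ ν → ν - (ν - γ) = γ := by
    intro γ h; ext i; have : γ i ≤ ν i := h i
    simp only [Pi.sub_apply]; omega
  have hle : ∀ γ : Fin L → ℕ, ν - γ ≤ ν := by
    intro γ i; simp
  refine Finset.sum_nbij' (fun η => ν - η) (fun γ => ν - γ) ?_ ?_ ?_ ?_ ?_
  · intro η hη
    simp only [mem_filter, mem_Iic, mem_piAntidiag, mem_univ, implies_true, and_true] at hη ⊢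
    have := hsub η hη.1
    have h2 := hη.2
    refine ⟨?_, hle η⟩
    change ∑ i, (ν - η) i = r
    omega
  · intro γ hγ
    simp only [mem_filter, mem_Iic, mem_piAntidiag, mem_univ, implies_true, and_true] at hγ ⊢
    have := hsub γ hγ.2
    have h2 : ∑ i, γ i = r := hγ.1
    refine ⟨hle γ, ?_⟩
    omega
  · intro η hη
    simp only [mem_filter, mem_Iic] at hη
    exact hss η hη.1
  · intro γ hγ
    simp only [mem_filter] at hγ
    exact hss γ hγ.2
  · intro η hη
    simp only [mem_filter, mem_Iic] at hη
    rw [hss η hη.1]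

/-- The coefficient of `x ^ c` in `x ^ μ` divided by the alternant. -/
def altSub {L : ℕ} (μ c : Fin L → ℕ) : ℝ := if ∀ i, c i ≤ μ i then altSign (μ - c) else 0

/-- The virtual character of `Sₙ` attached to a strictly decreasing vector `μ`: the alternating sum
of the characters of permutation modules on words of given content. -/
def alternantChar {n L : ℕ} (μ : Fin L → ℕ) (σ : Equiv.Perm (Fin n)) : ℝ :=
  ∑ u : Fin n → Fin L with u ∘ σ = u, altSub μ (letterCount u)

lemma altSub_eq_sum {L : ℕ} (μ c : Fin L → ℕ) :
    altSub μ c = ∑ w : Equiv.Perm (Fin L), ((Equiv.Perm.sign w : ℤ) : ℝ) *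
      if ∀ i, staircase L (w i) + c i = μ i then 1 else 0 := by
  unfold altSub altSign
  split_ifs with h
  · refine Finset.sum_congr rfl fun w _ => ?_
    have : (staircase L ∘ w = μ - c) ↔ ∀ i, staircase L (w i) + c i = μ i := by
      rw [funext_iff]
      refine forall_congr' fun i => ?_
      have := h i
      simp only [Function.comp_apply, Pi.sub_apply]
      omega
    simp only [this]
  · symm
    refine Finset.sum_eq_zero fun w _ => ?_
    rw [if_neg, mul_zero]
    intro hc
    exact h fun i => by have := hc i; omega

lemma altSub_add {L : ℕ} (ν c d : Fin L → ℕ) :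
    altSub ν (c + d) = if ∀ i, d i ≤ ν i then altSub (ν - d) c else 0 := by
  unfold altSub
  by_cases h : ∀ i, d i ≤ ν i
  · rw [if_pos h]
    have : (∀ i, (c + d) i ≤ ν i) ↔ ∀ i, c i ≤ (ν - d) i := by
      refine forall_congr' fun i => ?_
      have := h i
      simp only [Pi.add_apply, Pi.sub_apply]; omega
    simp only [this]
    have e : ν - (c + d) = ν - d - c := by
      ext i; simp only [Pi.add_apply, Pi.sub_apply]; omega
    rw [e]
  · rw [if_neg h, if_neg]
    intro hc
    exact h fun i => by have := hc i; simp only [Pi.add_apply] at this; omega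

/-- Choosing a monomial in every complete homogeneous factor amounts to choosing the columns of a
nonnegative integer matrix. This links iterated multiplication to contents of words in pairs of
letters. -/
lemma completeIter_eq_sum {L : ℕ} (β : ℕ → ℕ) (l : ℕ) (ν : Fin L → ℕ) :
    completeIter β l ν = ∑ γ ∈ Fintype.piFinset (fun j : Fin l => piAntidiag (univ : Finset (Fin L)) (β j)),
      altSub ν (∑ j, γ j) := by
  induction l generalizing ν with
  | zero => simp [completeIter, altSub]
  | succ l ih =>
    rw [completeIter, completeMul_eq_sum_piAntidiag]
    have h1 : ∀ γ₀ ∈ piAntidiag (univ : Finset (Fin L)) (β l),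
        (if ∀ i, γ₀ i ≤ ν i then completeIter β l (ν - γ₀) else 0) =
        ∑ γ ∈ Fintype.piFinset (fun j : Fin l => piAntidiag (univ : Finset (Fin L)) (β j)),
          altSub ν (∑ j, γ j + γ₀) := by
      intro γ₀ _
      simp only [altSub_add]
      split_ifs
      · exact ih _
      · simp
    rw [Finset.sum_congr rfl h1, ← Finset.sum_product']
    refine Finset.sum_nbij' (fun p => (Fin.snoc p.2 p.1 : Fin (l + 1) → Fin L → ℕ))
      (fun γ => (γ (Fin.last l), fun j => γ j.castSucc)) ?_ ?_ ?_ ?_ ?_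
    · rintro ⟨a, γ⟩ h
      simp only [mem_product, Fintype.mem_piFinset] at h ⊢
      intro j
      refine Fin.lastCases ?_ (fun j => ?_) j
      · simpa using h.1
      · simpa using h.2 j
    · intro γ h
      simp only [mem_product, Fintype.mem_piFinset] at h ⊢
      exact ⟨h (Fin.last l), fun j => h j.castSucc⟩
    · rintro ⟨a, γ⟩ _
      simp
    · intro γ _
      ext j
      refine Fin.lastCases ?_ (fun j => ?_) j <;> simp
    · rintro ⟨a, γ⟩ _
      rw [Fin.sum_univ_castSucc]
      simp

lemma letterCount_fst {n L : ℕ} (F : Fin n → Fin L × Fin L) (i : Fin L) :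
    letterCount (fun x => (F x).1) i = ∑ j, letterCount F (i, j) := by
  unfold letterCount
  rw [Finset.card_eq_sum_card_fiberwise (f := fun x => (F x).2) (t := univ) (by simp)]
  refine Finset.sum_congr rfl fun j _ => ?_
  rw [Finset.filter_filter]
  simp only [Prod.ext_iff]

lemma letterCount_snd {n L : ℕ} (F : Fin n → Fin L × Fin L) (j : Fin L) :
    letterCount (fun x => (F x).2) j = ∑ i, letterCount F (i, j) := by
  unfold letterCount
  rw [Finset.card_eq_sum_card_fiberwise (f := fun x => (F x).1) (t := univ) (by simp)]
  refine Finset.sum_congr rfl fun j _ => ?_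
  rw [Finset.filter_filter]
  simp only [Prod.ext_iff, and_comm]

/-- The indicator prescribes the column sums, so the columns are monomials of complete homogeneous
polynomials of prescribed degrees. The row sums are the exponent of their product, and
`completeIter_eq` applies. -/
lemma sum_matrices_of_columns {n L : ℕ} {μ : Fin L → ℕ} (hμ : StrictAnti μ)
    (hn : ∑ i, μ i = n + ∑ i, staircase L i) (w : Equiv.Perm (Fin L)) :
    ∑ M ∈ piAntidiag (univ : Finset (Fin L × Fin L)) n,
      (if ∀ j, staircase L (w j) + ∑ i, M (i, j) = μ j then 1 else 0) *
        altSub μ (fun i => ∑ j, M (i, j)) = if w = 1 then 1 else 0 := by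
  by_cases hle : ∀ i, staircase L (w i) ≤ μ i
  · let β : ℕ → ℕ := fun i => if h : i < L then μ ⟨i, h⟩ - staircase L (w ⟨i, h⟩) else 0
    have hβ : ∀ i : Fin L, β i + staircase L (w i) = μ i := by
      intro i
      have h := hle i
      have e : β i = μ i - staircase L (w i) := by simp [β, i.2]
      omega
    rw [← completeIter_eq hμ w hβ, completeIter_eq_sum]
    simp only [ite_mul, one_mul, zero_mul]
    rw [← Finset.sum_filter]
    refine Finset.sum_nbij' (fun M j i => M (i, j)) (fun γ p => γ p.2 p.1) ?_ ?_ ?_ ?_ ?_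
    · intro M hM
      simp only [mem_filter, Fintype.mem_piFinset, mem_piAntidiag, mem_univ, implies_true,
        and_true] at hM ⊢
      intro j
      have := hM.2 j
      have := hβ j
      change ∑ i, M (i, j) = β j
      omega
    · intro γ hγ
      simp only [mem_filter, Fintype.mem_piFinset, mem_piAntidiag, mem_univ, implies_true,
        and_true] at hγ ⊢
      have hγ' : ∀ j, ∑ i, γ j i = β j := hγ
      refine ⟨?_, fun j => ?_⟩
      · rw [Fintype.sum_prod_type, Finset.sum_comm]
        simp only [hγ']
        have h1 := Finset.sum_congr rfl fun i (_ : i ∈ (univ : Finset (Fin L))) => hβ i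
        rw [Finset.sum_add_distrib, Equiv.sum_comp w (staircase L)] at h1
        change ∑ i : Fin L, β i + _ = ∑ i, μ i at h1
        omega
      · rw [hγ']
        have := hβ j; omega
    · intro M _; rfl
    · intro γ _; rfl
    · intro M _
      congr 1
      ext i
      simp
  -- A strictly decreasing vector of naturals dominates the staircase, so the identity never meets a
  -- negative degree.
  · have hw : w ≠ 1 := by
      rintro rfl
      apply hle
      intro i
      have h : ∀ k : ℕ, ∀ i : Fin L, (i : ℕ) + k + 1 = L → k ≤ μ i := by
        intro k
        induction k with
        | zero => intros; omega
        | succ k ih =>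
          intro i hi
          have h1 := ih ⟨i + 1, by omega⟩ (by simp; omega)
          have h2 : μ ⟨i + 1, by omega⟩ < μ i := hμ (by change (i : ℕ) < i + 1; omega)
          omega
      have := h (staircase L i) i (by simp only [staircase, Fin.val_rev]; have := i.2; omega)
      simpa using this
    rw [if_neg hw]
    refine Finset.sum_eq_zero fun M _ => ?_
    rw [if_neg, zero_mul]
    intro hc
    exact hle fun i => by have := hc i; omega

/-- The virtual characters attached to strictly decreasing vectors have norm one. -/
theorem sum_sq_alternantChar {n L : ℕ} {μ : Fin L → ℕ} (hμ : StrictAnti μ)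
    (hn : ∑ i, μ i = n + ∑ i, staircase L i) :
    ∑ σ : Equiv.Perm (Fin n), alternantChar μ σ ^ 2 = n.factorial := by
  -- Two fixed words form one fixed word in pairs of letters. Its content is a matrix whose row and
  -- column sums are the contents of the two words.
  have h1 : ∀ σ : Equiv.Perm (Fin n), alternantChar μ σ ^ 2 =
      ∑ F : Fin n → Fin L × Fin L with F ∘ σ = F,
        (fun M : Fin L × Fin L → ℕ => altSub μ (fun i => ∑ j, M (i, j)) *
          altSub μ (fun j => ∑ i, M (i, j))) (letterCount F) := by
    intro σ
    rw [sq, alternantChar, Finset.sum_mul_sum, ← Finset.sum_product']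
    refine Finset.sum_nbij' (fun p x => (p.1 x, p.2 x))
      (fun F => (fun x => (F x).1, fun x => (F x).2)) ?_ ?_ ?_ ?_ ?_
    · rintro ⟨u, v⟩ h
      simp only [mem_product, mem_filter, mem_univ, true_and, funext_iff, Function.comp_apply,
        Prod.mk.injEq] at h ⊢
      exact fun x => ⟨h.1 x, h.2 x⟩
    · intro F h
      simp only [mem_product, mem_filter, mem_univ, true_and, funext_iff, Function.comp_apply] at h ⊢
      exact ⟨fun x => by rw [h x], fun x => by rw [h x]⟩
    · intro p _; rfl
    · intro F _; rfl
    · rintro ⟨u, v⟩ _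
      simp only [← letterCount_fst, ← letterCount_snd]
  rw [Finset.sum_congr rfl fun σ _ => h1 σ,
    sum_perm_sum_fixed_words fun M : Fin L × Fin L → ℕ => altSub μ (fun i => ∑ j, M (i, j)) *
      altSub μ (fun j => ∑ i, M (i, j))]
  have h2 : ∑ M ∈ piAntidiag (univ : Finset (Fin L × Fin L)) n,
      altSub μ (fun i => ∑ j, M (i, j)) * altSub μ (fun j => ∑ i, M (i, j)) = 1 := by
    have h3 : ∀ M : Fin L × Fin L → ℕ,
        altSub μ (fun i => ∑ j, M (i, j)) * altSub μ (fun j => ∑ i, M (i, j)) =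
        ∑ w : Equiv.Perm (Fin L), ((Equiv.Perm.sign w : ℤ) : ℝ) *
          ((if ∀ j, staircase L (w j) + ∑ i, M (i, j) = μ j then 1 else 0) *
            altSub μ (fun i => ∑ j, M (i, j))) := by
      intro M
      rw [altSub_eq_sum μ (fun j => ∑ i, M (i, j)), Finset.mul_sum]
      exact Finset.sum_congr rfl fun w _ => by ring
    simp only [h3]
    rw [Finset.sum_comm]
    simp only [← Finset.mul_sum, sum_matrices_of_columns hμ hn]
    simp
  rw [h2, mul_one]

/-! ### Values of the virtual character at the identity and at a k-cycle. -/

/-- The alternating sum of inverse factorials which evaluates `alternantChar` at the identity. -/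
def inverseFactorialDet {L : ℕ} (μ : Fin L → ℕ) : ℝ :=
  ∑ w : Equiv.Perm (Fin L), ((Equiv.Perm.sign w : ℤ) : ℝ) *
    ∏ i, (if staircase L (w i) ≤ μ i then ((((μ i - staircase L (w i)).factorial : ℕ) : ℝ))⁻¹ else 0)

lemma sum_altSub_div_factorial {n L : ℕ} {μ : Fin L → ℕ}
    (hn : ∑ i, μ i = n + ∑ i, staircase L i) :
    ∑ c ∈ piAntidiag univ n, altSub μ c / ∏ t, ((c t).factorial : ℝ) = inverseFactorialDet μ := by
  simp only [altSub_eq_sum, Finset.sum_div]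
  rw [Finset.sum_comm]
  refine Finset.sum_congr rfl fun w _ => ?_
  simp only [mul_div_assoc, ← Finset.mul_sum]
  congr 1
  by_cases h : ∀ i, staircase L (w i) ≤ μ i
  · have hsum : ∑ i, (μ i - staircase L (w i)) = n := by
      have h1 : ∑ i, (μ i - staircase L (w i)) + ∑ i, staircase L (w i) = ∑ i, μ i := by
        rw [← Finset.sum_add_distrib]
        exact Finset.sum_congr rfl fun i _ => Nat.sub_add_cancel (h i)
      rw [Equiv.sum_comp w (staircase L)] at h1
      omega
    rw [Finset.sum_eq_single (fun i => μ i - staircase L (w i))]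
    · rw [if_pos fun i => Nat.add_sub_cancel' (h i)]
      simp [h]
    · intro c _ hc
      rw [if_neg, zero_div]
      intro hcc
      apply hc
      ext i
      have := hcc i
      omega
    · intro hc
      simp [mem_piAntidiag, hsum] at hc
  · rw [Finset.sum_eq_zero]
    · symm
      push Not at h
      obtain ⟨i, hi⟩ := h
      exact Finset.prod_eq_zero (mem_univ i) (if_neg (by omega))
    · intro c _
      rw [if_neg, zero_div]
      exact fun hc => h fun i => by have := hc i; omega

lemma sum_words_altSub {Y : Type*} [Fintype Y] [DecidableEq Y] {L : ℕ} {μ : Fin L → ℕ}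
    (hn : ∑ i, μ i = Fintype.card Y + ∑ i, staircase L i) :
    ∑ u : Y → Fin L, altSub μ (letterCount u)
      = (Fintype.card Y).factorial * inverseFactorialDet μ := by
  rw [sum_words_eq_sum_contents (fun c => altSub μ c), sum_altSub_div_factorial hn]

lemma alternantChar_one {n L : ℕ} {μ : Fin L → ℕ}
    (hn : ∑ i, μ i = n + ∑ i, staircase L i) :
    alternantChar μ (1 : Equiv.Perm (Fin n)) = n.factorial * inverseFactorialDet μ := by
  have := sum_words_altSub (Y := Fin n) (μ := μ) (by simpa using hn)
  rw [Fintype.card_fin] at this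
  rw [← this, alternantChar]
  simp

/-- A fixed word is constant on the support of the cycle, which uses k copies of one letter t, and
is arbitrary elsewhere. -/
lemma sum_words_fixed_by_cycle {n k : ℕ} {T : Type*} [Fintype T] [DecidableEq T] (hk : 0 < k)
    {σ : Equiv.Perm (Fin n)}
    (hσ : IsKCycle k σ) (g : (T → ℕ) → ℝ) :
    ∑ u : Fin n → T with u ∘ σ = u, g (letterCount u)
      = ∑ t : T, ∑ v : {x // x ∉ σ.support} → T, g (letterCount v + Pi.single t k) := by
  obtain ⟨hc, hcard⟩ := hσ
  have hne : σ.support.Nonempty := Finset.card_pos.1 (by omega)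
  obtain ⟨x₀, hx₀⟩ := hne
  have hconst : ∀ u : Fin n → T, u ∘ σ = u → ∀ x ∈ σ.support, u x = u x₀ := by
    intro u hu x hx
    obtain ⟨m, hm⟩ := hc.exists_zpow_eq (Equiv.Perm.mem_support.1 hx₀) (Equiv.Perm.mem_support.1 hx)
    rw [← hm]
    have h1 : ∀ y, u (σ y) = u y := fun y => congrFun hu y
    have h2 : ∀ j : ℤ, ∀ y, u ((σ ^ j) y) = u y := by
      intro j
      induction j using Int.induction_on with
      | zero => simp
      | succ j ih => intro y; rw [zpow_add_one, Equiv.Perm.mul_apply, ih, h1]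
      | pred j ih =>
        intro y
        rw [zpow_sub_one, Equiv.Perm.mul_apply, ih, ← h1 (σ⁻¹ y)]
        simp
    exact h2 m x₀
  rw [← Finset.sum_product']
  refine Finset.sum_nbij' (fun u => (u x₀, fun x => u x.1))
    (fun p x => if h : x ∈ σ.support then p.1 else p.2 ⟨x, h⟩) ?_ ?_ ?_ ?_ ?_
  · simp
  · rintro ⟨t, v⟩ _
    simp only [mem_filter, mem_univ, true_and]
    ext x
    simp only [Function.comp_apply]
    by_cases h : x ∈ σ.support
    · rw [dif_pos h, dif_pos (Equiv.Perm.apply_mem_support.2 h)]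
    · have : σ x = x := Equiv.Perm.notMem_support.1 h
      simp only [this]
  · intro u hu
    simp only [mem_filter, mem_univ, true_and] at hu
    ext x
    by_cases h : x ∈ σ.support
    · rw [dif_pos h, hconst u hu x h]
    · rw [dif_neg h]
  · rintro ⟨t, v⟩ _
    ext x
    · simp only [dif_pos hx₀]
    · simp only [dif_neg x.2]
  · intro u hu
    simp only [mem_filter, mem_univ, true_and] at hu
    congr 1
    ext t
    simp only [letterCount, Pi.add_apply, Pi.single_apply]
    rw [← Finset.card_filter_add_card_filter_not (s := {y | u y = t}) (p := fun y => y ∉ σ.support)]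
    congr 1
    · rw [Finset.filter_filter]
      symm
      refine Finset.card_bij (fun x _ => x.1) ?_ ?_ ?_
      · intro x hx; simp only [mem_filter, mem_univ, true_and] at hx ⊢; exact ⟨hx, x.2⟩
      · intro x _ y _ h; exact Subtype.ext h
      · intro x hx; simp only [mem_filter, mem_univ, true_and] at hx
        exact ⟨⟨x, hx.2⟩, by simpa using hx.1, rfl⟩
    · rw [Finset.filter_filter]
      split_ifs with h
      · rw [← hcard]
        congr 1
        ext x
        simp only [not_not, mem_filter, mem_univ, true_and, and_iff_right_iff_imp]
        intro hx
        rw [hconst u hu x hx, h]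
      · rw [Finset.card_eq_zero, Finset.filter_eq_empty_iff]
        rintro x - ⟨h1, h2⟩
        rw [not_not] at h2
        exact h (by rw [← h1, hconst u hu x h2])

/-- The letter i spelled on the cycle lowers bead i by k. What remains is the sum over all words on
n - k points, as at the identity. -/
lemma alternantChar_cycle {n k L : ℕ} (hk : 0 < k) {μ : Fin L → ℕ}
    (hn : ∑ i, μ i = n + ∑ i, staircase L i) {σ : Equiv.Perm (Fin n)} (hσ : IsKCycle k σ) :
    alternantChar μ σ = (n - k).factorial *
      ∑ i, if k ≤ μ i then inverseFactorialDet (μ - Pi.single i k) else 0 := by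
  have hcardle : k ≤ n := by
    rw [← hσ.2]; simpa using Finset.card_le_univ σ.support
  have hcard : Fintype.card {x // x ∉ σ.support} = n - k := by
    rw [Fintype.card_subtype_compl, Fintype.card_fin, Fintype.card_coe, hσ.2]
  rw [alternantChar, sum_words_fixed_by_cycle hk hσ (fun c => altSub μ c), Finset.mul_sum]
  refine Finset.sum_congr rfl fun i _ => ?_
  simp only [altSub_add]
  have hiff : (∀ j, (Pi.single i k : Fin L → ℕ) j ≤ μ j) ↔ k ≤ μ i := by
    constructor
    · intro h; simpa using h i
    · intro h j
      rw [Pi.single_apply]; split_ifs with hj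
      · subst hj; exact h
      · exact Nat.zero_le _
  simp only [hiff]
  split_ifs with h
  · rw [sum_words_altSub, hcard]
    rw [hcard]
    have h1 : ∑ j, (μ - Pi.single i k : Fin L → ℕ) j + ∑ j, (Pi.single i k : Fin L → ℕ) j = ∑ j, μ j := by
      rw [← Finset.sum_add_distrib]
      exact Finset.sum_congr rfl fun j _ => Nat.sub_add_cancel (hiff.2 h j)
    rw [Finset.sum_pi_single'] at h1
    simp only [mem_univ, if_true] at h1
    omega
  · simp

/-- After extracting 1/μ_i! the entries become falling factorials of μ_i. These are monic of the
right degrees, so their determinant is a Vandermonde determinant. The sign is that of the reversal,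
since the staircase is decreasing. -/
lemma inverseFactorialDet_eq {L : ℕ} (μ : Fin L → ℕ) :
    inverseFactorialDet μ = ((Equiv.Perm.sign (Fin.revPerm (n := L)) : ℤ) : ℝ) *
      (Matrix.vandermonde fun i => (μ i : ℝ)).det / ∏ i, ((μ i).factorial : ℝ) := by
  rw [Matrix.det_eval_matrixOfPolynomials_eq_det_vandermonde (fun i => (μ i : ℝ))
    (fun j => descPochhammer ℝ j) (fun i => descPochhammer_natDegree ℝ i)
    (fun i => monic_descPochhammer ℝ i)]
  rw [← Matrix.det_transpose, ← Matrix.det_permute, Matrix.det_apply']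
  rw [inverseFactorialDet, Finset.sum_div]
  refine Finset.sum_congr rfl fun w _ => ?_
  rw [mul_div_assoc, ← Finset.prod_div_distrib]
  congr 1
  refine Finset.prod_congr rfl fun i _ => ?_
  simp only [Matrix.submatrix_apply, Matrix.transpose_apply, Matrix.of_apply, id]
  rw [descPochhammer_eval_eq_descFactorial]
  have : ((Fin.revPerm (w i) : Fin L) : ℕ) = staircase L (w i) := rfl
  rw [this]
  have hf : ((μ i).factorial : ℝ) ≠ 0 := by positivity
  split_ifs with h
  · have h1 := Nat.factorial_mul_descFactorial h
    have h2 : (((μ i - staircase L (w i)).factorial : ℕ) : ℝ) * ((μ i).descFactorial (staircase L (w i)) : ℝ)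
        = ((μ i).factorial : ℝ) := by exact_mod_cast h1
    have h3 : (((μ i - staircase L (w i)).factorial : ℕ) : ℝ) ≠ 0 := by positivity
    field_simp
    linarith
  · rw [Nat.descFactorial_eq_zero_iff_lt.2 (by omega)]
    simp

lemma det_vandermonde_update {L : ℕ} (v : Fin L → ℝ) (i : Fin L) (x : ℝ) :
    (Matrix.vandermonde (Function.update v i x)).det * ∏ j ∈ univ.erase i, (v i - v j)
      = (Matrix.vandermonde v).det * ∏ j ∈ univ.erase i, (x - v j) := by
  -- The factors that involve node i are isolated and oriented as `u i - u j`. The sign of this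
  -- reorientation does not depend on u and drops out of the comparison.
  have key : ∀ u : Fin L → ℝ, (Matrix.vandermonde u).det =
      (∏ p ∈ (univ : Finset (Fin L × Fin L)) with p.1 < p.2 ∧ p.1 ≠ i ∧ p.2 ≠ i, (u p.2 - u p.1)) *
      ((∏ j ∈ univ.erase i, if i < j then (-1 : ℝ) else 1) * ∏ j ∈ univ.erase i, (u i - u j)) := by
    intro u
    rw [Matrix.det_vandermonde]
    have h1 : ∏ a : Fin L, ∏ b ∈ Ioi a, (u b - u a) =
        ∏ p ∈ (univ : Finset (Fin L × Fin L)) with p.1 < p.2, (u p.2 - u p.1) := by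
      rw [Finset.prod_filter, ← Finset.univ_product_univ, Finset.prod_product]
      refine Finset.prod_congr rfl fun a _ => ?_
      rw [← Finset.prod_filter]
      congr 1
      ext b; simp
    rw [h1, ← Finset.prod_filter_mul_prod_filter_not _ (fun p : Fin L × Fin L => p.1 ≠ i ∧ p.2 ≠ i),
      Finset.filter_filter, Finset.filter_filter]
    congr 1
    rw [← Finset.prod_mul_distrib]
    refine Finset.prod_nbij' (fun p => if p.1 = i then p.2 else p.1)
      (fun j => if i < j then (i, j) else (j, i)) ?_ ?_ ?_ ?_ ?_
    · rintro ⟨a, b⟩ h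
      simp only [mem_filter, mem_univ, true_and, mem_erase, and_true] at h ⊢
      obtain ⟨h1, h2⟩ := h
      split_ifs with h3
      · subst h3; exact h1.ne'
      · exact h3
    · intro j h
      simp only [mem_filter, mem_univ, true_and, mem_erase, and_true] at h ⊢
      split_ifs with h3
      · exact ⟨h3, by simp⟩
      · exact ⟨lt_of_le_of_ne (not_lt.1 h3) h, by simp⟩
    · rintro ⟨a, b⟩ h
      simp only [mem_filter, mem_univ, true_and] at h ⊢
      obtain ⟨h1, h2⟩ := h
      by_cases h3 : a = i
      · subst h3; simp [h1]
      · have h4 : b = i := by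
          by_contra h4; exact h2 ⟨h3, h4⟩
        subst h4; simp [h3, not_lt.2 h1.le]
    · intro j h
      simp only [mem_erase, mem_univ, and_true] at h
      split_ifs <;> simp_all
    · rintro ⟨a, b⟩ h
      simp only [mem_filter, mem_univ, true_and] at h ⊢
      obtain ⟨h1, h2⟩ := h
      by_cases h3 : a = i
      · subst h3; simp [h1]
      · have h4 : b = i := by
          by_contra h4; exact h2 ⟨h3, h4⟩
        subst h4; simp [h3, not_lt.2 h1.le]
  rw [key, key v]
  have e1 : ∏ p ∈ (univ : Finset (Fin L × Fin L)) with p.1 < p.2 ∧ p.1 ≠ i ∧ p.2 ≠ i,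
      (Function.update v i x p.2 - Function.update v i x p.1) =
      ∏ p ∈ (univ : Finset (Fin L × Fin L)) with p.1 < p.2 ∧ p.1 ≠ i ∧ p.2 ≠ i, (v p.2 - v p.1) := by
    refine Finset.prod_congr rfl fun p hp => ?_
    simp only [mem_filter, mem_univ, true_and] at hp
    rw [Function.update_of_ne hp.2.1, Function.update_of_ne hp.2.2]
  have e2 : ∏ j ∈ univ.erase i, (Function.update v i x i - Function.update v i x j) =
      ∏ j ∈ univ.erase i, (x - v j) := by
    refine Finset.prod_congr rfl fun j hj => ?_
    rw [Function.update_self, Function.update_of_ne (Finset.ne_of_mem_erase hj)]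
  rw [e1, e2]
  ring

lemma alternantChar_one_ne_zero {n L : ℕ} {μ : Fin L → ℕ} (hμ : StrictAnti μ)
    (hn : ∑ i, μ i = n + ∑ i, staircase L i) :
    alternantChar μ (1 : Equiv.Perm (Fin n)) ≠ 0 := by
  rw [alternantChar_one hn, inverseFactorialDet_eq]
  have h1 : (Matrix.vandermonde fun i => (μ i : ℝ)).det ≠ 0 := by
    rw [Matrix.det_vandermonde_ne_zero_iff]
    intro i j h
    exact hμ.injective (by simpa using h)
  have h2 : ((Equiv.Perm.sign (Fin.revPerm (n := L)) : ℤ) : ℝ) ≠ 0 := by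
    exact_mod_cast (Equiv.Perm.sign (Fin.revPerm (n := L))).ne_zero
  have hp : (∏ s, ((μ s).factorial : ℝ)) ≠ 0 :=
    Finset.prod_ne_zero_iff.2 fun s _ => by positivity
  have h3 : (n.factorial : ℝ) ≠ 0 := by positivity
  exact mul_ne_zero h3 (div_ne_zero (mul_ne_zero h2 h1) hp)

/-- **Frobenius' formula** for the value on a `k`-cycle, as a sum over beads. -/
theorem descFactorial_mul_alternantChar_cycle {n k L : ℕ} (hk : 0 < k) {μ : Fin L → ℕ}
    (hμ : StrictAnti μ) (hn : ∑ i, μ i = n + ∑ i, staircase L i) {σ : Equiv.Perm (Fin n)}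
    (hσ : IsKCycle k σ) :
    (n.descFactorial k : ℝ) * alternantChar μ σ = alternantChar μ (1 : Equiv.Perm (Fin n)) *
      ∑ i, ((μ i).descFactorial k : ℝ) *
        ∏ j ∈ univ.erase i, (((μ i : ℝ) - k - μ j) / ((μ i : ℝ) - μ j)) := by
  have hcardle : k ≤ n := by
    rw [← hσ.2]; simpa using Finset.card_le_univ σ.support
  rw [alternantChar_cycle hk hn hσ, alternantChar_one hn]
  have hfac : ((n - k).factorial : ℝ) * (n.descFactorial k : ℝ) = (n.factorial : ℝ) := by
    exact_mod_cast Nat.factorial_mul_descFactorial hcardle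
  rw [← hfac, ← mul_assoc, mul_comm (n.descFactorial k : ℝ), mul_assoc _ (inverseFactorialDet μ)]
  congr 1
  rw [Finset.mul_sum]
  refine Finset.sum_congr rfl fun i _ => ?_
  split_ifs with h
  · rw [inverseFactorialDet_eq, inverseFactorialDet_eq]
    have hupd : (fun j => (((μ - Pi.single i k : Fin L → ℕ) j : ℕ) : ℝ)) =
        Function.update (fun j => (μ j : ℝ)) i ((μ i : ℝ) - k) := by
      ext j
      by_cases hj : j = i
      · subst hj; simp [Nat.cast_sub h]
      · simp [hj]
    rw [hupd]
    have hv := det_vandermonde_update (fun j => (μ j : ℝ)) i ((μ i : ℝ) - k)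
    have hne : ∏ j ∈ univ.erase i, ((μ i : ℝ) - μ j) ≠ 0 := by
      refine Finset.prod_ne_zero_iff.2 fun j hj => ?_
      rw [sub_ne_zero]
      intro hc
      exact Finset.ne_of_mem_erase hj (hμ.injective (by exact_mod_cast hc.symm))
    have hfp : (∏ j, ((((μ - Pi.single i k : Fin L → ℕ) j).factorial : ℕ) : ℝ)) *
        ((μ i).descFactorial k : ℝ) = ∏ j, (((μ j).factorial : ℕ) : ℝ) := by
      rw [← Finset.mul_prod_erase univ _ (mem_univ i),
        ← Finset.mul_prod_erase univ (fun j => (((μ j).factorial : ℕ) : ℝ)) (mem_univ i)]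
      have e : ∏ j ∈ univ.erase i, ((((μ - Pi.single i k : Fin L → ℕ) j).factorial : ℕ) : ℝ) =
          ∏ j ∈ univ.erase i, (((μ j).factorial : ℕ) : ℝ) := by
        refine Finset.prod_congr rfl fun j hj => ?_
        simp [Finset.ne_of_mem_erase hj]
      rw [e]
      have e2 : ((((μ - Pi.single i k : Fin L → ℕ) i).factorial : ℕ) : ℝ) *
        ((μ i).descFactorial k : ℝ) = (((μ i).factorial : ℕ) : ℝ) := by
        simp only [Pi.sub_apply, Pi.single_eq_same]
        exact_mod_cast Nat.factorial_mul_descFactorial h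
      rw [← e2]; ring
    have hp1 : ∏ j, ((((μ - Pi.single i k : Fin L → ℕ) j).factorial : ℕ) : ℝ) ≠ 0 :=
      Finset.prod_ne_zero_iff.2 fun s _ => by positivity
    have hp2 : ((μ i).descFactorial k : ℝ) ≠ 0 := by
      exact_mod_cast (Nat.descFactorial_pos.2 h).ne'
    rw [Finset.prod_div_distrib, ← hfp]
    field_simp
    linear_combination hv
  -- A bead below k cannot be lowered. The falling factorial vanishes there, so the final formula
  -- needs no case distinction.
  · rw [Nat.descFactorial_eq_zero_iff_lt.2 (by omega)]
    simp

/-! ### Von Neumann's lemma and idempotency of the symmetrizer up to a scalar. -/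

/-- A pair of subgroups of a finite group (given as finsets) with a sign character, to which
von Neumann's lemma on Young symmetrizers applies. -/
structure IsSymmetrizerPair {G : Type*} [Group G] (P Q : Finset G) (ε : G →* ℤˣ) : Prop where
  one_left : 1 ∈ P
  one_right : 1 ∈ Q
  mul_left : ∀ p ∈ P, ∀ g, p * g ∈ P ↔ g ∈ P
  mul_right : ∀ q ∈ Q, ∀ g, g * q ∈ Q ↔ g ∈ Q
  inter : ∀ g ∈ P, g ∈ Q → g = 1
  dichotomy : ∀ g, (∃ p ∈ P, ∃ q ∈ Q, g = p * q) ∨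
    ∃ t ∈ P, g⁻¹ * t * g ∈ Q ∧ ε (g⁻¹ * t * g) = -1

/-- The coefficient function of the symmetrizer `∑ ε(q) p q`. -/
def symmetrizerCoeff {G : Type*} [Group G] [DecidableEq G] (P Q : Finset G) (ε : G →* ℤˣ)
    (g : G) : ℝ :=
  ∑ p ∈ P, ∑ q ∈ Q, if p * q = g then ((ε q : ℤ) : ℝ) else 0

namespace IsSymmetrizerPair

variable {G : Type*} [Group G] [Fintype G] [DecidableEq G] {P Q : Finset G} {ε : G →* ℤˣ}
  (h : IsSymmetrizerPair P Q ε)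

include h

lemma inv_left {p : G} (hp : p ∈ P) : p⁻¹ ∈ P := by
  rw [← h.mul_left p hp]; simpa using h.one_left

lemma inv_right {q : G} (hq : q ∈ Q) : q⁻¹ ∈ Q := by
  rw [← h.mul_right q hq]; simpa using h.one_right

lemma coeff_mul_left {p : G} (hp : p ∈ P) (g : G) :
    symmetrizerCoeff P Q ε (p * g) = symmetrizerCoeff P Q ε g := by
  unfold symmetrizerCoeff
  symm
  refine Finset.sum_nbij' (fun x => p * x) (fun x => p⁻¹ * x) ?_ ?_ ?_ ?_ ?_
  · intro x hx; exact (h.mul_left p hp x).2 hx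
  · intro x hx; exact (h.mul_left _ (h.inv_left hp) x).2 hx
  · intro x _; simp
  · intro x _; simp
  · intro x _; simp [mul_assoc]

lemma coeff_mul_right {q : G} (hq : q ∈ Q) (g : G) :
    symmetrizerCoeff P Q ε (g * q) = ((ε q : ℤ) : ℝ) * symmetrizerCoeff P Q ε g := by
  unfold symmetrizerCoeff
  rw [Finset.mul_sum]
  refine Finset.sum_congr rfl fun p _ => ?_
  rw [Finset.mul_sum]
  symm
  refine Finset.sum_nbij' (fun x => x * q) (fun x => x * q⁻¹) ?_ ?_ ?_ ?_ ?_
  · intro x hx; exact (h.mul_right q hq x).2 hx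
  · intro x hx; exact (h.mul_right _ (h.inv_right hq) x).2 hx
  · intro x _; simp
  · intro x _; simp
  · intro x _
    simp only [← mul_assoc, mul_left_inj, map_mul, mul_ite, mul_zero]
    split_ifs
    · push_cast; ring
    · rfl

lemma coeff_one : symmetrizerCoeff P Q ε 1 = 1 := by
  unfold symmetrizerCoeff
  rw [Finset.sum_eq_single_of_mem 1 h.one_left, Finset.sum_eq_single_of_mem 1 h.one_right]
  · simp
  · intro q _ hq; simp [hq]
  · intro p hp hne
    refine Finset.sum_eq_zero fun q hq => if_neg fun hpq => hne ?_
    refine h.inter p hp ?_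
    rw [eq_inv_of_mul_eq_one_left hpq]
    exact h.inv_right hq

/-- Von Neumann's lemma. -/
lemma eq_coeff {x : G → ℝ} (hl : ∀ p ∈ P, ∀ g, x (p * g) = x g)
    (hr : ∀ q ∈ Q, ∀ g, x (g * q) = ((ε q : ℤ) : ℝ) * x g) (g : G) :
    x g = x 1 * symmetrizerCoeff P Q ε g := by
  -- In the second case of the dichotomy `t * g` equals g times an odd element of Q, so `y g = -y
  -- g`.
  have key : ∀ y : G → ℝ, (∀ p ∈ P, ∀ g, y (p * g) = y g) →
      (∀ q ∈ Q, ∀ g, y (g * q) = ((ε q : ℤ) : ℝ) * y g) →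
      ∀ t ∈ P, g⁻¹ * t * g ∈ Q → ε (g⁻¹ * t * g) = -1 → y g = 0 := by
    intro y yl yr t ht hq hε
    have h1 := yl t ht g
    have h2 := yr _ hq g
    rw [hε] at h2
    have e : g * (g⁻¹ * t * g) = t * g := by group
    rw [e, h1] at h2
    push_cast at h2
    linarith
  rcases h.dichotomy g with ⟨p, hp, q, hq, rfl⟩ | ⟨t, ht, hq, hε⟩
  · rw [hl p hp, h.coeff_mul_left hp]
    have h1 := hr q hq 1
    have h2 := h.coeff_mul_right hq 1
    rw [one_mul] at h1 h2
    rw [h1, h2, h.coeff_one]; ring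
  · rw [key x hl hr t ht hq hε, key _ (fun p hp g => h.coeff_mul_left hp g)
      (fun q hq g => h.coeff_mul_right hq g) t ht hq hε, mul_zero]

omit h in
/-- The scalar by which the symmetrizer fails to be idempotent. -/
def _root_.symmetrizerScalar (P Q : Finset G) (ε : G →* ℤˣ) : ℝ :=
  ∑ b, symmetrizerCoeff P Q ε b⁻¹ * symmetrizerCoeff P Q ε b

/-- The convolution of the symmetrizer with itself has the same left and right symmetries, so von
Neumann's lemma makes it a multiple of the symmetrizer. Evaluation at 1 identifies the scalar. -/
lemma sum_coeff_mul_coeff (t : G) :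
    ∑ b, symmetrizerCoeff P Q ε (t * b⁻¹) * symmetrizerCoeff P Q ε b
      = symmetrizerScalar P Q ε * symmetrizerCoeff P Q ε t := by
  have := h.eq_coeff (x := fun t => ∑ b, symmetrizerCoeff P Q ε (t * b⁻¹) * symmetrizerCoeff P Q ε b)
    ?_ ?_ t
  · simpa [symmetrizerScalar] using this
  · intro p hp g
    simp only [mul_assoc, h.coeff_mul_left hp]
  · intro q hq g
    rw [← Equiv.sum_comp (Equiv.mulRight q), Finset.mul_sum]
    refine Finset.sum_congr rfl fun b _ => ?_
    simp only [Equiv.coe_mulRight, mul_inv_rev, h.coeff_mul_right hq]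
    rw [mul_assoc g, mul_inv_cancel_left]
    ring

lemma sum_coeff_conj_mul_coeff (g t : G) :
    ∑ b, symmetrizerCoeff P Q ε (t * b⁻¹ * g⁻¹) * symmetrizerCoeff P Q ε b
      = (∑ b, symmetrizerCoeff P Q ε (b⁻¹ * g⁻¹) * symmetrizerCoeff P Q ε b) *
        symmetrizerCoeff P Q ε t := by
  have := h.eq_coeff (x := fun t => ∑ b, symmetrizerCoeff P Q ε (t * b⁻¹ * g⁻¹) *
    symmetrizerCoeff P Q ε b) ?_ ?_ t
  · simpa using this
  · intro p hp g
    simp only [mul_assoc, h.coeff_mul_left hp]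
  · intro q hq s
    rw [← Equiv.sum_comp (Equiv.mulRight q), Finset.mul_sum]
    refine Finset.sum_congr rfl fun b _ => ?_
    simp only [Equiv.coe_mulRight, mul_inv_rev, h.coeff_mul_right hq]
    rw [mul_assoc s, mul_inv_cancel_left]
    ring

lemma sum_coeff_mul_coeff' (t : G) :
    ∑ b, symmetrizerCoeff P Q ε b * symmetrizerCoeff P Q ε (b⁻¹ * t)
      = symmetrizerScalar P Q ε * symmetrizerCoeff P Q ε t := by
  rw [← h.sum_coeff_mul_coeff, ← Equiv.sum_comp ((Equiv.inv G).trans (Equiv.mulLeft t))]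
  refine Finset.sum_congr rfl fun b _ => ?_
  simp

/-- The orthogonality relation which makes the character of the ideal have norm one. -/
lemma sum_sum_coeff_conj :
    ∑ g, ∑ s, symmetrizerCoeff P Q ε (g * s⁻¹ * g⁻¹) * symmetrizerCoeff P Q ε s
      = symmetrizerScalar P Q ε ^ 2 := by
  simp only [h.sum_coeff_conj_mul_coeff, Finset.sum_mul]
  rw [Finset.sum_comm]
  have : ∀ b, ∑ g, symmetrizerCoeff P Q ε (b⁻¹ * g⁻¹) * symmetrizerCoeff P Q ε b *
      symmetrizerCoeff P Q ε g =
      symmetrizerScalar P Q ε * (symmetrizerCoeff P Q ε b⁻¹ * symmetrizerCoeff P Q ε b) := by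
    intro b
    have h1 := h.sum_coeff_mul_coeff b⁻¹
    rw [← mul_assoc, ← h1, Finset.sum_mul]
    exact Finset.sum_congr rfl fun g _ => by ring
  simp only [this]
  rw [← Finset.mul_sum, sq]
  rfl

/-- For fixed g the function t ↦ ∑ c(g⁻¹ p t) over p in P is again a multiple of the symmetrizer c,
and it is evaluated at t = g. In effect this pairs c with the permutation character on the cosets of
P. -/
lemma sum_sum_left_conj :
    ∑ g, ∑ p ∈ P, symmetrizerCoeff P Q ε (g⁻¹ * p * g) = #P * symmetrizerScalar P Q ε := by
  have h1 : ∀ g, ∑ p ∈ P, symmetrizerCoeff P Q ε (g⁻¹ * p * g) =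
      (∑ p ∈ P, symmetrizerCoeff P Q ε (g⁻¹ * p)) * symmetrizerCoeff P Q ε g := by
    intro g
    have := h.eq_coeff (x := fun t => ∑ p ∈ P, symmetrizerCoeff P Q ε (g⁻¹ * p * t)) ?_ ?_ g
    · simpa using this
    · intro p hp t
      refine Finset.sum_nbij' (fun x => x * p) (fun x => x * p⁻¹) ?_ ?_ ?_ ?_ ?_
      · intro x hx; exact (h.mul_left x hx p).2 hp
      · intro x hx; exact (h.mul_left x hx _).2 (h.inv_left hp)
      · intro x _; simp
      · intro x _; simp
      · intro x _; simp [mul_assoc]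
    · intro q hq t
      rw [Finset.mul_sum]
      refine Finset.sum_congr rfl fun p _ => ?_
      rw [← mul_assoc, h.coeff_mul_right hq]
  simp only [h1, Finset.sum_mul]
  rw [Finset.sum_comm]
  have h2 : ∀ p ∈ P, ∑ g, symmetrizerCoeff P Q ε (g⁻¹ * p) * symmetrizerCoeff P Q ε g =
      symmetrizerScalar P Q ε := by
    intro p hp
    have h3 := h.sum_coeff_mul_coeff' p
    have h4 : symmetrizerCoeff P Q ε p = 1 := by
      have := h.coeff_mul_left hp 1
      rwa [mul_one, h.coeff_one] at this
    rw [h4, mul_one] at h3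
    rw [← h3]
    exact Finset.sum_congr rfl fun g _ => mul_comm _ _
  rw [Finset.sum_congr rfl h2]
  simp

end IsSymmetrizerPair

/-! ### The character of a left ideal as a trace on the group algebra. -/

section Trace

open MonoidAlgebra

variable {G : Type*} [Group G] [Fintype G] [DecidableEq G] {P Q : Finset G} {ε : G →* ℤˣ}

/-- The symmetrizer as an element of the group algebra. -/
def symmetrizerElt (P Q : Finset G) (ε : G →* ℤˣ) : MonoidAlgebra ℂ G :=
  ∑ p ∈ P, ∑ q ∈ Q, MonoidAlgebra.single (p * q) ((ε q : ℤ) : ℂ)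

lemma symmetrizerElt_coeff (g : G) :
    (symmetrizerElt P Q ε).coeff g = ((symmetrizerCoeff P Q ε g : ℝ) : ℂ) := by
  simp only [symmetrizerElt, symmetrizerCoeff, coeff_sum, Finsupp.finsetSum_apply, coeff_single,
    Finsupp.single_apply]
  push_cast
  refine Finset.sum_congr rfl fun p _ => Finset.sum_congr rfl fun q _ => ?_
  split_ifs <;> simp

lemma coeff_mul_eq_sum (x y : MonoidAlgebra ℂ G) (g : G) :
    (x * y).coeff g = ∑ b, x.coeff (g * b⁻¹) * y.coeff b := by
  rw [MonoidAlgebra.coeff_mul, Finsupp.sum_fintype _ _ (by simp)]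
  simp only [Finsupp.sum_fintype, mul_zero, ite_self, implies_true]
  rw [Finset.sum_comm]
  refine Finset.sum_congr rfl fun b _ => ?_
  rw [Finset.sum_eq_single (g * b⁻¹)]
  · simp
  · intro a _ ha
    rw [if_neg]
    rintro rfl
    simp at ha
  · simp

lemma IsSymmetrizerPair.elt_mul_elt (h : IsSymmetrizerPair P Q ε) :
    symmetrizerElt P Q ε * symmetrizerElt P Q ε
      = ((symmetrizerScalar P Q ε : ℝ) : ℂ) • symmetrizerElt P Q ε := by
  ext g
  rw [coeff_mul_eq_sum, coeff_smul_apply]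
  simp only [symmetrizerElt_coeff, smul_eq_mul]
  rw [← Complex.ofReal_mul, ← h.sum_coeff_mul_coeff]
  push_cast
  rfl

lemma trace_groupAlgebra (f : MonoidAlgebra ℂ G →ₗ[ℂ] MonoidAlgebra ℂ G) :
    LinearMap.trace ℂ _ f = ∑ g, (f (single g 1)).coeff g := by
  rw [LinearMap.trace_eq_matrix_trace ℂ (MonoidAlgebra.basis G ℂ), Matrix.trace]
  refine Finset.sum_congr rfl fun g _ => ?_
  rw [Matrix.diag_apply, LinearMap.toMatrix_apply]
  rfl

/-- If the scalar were zero, right multiplication by the symmetrizer would square to zero and have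
trace 0. Its trace is |G| times the coefficient at 1, that is |G|. -/
lemma IsSymmetrizerPair.scalar_ne_zero (h : IsSymmetrizerPair P Q ε) :
    symmetrizerScalar P Q ε ≠ 0 := by
  intro h0
  have hnil : IsNilpotent (LinearMap.mulRight ℂ (symmetrizerElt P Q ε)) := by
    refine ⟨2, ?_⟩
    refine LinearMap.ext fun x => ?_
    rw [sq, Module.End.mul_apply, LinearMap.mulRight_apply, LinearMap.mulRight_apply, mul_assoc,
      h.elt_mul_elt, h0]
    simp
  have h1 := (LinearMap.isNilpotent_trace_of_isNilpotent hnil).eq_zero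
  rw [trace_groupAlgebra] at h1
  have h2 : ∀ g : G, ((LinearMap.mulRight ℂ (symmetrizerElt P Q ε)) (single g 1)).coeff g = 1 := by
    intro g
    rw [LinearMap.mulRight_apply, coeff_mul_eq_sum, Finset.sum_eq_single 1]
    · simp [symmetrizerElt_coeff, h.coeff_one]
    · intro b _ hb
      rw [coeff_single, Finsupp.single_apply, if_neg, zero_mul]
      intro hc
      apply hb
      have : g * 1 = g * b⁻¹ := by rw [mul_one]; exact hc
      exact (inv_eq_one.1 (mul_left_cancel this).symm)
    · simp
  rw [Finset.sum_congr rfl fun g _ => h2 g] at h1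
  simp at h1

/-- The character of the left ideal generated by the symmetrizer. -/
lemma IsSymmetrizerPair.character_ofModule' (h : IsSymmetrizerPair P Q ε) (σ : G) :
    (Representation.ofModule' (k := ℂ) (G := G)
      (Submodule.span (MonoidAlgebra ℂ G) {symmetrizerElt P Q ε})).character σ =
      (((symmetrizerScalar P Q ε)⁻¹ * ∑ g, symmetrizerCoeff P Q ε (g * σ⁻¹ * g⁻¹) : ℝ) : ℂ) := by
  set c := symmetrizerElt P Q ε with hc
  set S := Submodule.span (MonoidAlgebra ℂ G) {c} with hS
  set κ : ℂ := ((symmetrizerScalar P Q ε : ℝ) : ℂ) with hκ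
  have hκ0 : κ ≠ 0 := by
    rw [hκ]; exact_mod_cast h.scalar_ne_zero
  have hcc : c * c = κ • c := h.elt_mul_elt
  -- Right multiplication by κ⁻¹c is a projection onto the ideal. Hence the trace of σ on the ideal
  -- is the trace of f on the whole group algebra, which the standard basis computes.
  let f : MonoidAlgebra ℂ G →ₗ[ℂ] MonoidAlgebra ℂ G :=
    (LinearMap.mulLeft ℂ (single σ 1)) ∘ₗ (LinearMap.mulRight ℂ (κ⁻¹ • c))
  have hf : ∀ x, f x = single σ 1 * (x * (κ⁻¹ • c)) := fun x => rfl
  have hmem : ∀ x, f x ∈ S.restrictScalars ℂ := by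
    intro x
    rw [hf, Submodule.restrictScalars_mem, ← mul_assoc, mul_smul_comm, ← smul_mul_assoc]
    exact Submodule.smul_mem S _ (Submodule.mem_span_singleton_self c)
  have htr := LinearMap.trace_restrict_eq_of_forall_mem (S.restrictScalars ℂ) f hmem
  have heq : (Representation.ofModule' (k := ℂ) (G := G) S).character σ =
      LinearMap.trace ℂ (S.restrictScalars ℂ) (f.restrict fun x _ => hmem x) := by
    change LinearMap.trace ℂ S _ = LinearMap.trace ℂ S _
    congr 1
    ext1 ⟨x, hx⟩
    apply Subtype.ext
    obtain ⟨a, rfl⟩ := Submodule.mem_span_singleton.1 hx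
    change ((Representation.ofModule' (k := ℂ) (G := G) S) σ ⟨a • c, hx⟩ : MonoidAlgebra ℂ G) = f (a • c)
    have h1 : ((Representation.ofModule' (k := ℂ) (G := G) S) σ ⟨a • c, hx⟩ : MonoidAlgebra ℂ G) =
        single σ 1 * (a • c) := rfl
    rw [h1, hf, smul_eq_mul, mul_smul_comm, mul_assoc a, hcc, mul_smul_comm, mul_smul_comm, mul_smul_comm, smul_smul,
      inv_mul_cancel₀ hκ0, one_smul]
  rw [heq, htr, trace_groupAlgebra]
  push_cast
  rw [Finset.mul_sum, ← Equiv.sum_comp (Equiv.inv G)]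
  refine Finset.sum_congr rfl fun g _ => ?_
  rw [hf, mul_smul_comm, mul_smul_comm, coeff_smul_apply, ← mul_assoc, single_mul_single, smul_eq_mul,
    coeff_mul_eq_sum, Finset.sum_eq_single (g * σ⁻¹ * g⁻¹)]
  · simp [hc, symmetrizerElt_coeff, mul_assoc]
    exact Or.inl hκ
  · intro b _ hb
    rw [coeff_single, Finsupp.single_apply, if_neg, zero_mul]
    intro he
    apply hb
    simp only [Equiv.inv_apply] at he
    have h2 : b = (g * (σ * g⁻¹))⁻¹ := by rw [he]; group
    rw [h2]; group
  · simp

end Trace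

/-! ### Row and column groups of a diagram, and dominance of contents. -/

section Young

variable (μ : YoungDiagram) {n : ℕ} (h : μ.card = n)

/-- The row of the cell numbered `x`. -/
def cellRow (x : Fin n) : ℕ := (cellNumbering μ h x).1.1

/-- The column of the cell numbered `x`. -/
def cellCol (x : Fin n) : ℕ := (cellNumbering μ h x).1.2

lemma cellRow_lt_colLen (x : Fin n) : cellRow μ h x < μ.colLen (cellCol μ h x) :=
  YoungDiagram.mem_iff_lt_colLen.1 ((YoungDiagram.mem_cells _).1 (cellNumbering μ h x).2)

lemma cellCol_lt_rowLen (x : Fin n) : cellCol μ h x < μ.rowLen (cellRow μ h x) :=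
  YoungDiagram.mem_iff_lt_rowLen.1 ((YoungDiagram.mem_cells _).1 (cellNumbering μ h x).2)

/-- The number of the cell in row `i` and column `j`. -/
def cellIndex (i j : ℕ) (hij : i < μ.colLen j) : Fin n :=
  (cellNumbering μ h).symm ⟨(i, j), (YoungDiagram.mem_cells _).2 (YoungDiagram.mem_iff_lt_colLen.2 hij)⟩

@[simp] lemma cellRow_cellIndex (i j : ℕ) (hij : i < μ.colLen j) :
    cellRow μ h (cellIndex μ h i j hij) = i := by
  simp [cellRow, cellIndex]

@[simp] lemma cellCol_cellIndex (i j : ℕ) (hij : i < μ.colLen j) :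
    cellCol μ h (cellIndex μ h i j hij) = j := by
  simp [cellCol, cellIndex]

lemma cell_ext {x y : Fin n} (hr : cellRow μ h x = cellRow μ h y)
    (hc : cellCol μ h x = cellCol μ h y) : x = y :=
  (cellNumbering μ h).injective (Subtype.ext (Prod.ext hr hc))

lemma card_col_row_lt (c j : ℕ) :
    #{x | cellCol μ h x = c ∧ cellRow μ h x < j} = min j (μ.colLen c) := by
  rw [← Finset.card_range (min j (μ.colLen c))]
  symm
  refine Finset.card_bij (fun i hi => cellIndex μ h i c (by
    have := Finset.mem_range.1 hi; omega)) ?_ ?_ ?_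
  · intro i hi
    have := Finset.mem_range.1 hi
    simp only [mem_filter, mem_univ, true_and, cellCol_cellIndex, cellRow_cellIndex]
    omega
  · intro i hi j hj hij
    have := congrArg (cellRow μ h) hij
    simpa using this
  · intro x hx
    simp only [mem_filter, mem_univ, true_and] at hx
    have h1 := cellRow_lt_colLen μ h x
    rw [hx.1] at h1
    refine ⟨cellRow μ h x, by rw [Finset.mem_range]; omega, ?_⟩
    apply cell_ext μ h <;> simp [hx.1]

variable {μ h}

/-- Distinct letters below j number at most j, and a column has no more letters than cells. The row
numbers attain the smaller of the two bounds. -/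
lemma card_col_word_lt {u : Fin n → ℕ}
    (hu : ∀ x y, cellCol μ h x = cellCol μ h y → u x = u y → x = y) (c j : ℕ) :
    #{x | cellCol μ h x = c ∧ u x < j} ≤ #{x | cellCol μ h x = c ∧ cellRow μ h x < j} := by
  rw [card_col_row_lt, le_min_iff]
  constructor
  · rw [← Finset.card_range j]
    refine Finset.card_le_card_of_injOn u ?_ ?_
    · intro x hx
      simp only [coe_filter, mem_univ, true_and, Set.mem_ofPred_eq] at hx
      simpa using hx.2
    · intro x hx y hy hxy
      simp only [coe_filter, mem_univ, true_and, Set.mem_ofPred_eq] at hx hy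
      exact hu x y (hx.1.trans hy.1.symm) hxy
  · have h1 := card_col_row_lt μ h c (μ.colLen c)
    rw [min_self] at h1
    rw [← h1]
    refine Finset.card_le_card fun x hx => ?_
    simp only [mem_filter, mem_univ, true_and] at hx ⊢
    refine ⟨hx.1, ?_⟩
    rw [← hx.1]
    exact cellRow_lt_colLen μ h x

lemma card_filter_eq_sum_cols (p : Fin n → Prop) [DecidablePred p] :
    #{x | p x} = ∑ c ∈ univ.image (cellCol μ h), #{x | cellCol μ h x = c ∧ p x} := by
  rw [Finset.card_eq_sum_card_fiberwise (f := cellCol μ h) (t := univ.image (cellCol μ h))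
    (fun x _ => by simp)]
  refine Finset.sum_congr rfl fun c _ => ?_
  rw [Finset.filter_filter]
  simp only [and_comm]

/-- A word that is injective on columns has a content dominated by the shape. -/
lemma card_word_lt_le {u : Fin n → ℕ}
    (hu : ∀ x y, cellCol μ h x = cellCol μ h y → u x = u y → x = y) (j : ℕ) :
    #{x | u x < j} ≤ #{x | cellRow μ h x < j} := by
  rw [card_filter_eq_sum_cols (μ := μ) (h := h), card_filter_eq_sum_cols (μ := μ) (h := h)]
  exact Finset.sum_le_sum fun c _ => card_col_word_lt hu c j

/-- Equality of the totals forces equality in every column. With j the length of the column, every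
cell has row number below j, hence so has every letter. -/
lemma word_lt_colLen {u : Fin n → ℕ}
    (hu : ∀ x y, cellCol μ h x = cellCol μ h y → u x = u y → x = y)
    (heq : ∀ j, #{x | u x < j} = #{x | cellRow μ h x < j}) (x : Fin n) :
    u x < μ.colLen (cellCol μ h x) := by
  set c := cellCol μ h x with hc
  set j := μ.colLen c
  have h1 := heq j
  rw [card_filter_eq_sum_cols (μ := μ) (h := h),
    card_filter_eq_sum_cols (μ := μ) (h := h) (fun x => cellRow μ h x < j)] at h1
  have h2 := (Finset.sum_eq_sum_iff_of_le fun c _ => card_col_word_lt hu c j).1 h1 c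
    (by simp [hc])
  have h3 : ({y | cellCol μ h y = c ∧ u y < j} : Finset (Fin n)) =
      ({y | cellCol μ h y = c ∧ cellRow μ h y < j} : Finset (Fin n)) := by
    refine Finset.eq_of_subset_of_card_le (fun y hy => ?_) h2.ge
    simp only [mem_filter, mem_univ, true_and] at hy ⊢
    refine ⟨hy.1, ?_⟩
    have := cellRow_lt_colLen μ h y
    rwa [hy.1] at this
  have h4 : x ∈ ({y | cellCol μ h y = c ∧ cellRow μ h y < j} : Finset (Fin n)) := by
    simp only [mem_filter, mem_univ, true_and]
    exact ⟨rfl, cellRow_lt_colLen μ h x⟩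
  rw [← h3] at h4
  simp only [mem_filter, mem_univ, true_and] at h4
  exact h4.2

lemma mem_rowGroup {p : Equiv.Perm (Fin n)} :
    p ∈ rowGroup μ h ↔ ∀ x, cellRow μ h (p x) = cellRow μ h x := by
  simp [rowGroup, cellRow]

lemma mem_columnGroup {p : Equiv.Perm (Fin n)} :
    p ∈ columnGroup μ h ↔ ∀ x, cellCol μ h (p x) = cellCol μ h x := by
  simp [columnGroup, cellCol]

variable (μ h)

/-- For the dichotomy, consider the word giving the row of the image of each cell under g. If it is
injective on columns, its content is the shape and each column can be sorted within itself, which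
factors g as p q. If not, two cells of one column are sent to one row, and the transposition of
their images serves as t. -/
theorem isSymmetrizerPair_young :
    IsSymmetrizerPair (rowGroup μ h) (columnGroup μ h) Equiv.Perm.sign where
  one_left := by simp [mem_rowGroup]
  one_right := by simp [mem_columnGroup]
  mul_left p hp g := by
    simp only [mem_rowGroup, Equiv.Perm.mul_apply] at *
    simp only [hp]
  mul_right q hq g := by
    simp only [mem_columnGroup, Equiv.Perm.mul_apply] at *
    constructor
    · intro hg x
      have h1 := hg (q.symm x)
      have h2 := hq (q.symm x)
      rw [Equiv.apply_symm_apply] at h1 h2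
      rw [h1, h2]
    · intro hg x
      rw [hg, hq]
  inter g hg hg' := by
    rw [mem_rowGroup] at hg
    rw [mem_columnGroup] at hg'
    ext1 x
    exact cell_ext μ h (hg x) (hg' x)
  dichotomy g := by
    by_cases hu : ∀ x y, cellCol μ h x = cellCol μ h y →
        cellRow μ h (g x) = cellRow μ h (g y) → x = y
    · left
      have heq : ∀ j, #{x | cellRow μ h (g x) < j} = #{x | cellRow μ h x < j} := by
        intro j
        refine Finset.card_bij (fun x _ => g x) ?_ ?_ ?_
        · simp
        · intro a _ b _ hab; exact g.injective hab
        · intro b hb; exact ⟨g.symm b, by simpa using hb, by simp⟩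
      have hlt := word_lt_colLen (u := fun x => cellRow μ h (g x)) hu heq
      -- q moves each cell within its column to the row that g prescribes, so g q⁻¹ preserves rows.
      let q₀ : Fin n → Fin n := fun x => cellIndex μ h _ _ (hlt x)
      have hr : ∀ x, cellRow μ h (q₀ x) = cellRow μ h (g x) := fun x => by simp [q₀]
      have hc : ∀ x, cellCol μ h (q₀ x) = cellCol μ h x := fun x => by simp [q₀]
      have hinj : Function.Injective q₀ := by
        intro x y hxy
        exact hu x y (by rw [← hc, hxy, hc]) (by rw [← hr, hxy, hr])
      let q : Equiv.Perm (Fin n) := Equiv.ofBijective q₀ (Finite.injective_iff_bijective.1 hinj)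
      have hq : ∀ x, q x = q₀ x := fun x => rfl
      refine ⟨g * q⁻¹, ?_, q, ?_, by simp⟩
      · rw [mem_rowGroup]
        intro x
        have := hr (q.symm x)
        rw [← hq, Equiv.apply_symm_apply] at this
        rw [this]; rfl
      · rw [mem_columnGroup]; exact hc
    · right
      push Not at hu
      obtain ⟨x, y, hc, hr, hne⟩ := hu
      refine ⟨Equiv.swap (g x) (g y), ?_, ?_⟩
      · rw [mem_rowGroup]
        intro z
        rw [Equiv.swap_apply_def]
        split_ifs with h1 h2
        · rw [h1, hr]
        · rw [h2, hr]
        · rfl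
      · have e : g⁻¹ * Equiv.swap (g x) (g y) * g = Equiv.swap x y := by
          rw [mul_assoc, Equiv.swap_mul_eq_mul_swap]
          simp
        rw [e]
        refine ⟨?_, Equiv.Perm.sign_swap hne⟩
        rw [mem_columnGroup]
        intro z
        rw [Equiv.swap_apply_def]
        split_ifs with h1 h2
        · rw [h1, hc]
        · rw [h2, hc]
        · rfl

/-- The bead positions `λ_i + (L - 1 - i)`. -/
def beads (μ : YoungDiagram) (L : ℕ) (i : Fin L) : ℕ := μ.rowLen i + staircase L i

lemma beads_strictAnti (L : ℕ) : StrictAnti (beads μ L) := by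
  intro i j hij
  have h1 := μ.rowLen_anti i j (le_of_lt hij)
  have h2 := staircase_strictAnti L hij
  unfold beads
  omega

lemma card_cellRow_eq (i : ℕ) : #{x | cellRow μ h x = i} = μ.rowLen i := by
  rw [← Finset.card_range (μ.rowLen i)]
  symm
  have key : ∀ {j}, j < μ.rowLen i → i < μ.colLen j := fun hj =>
    YoungDiagram.mem_iff_lt_colLen.1 (YoungDiagram.mem_iff_lt_rowLen.2 hj)
  refine Finset.card_bij (fun j hj => cellIndex μ h i j (key (Finset.mem_range.1 hj))) ?_ ?_ ?_
  · intro j hj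
    simp
  · intro j hj j' hj' hij
    have := congrArg (cellCol μ h) hij
    simpa using this
  · intro x hx
    simp only [mem_filter, mem_univ, true_and] at hx
    have h1 := cellCol_lt_rowLen μ h x
    rw [hx] at h1
    refine ⟨cellCol μ h x, Finset.mem_range.2 h1, ?_⟩
    apply cell_ext μ h <;> simp [hx]

variable {L : ℕ} (hL : μ.colLen 0 ≤ L)

include hL in
lemma cellRow_lt (x : Fin n) : cellRow μ h x < L :=
  (cellRow_lt_colLen μ h x).trans_le ((μ.colLen_anti 0 _ (Nat.zero_le _)).trans hL)

/-- The word that spells the row of each cell. -/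
def rowWord (x : Fin n) : Fin L := ⟨cellRow μ h x, cellRow_lt μ h hL x⟩

lemma letterCount_rowWord (i : Fin L) : letterCount (rowWord μ h hL) i = μ.rowLen i := by
  rw [← card_cellRow_eq μ h, letterCount]
  congr 1
  ext x
  simp [rowWord, Fin.ext_iff]

include h hL in
lemma sum_rowLen : ∑ i : Fin L, μ.rowLen i = n := by
  simp only [← letterCount_rowWord μ h hL]
  rw [sum_letterCount, Fintype.card_fin]

include h hL in
lemma sum_beads : ∑ i, beads μ L i = n + ∑ i, staircase L i := by
  simp only [beads, Finset.sum_add_distrib, sum_rowLen μ h hL]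

lemma card_word_lt_eq_sum (u : Fin n → Fin L) (j : ℕ) :
    #{x | (u x : ℕ) < j} = ∑ i ∈ univ.filter fun i : Fin L => (i : ℕ) < j, letterCount u i := by
  rw [Finset.card_eq_sum_card_fiberwise (f := u) (t := univ.filter fun i : Fin L => (i : ℕ) < j)
    (fun x hx => by simpa using hx)]
  refine Finset.sum_congr rfl fun i hi => ?_
  simp only [mem_filter, mem_univ, true_and] at hi
  rw [Finset.filter_filter, letterCount]
  congr 1
  ext x
  simp only [mem_filter, mem_univ, true_and, and_iff_right_iff_imp]
  rintro rfl; exact hi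

/-- The staircase is strictly decreasing, so a rearrangement whose initial sums are at least as
large must fix the positions one after another. -/
lemma perm_eq_one_of_staircase_le {L : ℕ} {w : Equiv.Perm (Fin L)}
    (hw : ∀ j, ∑ i ∈ univ.filter fun i : Fin L => (i : ℕ) < j, staircase L i ≤
      ∑ i ∈ univ.filter fun i : Fin L => (i : ℕ) < j, staircase L (w i)) : w = 1 := by
  have key : ∀ j (hj : j < L), (∀ i : Fin L, (i : ℕ) < j → w i = i) → w ⟨j, hj⟩ = ⟨j, hj⟩ := by
    intro j hj ih
    have h1 := hw (j + 1)
    have e : (univ.filter fun i : Fin L => (i : ℕ) < j + 1) =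
        insert ⟨j, hj⟩ (univ.filter fun i : Fin L => (i : ℕ) < j) := by
      ext i; simp only [mem_filter, mem_univ, true_and, mem_insert, Fin.ext_iff]; omega
    rw [e, Finset.sum_insert (by simp), Finset.sum_insert (by simp)] at h1
    have e2 : ∑ i ∈ univ.filter fun i : Fin L => (i : ℕ) < j, staircase L (w i) =
        ∑ i ∈ univ.filter fun i : Fin L => (i : ℕ) < j, staircase L i := by
      refine Finset.sum_congr rfl fun i hi => ?_
      rw [ih i (by simpa using hi)]
    rw [e2] at h1
    have h2 : w ⟨j, hj⟩ ≤ ⟨j, hj⟩ := by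
      rw [← (staircase_strictAnti L).le_iff_ge]; omega
    rcases lt_or_eq_of_le h2 with h3 | h3
    · have := ih (w ⟨j, hj⟩) h3
      exact w.injective this
    · exact h3
  have all : ∀ j, ∀ i : Fin L, (i : ℕ) < j → w i = i := by
    intro j
    induction j with
    | zero => intro i hi; omega
    | succ j ih =>
      intro i hi
      rcases Nat.lt_succ_iff_lt_or_eq.1 hi with h1 | h1
      · exact ih i h1
      · have := key j (by have := i.2; omega) ih
        have e : i = ⟨j, by have := i.2; omega⟩ := Fin.ext h1
        rw [e, this]
  ext1 i
  simpa using all L i i.2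

lemma exists_perm_of_letterCount_eq {T : Type*} [Fintype T] [DecidableEq T] {u v : Fin n → T}
    (huv : letterCount u = letterCount v) : ∃ g : Equiv.Perm (Fin n), v ∘ g = u := by
  have hcard : ∀ t, Nonempty ({x // u x = t} ≃ {x // v x = t}) := by
    intro t
    refine ⟨Fintype.equivOfCardEq ?_⟩
    rw [Fintype.card_subtype, Fintype.card_subtype]
    exact congrFun huv t
  let f' : ∀ t, {x // u x = t} ≃ {x // v x = t} := fun t => (hcard t).some
  let g : Equiv.Perm (Fin n) :=
    (Equiv.sigmaFiberEquiv u).symm.trans ((Equiv.sigmaCongrRight f').trans (Equiv.sigmaFiberEquiv v))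
  refine ⟨g, ?_⟩
  ext1 x
  exact (f' (u x) ⟨x, rfl⟩).2

/-- Perturbing by an odd column permutation that fixes the word kills the symmetrizer. -/
lemma sum_coeff_fixed_eq_zero {T : Type*} [DecidableEq T] {u : Fin n → T} {x y : Fin n}
    (hxy : x ≠ y) (hc : cellCol μ h x = cellCol μ h y) (hu : u x = u y) :
    ∑ σ ∈ univ.filter (fun σ : Equiv.Perm (Fin n) => u ∘ ⇑σ = u),
      symmetrizerCoeff (rowGroup μ h) (columnGroup μ h) Equiv.Perm.sign σ = 0 := by
  have hp := isSymmetrizerPair_young μ h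
  set t := Equiv.swap x y with ht
  have ht1 : t ∈ columnGroup μ h := by
    rw [mem_columnGroup]
    intro z
    rw [ht, Equiv.swap_apply_def]
    split_ifs with h1 h2
    · rw [h1, hc]
    · rw [h2, hc]
    · rfl
  have ht2 : u ∘ t = u := by
    ext1 z
    rw [ht, Function.comp_apply, Equiv.swap_apply_def]
    split_ifs with h1 h2
    · rw [h1, hu]
    · rw [h2, hu]
    · rfl
  have hneg : ∑ σ ∈ univ.filter (fun σ : Equiv.Perm (Fin n) => u ∘ ⇑σ = u),
      symmetrizerCoeff (rowGroup μ h) (columnGroup μ h) Equiv.Perm.sign σ =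
      ∑ σ ∈ univ.filter (fun σ : Equiv.Perm (Fin n) => u ∘ ⇑σ = u),
      -symmetrizerCoeff (rowGroup μ h) (columnGroup μ h) Equiv.Perm.sign σ := by
    have hmem : ∀ σ : Equiv.Perm (Fin n), u ∘ σ = u → u ∘ (σ * t : Equiv.Perm (Fin n)) = u := by
      intro σ hσ
      rw [Equiv.Perm.coe_mul, ← Function.comp_assoc, hσ, ht2]
    refine Finset.sum_nbij' (fun σ => σ * t) (fun σ => σ * t) ?_ ?_ ?_ ?_ ?_
    · intro σ hσ
      simp only [mem_filter, mem_univ, true_and] at hσ ⊢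
      exact hmem σ hσ
    · intro σ hσ
      simp only [mem_filter, mem_univ, true_and] at hσ ⊢
      exact hmem σ hσ
    · intro σ _; simp [ht, mul_assoc]
    · intro σ _; simp [ht, mul_assoc]
    · intro σ _
      rw [hp.coeff_mul_right ht1, ht, Equiv.Perm.sign_swap hxy]
      push_cast; ring
  rw [Finset.sum_neg_distrib] at hneg
  linarith

/-- The words of the given content are the rearrangements v ∘ g of the row word v, each obtained |P|
times. The stabilizer of v ∘ g is g⁻¹Pg, so `sum_sum_left_conj` evaluates the sum. -/
lemma sum_coeff_fixed_words :
    ∑ u : Fin n → Fin L with letterCount u = letterCount (rowWord μ h hL),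
      ∑ σ ∈ univ.filter (fun σ : Equiv.Perm (Fin n) => u ∘ ⇑σ = u),
        symmetrizerCoeff (rowGroup μ h) (columnGroup μ h) Equiv.Perm.sign σ =
      symmetrizerScalar (rowGroup μ h) (columnGroup μ h) Equiv.Perm.sign := by
  have hp := isSymmetrizerPair_young μ h
  set v := rowWord μ h hL with hv
  set F : (Fin n → Fin L) → ℝ := fun u => ∑ σ ∈ univ.filter (fun σ : Equiv.Perm (Fin n) => u ∘ ⇑σ = u),
        symmetrizerCoeff (rowGroup μ h) (columnGroup μ h) Equiv.Perm.sign σ with hF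
  have hstab : ∀ p : Equiv.Perm (Fin n), v ∘ p = v ↔ p ∈ rowGroup μ h := by
    intro p
    rw [mem_rowGroup, funext_iff]
    refine forall_congr' fun x => ?_
    simp [hv, rowWord, Fin.ext_iff]
  have hP : (#(rowGroup μ h) : ℝ) ≠ 0 := by
    have : 0 < #(rowGroup μ h) := Finset.card_pos.2 ⟨1, hp.one_left⟩
    positivity
  have h1 : ∑ g : Equiv.Perm (Fin n), F (v ∘ g) =
      #(rowGroup μ h) * ∑ u : Fin n → Fin L with letterCount u = letterCount v, F u := by
    rw [← Finset.sum_fiberwise_of_maps_to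
      (t := univ.filter fun u : Fin n → Fin L => letterCount u = letterCount v)
      (g := fun g : Equiv.Perm (Fin n) => v ∘ g)
      (fun g _ => by simpa using letterCount_comp_equiv g v), Finset.mul_sum]
    refine Finset.sum_congr rfl fun u hu => ?_
    simp only [mem_filter, mem_univ, true_and] at hu
    obtain ⟨g₀, hg₀⟩ := exists_perm_of_letterCount_eq hu
    rw [Finset.sum_congr rfl (g := fun _ => F u)
      (fun g hg => by rw [(Finset.mem_filter.1 hg).2]), Finset.sum_const, nsmul_eq_mul]
    congr 2
    -- The rearrangements producing a given word form a coset of the row group.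
    refine Finset.card_bij' (fun g _ => g * g₀⁻¹) (fun p _ => p * g₀) ?_ ?_ ?_ ?_
    · intro g hg
      simp only [mem_filter, mem_univ, true_and] at hg
      rw [← hstab]
      ext1 x
      have e1 := congrFun hg (g₀⁻¹ x)
      have e2 := congrFun hg₀ (g₀⁻¹ x)
      simp only [Function.comp_apply, Equiv.Perm.mul_apply] at e1 e2 ⊢
      rw [e1, ← e2]; simp
    · intro p hp'
      rw [← hstab] at hp'
      simp only [mem_filter, mem_univ, true_and]
      rw [Equiv.Perm.coe_mul, ← Function.comp_assoc, hp', hg₀]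
    · intro g _; simp
    · intro p _; simp
  have h2 : ∑ g : Equiv.Perm (Fin n), F (v ∘ g) =
      ∑ g : Equiv.Perm (Fin n), ∑ p ∈ rowGroup μ h,
        symmetrizerCoeff (rowGroup μ h) (columnGroup μ h) Equiv.Perm.sign (g⁻¹ * p * g) := by
    refine Finset.sum_congr rfl fun g _ => ?_
    refine Finset.sum_bij' (fun σ _ => g * σ * g⁻¹) (fun p _ => g⁻¹ * p * g) ?_ ?_ ?_ ?_ ?_
    · intro σ hσ
      simp only [mem_filter, mem_univ, true_and] at hσ
      rw [← hstab]
      ext1 x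
      have e1 := congrFun hσ (g⁻¹ x)
      simp only [Function.comp_apply, Equiv.Perm.mul_apply] at e1 ⊢
      rw [e1]; simp
    · intro p hp'
      rw [← hstab] at hp'
      simp only [mem_filter, mem_univ, true_and]
      ext1 x
      have e1 := congrFun hp' (g x)
      simp only [Function.comp_apply, Equiv.Perm.mul_apply] at e1 ⊢
      rw [← e1]; simp
    · intro σ _; group
    · intro p _; group
    · intro σ _; congr 1; group
  rw [h1, hp.sum_sum_left_conj] at h2
  exact mul_left_cancel₀ hP h2

/-- Words that repeat a letter in a column are killed by an odd column transposition. The content of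
any other word is dominated by the shape, which leaves only w = 1 in the alternating sum and only
words whose content is the shape. -/
lemma sum_coeff_mul_alternantChar (hL : μ.colLen 0 ≤ L) :
    ∑ σ : Equiv.Perm (Fin n), symmetrizerCoeff (rowGroup μ h) (columnGroup μ h) Equiv.Perm.sign σ *
      alternantChar (beads μ L) σ =
      symmetrizerScalar (rowGroup μ h) (columnGroup μ h) Equiv.Perm.sign := by
  set c := symmetrizerCoeff (rowGroup μ h) (columnGroup μ h) Equiv.Perm.sign with hc
  have h1 : ∑ σ : Equiv.Perm (Fin n), c σ * alternantChar (beads μ L) σ =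
      ∑ u : Fin n → Fin L, altSub (beads μ L) (letterCount u) *
        ∑ σ ∈ univ.filter (fun σ : Equiv.Perm (Fin n) => u ∘ ⇑σ = u), c σ := by
    simp only [alternantChar, Finset.mul_sum, Finset.sum_filter]
    rw [Finset.sum_comm]
    refine Finset.sum_congr rfl fun u _ => Finset.sum_congr rfl fun σ _ => ?_
    split_ifs <;> ring
  rw [h1, ← sum_coeff_fixed_words μ h hL, Finset.sum_filter]
  refine Finset.sum_congr rfl fun u _ => ?_
  by_cases hu : ∀ x y, cellCol μ h x = cellCol μ h y → (u x : ℕ) = u y → x = y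
  · have hw : ∀ w : Equiv.Perm (Fin L),
        (∀ i, staircase L (w i) + letterCount u i = beads μ L i) → w = 1 := by
      intro w hw
      refine perm_eq_one_of_staircase_le fun j => ?_
      have h2 := card_word_lt_le hu j
      have h3 := card_word_lt_eq_sum (rowWord μ h hL) j
      rw [card_word_lt_eq_sum] at h2
      have e : #{x | cellRow μ h x < j} = #{x | ((rowWord μ h hL x : Fin L) : ℕ) < j} := rfl
      rw [e, h3] at h2
      have h4 : ∑ i ∈ univ.filter (fun i : Fin L => (i : ℕ) < j), staircase L (w i) +
          ∑ i ∈ univ.filter (fun i : Fin L => (i : ℕ) < j), letterCount u i =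
          ∑ i ∈ univ.filter (fun i : Fin L => (i : ℕ) < j), μ.rowLen i +
          ∑ i ∈ univ.filter (fun i : Fin L => (i : ℕ) < j), staircase L i := by
        rw [← Finset.sum_add_distrib, ← Finset.sum_add_distrib]
        exact Finset.sum_congr rfl fun i _ => hw i
      simp only [letterCount_rowWord] at h2
      omega
    have h5 : altSub (beads μ L) (letterCount u) =
        if letterCount u = letterCount (rowWord μ h hL) then 1 else 0 := by
      rw [altSub_eq_sum, Finset.sum_eq_single 1]
      · have : (∀ i, staircase L ((1 : Equiv.Perm (Fin L)) i) + letterCount u i = beads μ L i) ↔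
            letterCount u = letterCount (rowWord μ h hL) := by
          rw [funext_iff]
          refine forall_congr' fun i => ?_
          rw [letterCount_rowWord]
          simp only [beads, Equiv.Perm.coe_one, id]
          omega
        simp only [this]
        simp
      · intro w _ hne
        rw [if_neg, mul_zero]
        exact fun hh => hne (hw w hh)
      · simp
    rw [h5]
    split_ifs <;> simp [hc]
  · push Not at hu
    obtain ⟨x, y, hcol, hux, hne⟩ := hu
    have h6 := sum_coeff_fixed_eq_zero μ h hne hcol (Fin.ext hux)
    simp [hc, h6]

end Young

/-! ### Identification of the Specht character. -/

lemma classFunction_inv {n : ℕ} {F : Equiv.Perm (Fin n) → ℝ}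
    (hF : ∀ g σ, F (g * σ * g⁻¹) = F σ) (σ : Equiv.Perm (Fin n)) : F σ⁻¹ = F σ := by
  have : IsConj σ σ⁻¹ := by
    rw [Equiv.Perm.isConj_iff_cycleType_eq, Equiv.Perm.cycleType_inv]
  obtain ⟨g, hg⟩ := isConj_iff.1 this
  rw [← hg, hF]

lemma sum_mul_sum_conj {n : ℕ} {F : Equiv.Perm (Fin n) → ℝ}
    (hF : ∀ g σ, F (g * σ * g⁻¹) = F σ) (c : Equiv.Perm (Fin n) → ℝ) :
    ∑ σ, F σ * ∑ g, c (g * σ⁻¹ * g⁻¹) = n.factorial * ∑ σ, c σ * F σ := by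
  simp only [Finset.mul_sum]
  rw [Finset.sum_comm]
  have : ∀ g : Equiv.Perm (Fin n), ∑ σ, F σ * c (g * σ⁻¹ * g⁻¹) = ∑ σ, c σ * F σ := by
    intro g
    rw [← Equiv.sum_comp ((Equiv.inv (Equiv.Perm (Fin n))).trans (MulAut.conj g).toEquiv)
      (fun σ => c σ * F σ)]
    refine Finset.sum_congr rfl fun σ _ => ?_
    simp only [Equiv.trans_apply, Equiv.inv_apply, MulEquiv.toEquiv_eq_coe, EquivLike.coe_coe,
      MulAut.conj_apply]
    rw [hF, classFunction_inv hF, mul_comm]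
  rw [Finset.sum_congr rfl fun g _ => this g, Finset.sum_const, Finset.card_univ,
    Fintype.card_perm, Fintype.card_fin, nsmul_eq_mul, Finset.mul_sum]

lemma alternantChar_conj {n L : ℕ} (M : Fin L → ℕ) (g σ : Equiv.Perm (Fin n)) :
    alternantChar M (g * σ * g⁻¹) = alternantChar M σ := by
  unfold alternantChar
  refine Finset.sum_bij' (fun u _ => u ∘ g) (fun u _ => u ∘ (g⁻¹ : Equiv.Perm (Fin n))) ?_ ?_ ?_ ?_ ?_
  · intro u hu
    simp only [mem_filter, mem_univ, true_and] at hu ⊢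
    ext1 x
    have := congrFun hu (g x)
    simpa using this
  · intro u hu
    simp only [mem_filter, mem_univ, true_and] at hu ⊢
    ext1 x
    have := congrFun hu (g⁻¹ x)
    simpa using this
  · intro u _; ext1 x; simp
  · intro u _; ext1 x; simp
  · intro u _; rw [letterCount_comp_equiv]

/-- The character of the Specht ideal is the alternating sum of permutation characters. -/
theorem spechtChar_eq_alternantChar (μ : YoungDiagram) {n : ℕ} (h : μ.card = n) {L : ℕ}
    (hL : μ.colLen 0 ≤ L) (σ : Equiv.Perm (Fin n)) :
    spechtChar μ h σ = ((alternantChar (beads μ L) σ : ℝ) : ℂ) := by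
  have hp := isSymmetrizerPair_young μ h
  set c := symmetrizerCoeff (rowGroup μ h) (columnGroup μ h) Equiv.Perm.sign with hc
  set κ := symmetrizerScalar (rowGroup μ h) (columnGroup μ h) Equiv.Perm.sign with hκ
  have hκ0 : κ ≠ 0 := hp.scalar_ne_zero
  set ψ : Equiv.Perm (Fin n) → ℝ := fun σ => κ⁻¹ * ∑ g, c (g * σ⁻¹ * g⁻¹) with hψ
  have hchar : spechtChar μ h σ = ((ψ σ : ℝ) : ℂ) := hp.character_ofModule' σ
  rw [hchar]
  congr 1
  have hψc : ∀ g σ, ψ (g * σ * g⁻¹) = ψ σ := by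
    intro g σ
    simp only [hψ]
    congr 1
    rw [← Equiv.sum_comp (Equiv.mulRight g) (fun x => c (x * σ⁻¹ * x⁻¹))]
    refine Finset.sum_congr rfl fun x _ => congrArg c ?_
    rw [Equiv.coe_mulRight]
    group
  have hinner : ∀ F : Equiv.Perm (Fin n) → ℝ, (∀ g σ, F (g * σ * g⁻¹) = F σ) →
      ∑ σ, F σ * ψ σ = κ⁻¹ * (n.factorial * ∑ σ, c σ * F σ) := by
    intro F hF
    rw [← sum_mul_sum_conj hF, Finset.mul_sum]
    refine Finset.sum_congr rfl fun σ _ => ?_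
    simp only [hψ]; ring
  have h1 : ∑ σ, alternantChar (beads μ L) σ * ψ σ = n.factorial := by
    rw [hinner _ (fun g σ => alternantChar_conj _ g σ), sum_coeff_mul_alternantChar μ h hL, ← hκ]
    field_simp
  have h2 : ∑ σ, ψ σ * ψ σ = n.factorial := by
    rw [hinner _ hψc]
    have h3 : ∑ σ, c σ * ψ σ = κ⁻¹ * κ ^ 2 := by
      rw [hκ, ← hp.sum_sum_coeff_conj, ← hκ, Finset.sum_comm, Finset.mul_sum]
      refine Finset.sum_congr rfl fun σ _ => ?_
      simp only [hψ]
      rw [← Finset.sum_mul]; ring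
    rw [h3]
    field_simp
  have h3 : ∑ σ : Equiv.Perm (Fin n), alternantChar (beads μ L) σ ^ 2 = n.factorial :=
    sum_sq_alternantChar (beads_strictAnti μ L) (sum_beads μ h hL)
  -- Both squared norms and the inner product equal n!, so the difference of the two real functions
  -- has norm zero.
  have h4 : ∑ σ : Equiv.Perm (Fin n), (ψ σ - alternantChar (beads μ L) σ) ^ 2 = 0 := by
    have : ∀ σ : Equiv.Perm (Fin n), (ψ σ - alternantChar (beads μ L) σ) ^ 2 =
        ψ σ * ψ σ - 2 * (alternantChar (beads μ L) σ * ψ σ) + alternantChar (beads μ L) σ ^ 2 :=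
      fun σ => by ring
    simp only [this, Finset.sum_add_distrib, Finset.sum_sub_distrib, ← Finset.mul_sum, h1, h2, h3]
    ring
  have h5 := (Finset.sum_eq_zero_iff_of_nonneg fun σ _ => sq_nonneg _).1 h4 σ (mem_univ σ)
  have := pow_eq_zero_iff (two_ne_zero) |>.1 h5
  linarith

/-- Frobenius' formula for the normalized character on a `k`-cycle, as a sum over beads. -/
theorem spechtChar_div_spechtDim (μ : YoungDiagram) {n : ℕ} (h : μ.card = n) {L k : ℕ}
    (hL : μ.colLen 0 ≤ L) (hk : 0 < k) {σ : Equiv.Perm (Fin n)} (hσ : IsKCycle k σ) :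
    spechtChar μ h σ / spechtDim μ h = (((n.descFactorial k : ℝ)⁻¹ *
      ∑ i, ((beads μ L i).descFactorial k : ℝ) *
        ∏ j ∈ univ.erase i, (((beads μ L i : ℝ) - k - beads μ L j) /
          ((beads μ L i : ℝ) - beads μ L j)) : ℝ) : ℂ) := by
  have hcardle : k ≤ n := by
    rw [← hσ.2]; simpa using Finset.card_le_univ σ.support
  have h0 := alternantChar_one_ne_zero (beads_strictAnti μ L) (sum_beads μ h hL)
  have h1 := descFactorial_mul_alternantChar_cycle hk (beads_strictAnti μ L) (sum_beads μ h hL) hσ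
  have h2 : (n.descFactorial k : ℝ) ≠ 0 := by
    exact_mod_cast (Nat.descFactorial_pos.2 hcardle).ne'
  rw [spechtDim, spechtChar_eq_alternantChar μ h hL, spechtChar_eq_alternantChar μ h hL,
    ← Complex.ofReal_div]
  congr 1
  rw [div_eq_iff h0, mul_assoc, mul_comm (Finset.sum _ _), ← h1]
  field_simp

/-! ### Rational functions of z as power series in X = 1/z, and partial fractions. -/

section SeriesAlgebra

open PowerSeries

/-- The geometric series `1 / (1 - x X)`. -/
def geomSeries (x : ℝ) : PowerSeries ℝ := PowerSeries.mk fun d => x ^ d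

/-- The polynomial `∏ t < k, (1 - ρ t X)` as a power series. -/
def rootSeries (ρ : ℕ → ℝ) (k : ℕ) : PowerSeries ℝ := ∏ t ∈ range k, (1 - C (ρ t) * X)

@[simp] lemma coeff_geomSeries (x : ℝ) (d : ℕ) : coeff d (geomSeries x) = x ^ d := by
  simp [geomSeries]

lemma lin_mul_geomSeries (x : ℝ) : (1 - C x * X) * geomSeries x = 1 := by
  ext d
  rw [sub_mul, one_mul, mul_assoc, map_sub, coeff_C_mul, mul_comm X]
  cases d with
  | zero => simp [geomSeries]
  | succ d => rw [coeff_succ_mul_X]; simp [coeff_one, pow_succ']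

/-- `X * geomSeries x` stands for 1/(z - x), and this is the partial fraction identity for two
poles. -/
lemma X_mul_geomSeries_mul (x y : ℝ) :
    C (x - y) * ((X * geomSeries x) * (X * geomSeries y)) = X * geomSeries x - X * geomSeries y := by
  have hx := lin_mul_geomSeries x
  have hy := lin_mul_geomSeries y
  rw [map_sub]
  linear_combination (X * geomSeries x) * hy - (X * geomSeries y) * hx

lemma lin_mul_geomSeries' (x y : ℝ) :
    (1 - C x * X) * geomSeries y = 1 + C (y - x) * (X * geomSeries y) := by
  have hy := lin_mul_geomSeries y
  rw [map_sub]
  linear_combination hy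

lemma rootSeries_succ (ρ : ℕ → ℝ) (k : ℕ) :
    rootSeries ρ (k + 1) = rootSeries ρ k - C (ρ k) * (rootSeries ρ k * X) := by
  rw [rootSeries, prod_range_succ, ← rootSeries]; ring

/-- From degree k on, a polynomial of degree k over 1 - xX has geometric coefficients, whose
amplitude is the residue at z = x. -/
lemma coeff_rootSeries_mul_geomSeries (ρ : ℕ → ℝ) (k : ℕ) (x : ℝ) (d : ℕ) :
    coeff (k + d) (rootSeries ρ k * geomSeries x) = x ^ d * ∏ t ∈ range k, (x - ρ t) := by
  induction k generalizing d with
  | zero => simp [rootSeries]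
  | succ k ih =>
    have e : rootSeries ρ (k + 1) * geomSeries x =
        rootSeries ρ k * geomSeries x - C (ρ k) * ((rootSeries ρ k * geomSeries x) * X) := by
      rw [rootSeries_succ]; ring
    rw [e, map_sub, coeff_C_mul, show k + 1 + d = (k + d) + 1 by ring, coeff_succ_mul_X, ih,
      show k + d + 1 = k + (d + 1) by ring, ih, prod_range_succ]
    ring

lemma coeff_rootSeries_of_lt (ρ : ℕ → ℝ) {k d : ℕ} (h : k < d) :
    coeff d (rootSeries ρ k) = 0 := by
  induction k generalizing d with
  | zero => simp [rootSeries, coeff_one, h.ne']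
  | succ k ih =>
    obtain ⟨d, rfl⟩ : ∃ e, d = e + 1 := ⟨d - 1, by omega⟩
    rw [rootSeries_succ, map_sub, coeff_C_mul, coeff_succ_mul_X, ih (by omega), ih (by omega)]
    simp

/-- Partial fractions for a product of factors `1 - k / (z - x i)`, in any algebra where the
elements `u i` multiply like `1 / (z - x i)`. -/
theorem prod_one_sub_eq_partialFractions {ι : Type} [DecidableEq ι] (k : ℝ) (x : ι → ℝ)
    (s : Finset ι) : Set.InjOn x s →
    ∀ (A : Type) [CommRing A] [Algebra ℝ A] (u : ι → A),
      (∀ i ∈ s, ∀ j ∈ s, (x i - x j) • (u i * u j) = u i - u j) →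
      ∏ i ∈ s, (1 - k • u i) =
        1 - k • ∑ i ∈ s, (∏ j ∈ s.erase i, (x i - k - x j) / (x i - x j)) • u i := by
  induction s using Finset.induction_on with
  | empty => intro _ A _ _ u _; simp
  | insert a s ha ih =>
    intro hinj A _ _ u hu
    have hinj' : Set.InjOn x s := hinj.mono (by simp)
    have hne : ∀ i ∈ s, x a - x i ≠ 0 := by
      intro i hi h0
      have := hinj (by simp) (by simp [hi]) (sub_eq_zero.1 h0)
      exact ha (this ▸ hi)
    set c : ι → ℝ := fun i => ∏ j ∈ s.erase i, (x i - k - x j) / (x i - x j) with hc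
    have hscalar : ∏ i ∈ s, (x a - k - x i) / (x a - x i) =
        1 - k * ∑ i ∈ s, c i * (x a - x i)⁻¹ := by
      -- The induction hypothesis is quantified over all algebras so that it may be evaluated at the
      -- real point z = x a, which gives the coefficient at the new pole.
      have := ih hinj' ℝ (fun i => (x a - x i)⁻¹) (by
        intro i hi j hj
        have h1 := hne i hi
        have h2 := hne j hj
        simp only [smul_eq_mul]
        field_simp
        ring)
      simp only [smul_eq_mul] at this
      rw [← this]
      refine prod_congr rfl fun i hi => ?_
      have := hne i hi
      field_simp
      ring
    have hcoef : ∀ i ∈ s, ∏ j ∈ (insert a s).erase i, (x i - k - x j) / (x i - x j) =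
        c i * (1 + k * (x a - x i)⁻¹) := by
      intro i hi
      have hia : a ≠ i := fun e => ha (e ▸ hi)
      rw [erase_insert_of_ne hia, prod_insert (by simp [ha]), mul_comm]
      congr 1
      have h1 := hne i hi
      have h2 : x i - x a ≠ 0 := fun e => h1 (by linarith)
      field_simp
      ring
    have huu : ∀ i ∈ s, u a * u i = (x a - x i)⁻¹ • u a - (x a - x i)⁻¹ • u i := by
      intro i hi
      rw [← smul_sub, ← hu a (by simp) i (by simp [hi]), smul_smul, inv_mul_cancel₀ (hne i hi),
        one_smul]
    rw [prod_insert ha, ih hinj' A u (fun i hi j hj => hu i (by simp [hi]) j (by simp [hj])),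
      sum_insert ha, erase_insert ha, hscalar,
      sum_congr (s₁ := s) rfl (fun i hi => congrArg (· • u i) (hcoef i hi))]
    change (1 - k • u a) * (1 - k • ∑ i ∈ s, c i • u i) = _
    have e1 : (1 - k • u a) * (1 - k • ∑ i ∈ s, c i • u i) =
        1 - k • u a - k • ∑ i ∈ s, c i • u i + (k * k) • ∑ i ∈ s, c i • (u a * u i) := by
      have : ∑ i ∈ s, c i • (u a * u i) = u a * ∑ i ∈ s, c i • u i := by
        rw [mul_sum]
        exact sum_congr rfl fun i _ => (mul_smul_comm _ _ _).symm
      rw [this]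
      simp only [Algebra.smul_def, map_mul]
      ring
    have e2 : ∑ i ∈ s, c i • (u a * u i) =
        (∑ i ∈ s, c i * (x a - x i)⁻¹) • u a - ∑ i ∈ s, (c i * (x a - x i)⁻¹) • u i := by
      rw [sum_smul, ← sum_sub_distrib]
      refine sum_congr rfl fun i hi => ?_
      rw [huu i hi, smul_sub, smul_smul, smul_smul]
    have e3 : ∑ i ∈ s, (c i * (1 + k * (x a - x i)⁻¹)) • u i =
        ∑ i ∈ s, c i • u i + k • ∑ i ∈ s, (c i * (x a - x i)⁻¹) • u i := by
      rw [smul_sum, ← sum_add_distrib]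
      refine sum_congr rfl fun i _ => ?_
      rw [smul_smul, ← add_smul]; congr 1; ring
    rw [e1, e2, e3]
    simp only [Algebra.smul_def, map_mul, map_sub, map_one]
    ring

/-- The factor `1 - k X / (1 - (a - k / 2) X)`. -/
def upFactor (k : ℕ) (a : ℝ) : PowerSeries ℝ := 1 - C (k : ℝ) * (X * geomSeries (a - k / 2))

/-- The factor `1 + k X / (1 - (k / 2 - b) X)`. -/
def downFactor (k : ℕ) (b : ℝ) : PowerSeries ℝ := 1 + C (k : ℝ) * (X * geomSeries (k / 2 - b))

lemma upFactor_eq (k : ℕ) (a : ℝ) :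
    upFactor k a = (1 - C (a + k / 2) * X) * geomSeries (a - k / 2) := by
  rw [lin_mul_geomSeries', upFactor, show a - (k : ℝ) / 2 - (a + k / 2) = -k by ring, map_neg]
  ring

lemma downFactor_eq (k : ℕ) (b : ℝ) :
    downFactor k b = (1 - C (-b - k / 2) * X) * geomSeries (-b + k / 2) := by
  rw [lin_mul_geomSeries', downFactor, show -b + (k : ℝ) / 2 - (-b - k / 2) = k by ring,
    show (k : ℝ) / 2 - b = -b + k / 2 by ring]

/-- A column coordinate b marks a vacancy at -b, so its factor removes the bead there. -/
lemma upFactor_neg_mul_downFactor (k : ℕ) (b : ℝ) : upFactor k (-b) * downFactor k b = 1 := by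
  rw [upFactor_eq, downFactor_eq]
  have h1 := lin_mul_geomSeries (-b + k / 2)
  have h2 := lin_mul_geomSeries (-b - k / 2)
  linear_combination ((1 - C (-b - k / 2) * X) * geomSeries (-b - k / 2)) * h1 + h2

lemma prod_upFactor_eq {ι : Type} [DecidableEq ι] (k : ℕ) (x : ι → ℝ) (s : Finset ι)
    (hx : Set.InjOn x s) :
    ∏ i ∈ s, upFactor k (x i) = 1 - C (k : ℝ) * ∑ i ∈ s,
      C (∏ j ∈ s.erase i, (x i - k - x j) / (x i - x j)) * (X * geomSeries (x i - k / 2)) := by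
  have := prod_one_sub_eq_partialFractions (k : ℝ) x s hx (PowerSeries ℝ)
    (fun i => X * geomSeries (x i - k / 2)) (by
      intro i _ j _
      have := X_mul_geomSeries_mul (x i - k / 2) (x j - k / 2)
      rw [sub_sub_sub_cancel_right] at this
      rw [← this, smul_eq_C_mul])
  simpa only [smul_eq_C_mul, upFactor] using this

/-- The coefficients beyond degree `k` of `∏ (1 - ρ t X) ∏ upFactor k (x i)`. -/
lemma coeff_rootSeries_mul_prod_upFactor {ι : Type} [DecidableEq ι] (ρ : ℕ → ℝ) (k : ℕ)
    (x : ι → ℝ) (s : Finset ι) (hx : Set.InjOn x s) (d : ℕ) :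
    coeff (k + d + 1) (rootSeries ρ k * ∏ i ∈ s, upFactor k (x i)) =
      -k * ∑ i ∈ s, (∏ j ∈ s.erase i, (x i - k - x j) / (x i - x j)) *
        ((x i - k / 2) ^ d * ∏ t ∈ range k, (x i - k / 2 - ρ t)) := by
  rw [prod_upFactor_eq k x s hx]
  have e : ∀ c : ι → ℝ, rootSeries ρ k * (1 - C (k : ℝ) * ∑ i ∈ s,
      C (c i) * (X * geomSeries (x i - k / 2))) =
      rootSeries ρ k - C (k : ℝ) *
        ∑ i ∈ s, C (c i) * ((rootSeries ρ k * geomSeries (x i - k / 2)) * X) := by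
    intro c
    rw [mul_sub, mul_one, mul_left_comm, mul_sum]
    congr 2
    exact sum_congr rfl fun i _ => by ring
  rw [e, map_sub, coeff_rootSeries_of_lt ρ (by omega), coeff_C_mul, map_sum]
  simp only [coeff_C_mul, coeff_succ_mul_X, coeff_rootSeries_mul_geomSeries]
  ring

/-- A string of consecutive vacancies acts by shifting the roots. -/
lemma rootSeries_mul_prod_upFactor (k L : ℕ) :
    rootSeries (fun t => (t : ℝ) - L + 1 / 2 - k / 2) k *
      ∏ s ∈ range L, upFactor k (-(s : ℝ) - 1 / 2) =
    rootSeries (fun t => (t : ℝ) + 1 / 2 - k / 2) k := by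
  set h : ℕ → PowerSeries ℝ := fun s => 1 - C ((k : ℝ) / 2 - 1 / 2 - s) * X with hh
  have hroot : ∀ M : ℕ, rootSeries (fun t => (t : ℝ) - M + 1 / 2 - k / 2) k =
      ∏ t ∈ range k, h (M + t) := by
    intro M
    rw [rootSeries, ← prod_range_reflect]
    refine prod_congr rfl fun t ht => ?_
    have : t < k := mem_range.1 ht
    rw [hh]
    have e : ((k - 1 - t : ℕ) : ℝ) = k - 1 - t := by
      rw [Nat.cast_sub (by omega), Nat.cast_sub (by omega)]; simp
    simp only [e]
    push_cast
    congr 3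
    ring
  -- Each factor is `h s / h (k + s)`, so a product over consecutive s telescopes.
  have hup : (∏ s ∈ range L, upFactor k (-(s : ℝ) - 1 / 2)) * ∏ s ∈ range L, h (k + s) =
      ∏ s ∈ range L, h s := by
    rw [← prod_mul_distrib]
    refine prod_congr rfl fun s _ => ?_
    rw [upFactor_eq, hh]
    have := lin_mul_geomSeries (-(s : ℝ) - 1 / 2 - k / 2)
    push_cast
    rw [show (k : ℝ) / 2 - 1 / 2 - (k + s) = -(s : ℝ) - 1 / 2 - k / 2 by ring,
      show (k : ℝ) / 2 - 1 / 2 - s = -(s : ℝ) - 1 / 2 + k / 2 by ring]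
    linear_combination (1 - C (-(s : ℝ) - 1 / 2 + k / 2) * X) * this
  have hunit : IsUnit (∏ s ∈ range L, h (k + s)) := by
    rw [IsUnit.prod_iff]
    intro s _
    exact IsUnit.of_mul_eq_one _ (lin_mul_geomSeries _)
  have h0 := hroot 0
  simp only [Nat.cast_zero, sub_zero, zero_add] at h0
  rw [hroot L, h0]
  refine hunit.mul_right_cancel ?_
  rw [mul_assoc, hup, mul_comm, ← prod_range_add, ← prod_range_add, add_comm]

end SeriesAlgebra

/-! ### Frobenius coordinates and the diagonal of the diagram. -/

section Diagonal

variable (μ : YoungDiagram)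

lemma lt_diagLen_iff {j : ℕ} : j < diagLen μ ↔ (j, j) ∈ μ := by
  have hex : ∃ t, (t, t) ∉ μ := by
    refine ⟨μ.colLen 0, fun h => ?_⟩
    have h1 : (μ.colLen 0, 0) ∈ μ := μ.up_left_mem le_rfl (Nat.zero_le _) h
    exact lt_irrefl _ (YoungDiagram.mem_iff_lt_colLen.1 h1)
  classical
  have hlt : ∀ i, (i, i) ∈ μ ↔ i < Nat.find hex := by
    intro i
    constructor
    · intro hi
      by_contra hle
      push Not at hle
      exact Nat.find_spec hex (μ.up_left_mem hle hle hi)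
    · intro hi
      simpa using Nat.find_min hex hi
  have hcard : diagLen μ = Nat.find hex := by
    rw [diagLen, ← card_range (Nat.find hex)]
    symm
    refine card_bij (fun i _ => (i, i)) ?_ ?_ ?_
    · intro i hi
      simp only [mem_filter, YoungDiagram.mem_cells, and_true]
      exact (hlt i).2 (mem_range.1 hi)
    · intro i _ j _ hij
      exact (Prod.ext_iff.1 hij).1
    · rintro ⟨i, j⟩ hij
      simp only [mem_filter, YoungDiagram.mem_cells] at hij
      obtain ⟨h1, rfl⟩ := hij
      exact ⟨i, mem_range.2 ((hlt i).1 h1), rfl⟩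
  rw [hcard, hlt]

lemma lt_rowLen_iff_lt_colLen {i j : ℕ} : j < μ.rowLen i ↔ i < μ.colLen j := by
  rw [← YoungDiagram.mem_iff_lt_colLen, ← YoungDiagram.mem_iff_lt_rowLen]

lemma lt_rowLen_self {j : ℕ} (h : j < diagLen μ) : j < μ.rowLen j :=
  YoungDiagram.mem_iff_lt_rowLen.1 ((lt_diagLen_iff μ).1 h)

lemma lt_colLen_self {j : ℕ} (h : j < diagLen μ) : j < μ.colLen j :=
  YoungDiagram.mem_iff_lt_colLen.1 ((lt_diagLen_iff μ).1 h)

lemma rowLen_le_self {j : ℕ} (h : diagLen μ ≤ j) : μ.rowLen j ≤ j := by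
  by_contra hlt
  push Not at hlt
  exact absurd ((lt_diagLen_iff μ).2 (YoungDiagram.mem_iff_lt_rowLen.2 hlt)) (by omega)

lemma diagLen_le_colLen_zero : diagLen μ ≤ μ.colLen 0 := by
  by_contra h
  push Not at h
  have := lt_colLen_self μ h
  have h2 := μ.colLen_anti 0 (μ.colLen 0) (Nat.zero_le _)
  omega

lemma half_le_frobA {j : ℕ} (h : j < diagLen μ) : 1 / 2 ≤ frobA μ j := by
  have : ((j + 1 : ℕ) : ℝ) ≤ μ.rowLen j := by exact_mod_cast lt_rowLen_self μ h
  push_cast at this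
  rw [frobA]; linarith

lemma half_le_frobB {j : ℕ} (h : j < diagLen μ) : 1 / 2 ≤ frobB μ j := by
  have : ((j + 1 : ℕ) : ℝ) ≤ μ.colLen j := by exact_mod_cast lt_colLen_self μ h
  push_cast at this
  rw [frobB]; linarith

lemma frobA_strictAnti : StrictAnti (frobA μ) := by
  intro i j hij
  have h1 : (μ.rowLen j : ℝ) ≤ μ.rowLen i := by exact_mod_cast μ.rowLen_anti i j hij.le
  have h2 : (i : ℝ) < j := by exact_mod_cast hij
  rw [frobA, frobA]; linarith

lemma frobB_strictAnti : StrictAnti (frobB μ) := by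
  intro i j hij
  have h1 : (μ.colLen j : ℝ) ≤ μ.colLen i := by exact_mod_cast μ.colLen_anti i j hij.le
  have h2 : (i : ℝ) < j := by exact_mod_cast hij
  rw [frobB, frobB]; linarith

/-- The two-sided description of the beads: rows below the diagonal are the gaps between the
negatives of the column coordinates. -/
lemma prod_frobA_mul_prod_frobB {M : Type*} [CommMonoid M] (Φ : ℝ → M) {L : ℕ}
    (hL : μ.colLen 0 ≤ L) :
    (∏ i ∈ range L, Φ (frobA μ i)) * ∏ j ∈ range (diagLen μ), Φ (-frobB μ j) =
      (∏ j ∈ range (diagLen μ), Φ (frobA μ j)) * ∏ s ∈ range L, Φ (-(s : ℝ) - 1 / 2) := by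
  have hm := (diagLen_le_colLen_zero μ).trans hL
  set m := diagLen μ with hm_def
  -- The L half-integer sites between -L and 0 are either vacancies, coming from the columns i < m,
  -- or beads, coming from the rows i ≥ m. The map g enumerates both kinds and permutes `range L`.
  set g : ℕ → ℕ := fun i => if i < m then μ.colLen i - i - 1 else i - μ.rowLen i with hg
  have hcol : ∀ i, μ.colLen i ≤ L := fun i => (μ.colLen_anti 0 i (Nat.zero_le _)).trans hL
  have hmaps : ∀ i ∈ range L, g i ∈ range L := by
    intro i hi
    rw [mem_range] at hi ⊢
    have := hcol i
    simp only [hg]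
    split_ifs <;> omega
  have hinj : Set.InjOn g (range L) := by
    have hmix : ∀ i j, i < m → m ≤ j → μ.colLen i - i - 1 ≠ j - μ.rowLen j := by
      intro i j hi hj
      have h1 := lt_colLen_self μ hi
      have h2 := rowLen_le_self μ hj
      have h3 := lt_rowLen_iff_lt_colLen μ (i := j) (j := i)
      omega
    intro i _ j _ hij
    simp only [hg] at hij
    split_ifs at hij with h1 h2 h2
    · have h3 := lt_colLen_self μ h1
      have h4 := lt_colLen_self μ h2
      rcases lt_trichotomy i j with h | h | h
      · have := μ.colLen_anti i j h.le; omega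
      · exact h
      · have := μ.colLen_anti j i h.le; omega
    · exact absurd hij (hmix i j h1 (by omega))
    · exact absurd hij.symm (hmix j i h2 (by omega))
    · have h3 := rowLen_le_self μ (show m ≤ i by omega)
      have h4 := rowLen_le_self μ (show m ≤ j by omega)
      rcases lt_trichotomy i j with h | h | h
      · have := μ.rowLen_anti i j h.le; omega
      · exact h
      · have := μ.rowLen_anti j i h.le; omega
  have hprod : ∏ s ∈ range L, Φ (-(s : ℝ) - 1 / 2) = ∏ i ∈ range L, Φ (-(g i : ℝ) - 1 / 2) := by
    have himg : (range L).image g = range L := by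
      refine eq_of_subset_of_card_le (image_subset_iff.2 hmaps) ?_
      rw [card_image_of_injOn hinj]
    conv_lhs => rw [← himg]
    rw [prod_image hinj]
  have hsplit : ∀ f : ℕ → M, ∏ i ∈ range L, f i = (∏ i ∈ range m, f i) * ∏ i ∈ Ico m L, f i :=
    fun f => (prod_range_mul_prod_Ico f hm).symm
  rw [hprod, hsplit, hsplit]
  have h1 : ∏ i ∈ range m, Φ (-(g i : ℝ) - 1 / 2) = ∏ i ∈ range m, Φ (-frobB μ i) := by
    refine prod_congr rfl fun i hi => ?_
    have hi := mem_range.1 hi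
    have := lt_colLen_self μ hi
    congr 1
    simp only [hg, if_pos hi, frobB]
    rw [Nat.cast_sub (by omega), Nat.cast_sub (by omega)]
    push_cast; ring
  have h2 : ∏ i ∈ Ico m L, Φ (-(g i : ℝ) - 1 / 2) = ∏ i ∈ Ico m L, Φ (frobA μ i) := by
    refine prod_congr rfl fun i hi => ?_
    have hi := mem_Ico.1 hi
    have := rowLen_le_self μ hi.1
    congr 1
    simp only [hg, if_neg (not_lt.2 hi.1), frobA]
    rw [Nat.cast_sub (by omega)]
    ring
  rw [h1, h2, mul_assoc, mul_comm (∏ i ∈ Ico m L, _)]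

end Diagonal

/-! ### The normalized character as a coefficient. -/

section FrobeniusSeries

open PowerSeries

/-- The roots `t + 1/2 - k/2`, `t < k`, centred at the origin. -/
def centredRoot (k t : ℕ) : ℝ := t + 1 / 2 - k / 2

/-- Frobenius' generating function in the variable `1 / z`, centred at half the cycle length. -/
def frobeniusSeries (μ : YoungDiagram) (k : ℕ) : PowerSeries ℝ :=
  rootSeries (centredRoot k) k *
    ∏ j ∈ range (diagLen μ), upFactor k (frobA μ j) * downFactor k (frobB μ j)

/-- The beads of rows below the diagonal fill the negative sites except at the vacancies. A full
string of sites only shifts the roots, so the dependence on L disappears and the Frobenius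
coordinates remain. -/
lemma rootSeries_mul_prod_frobA (μ : YoungDiagram) (k : ℕ) {L : ℕ} (hL : μ.colLen 0 ≤ L) :
    rootSeries (fun t => (t : ℝ) - L + 1 / 2 - k / 2) k * ∏ i ∈ range L, upFactor k (frobA μ i) =
      frobeniusSeries μ k := by
  have h1 := prod_frobA_mul_prod_frobB μ (upFactor k) hL
  have h2 := rootSeries_mul_prod_upFactor k L
  have h3 : (∏ j ∈ range (diagLen μ), upFactor k (-frobB μ j)) *
      ∏ j ∈ range (diagLen μ), downFactor k (frobB μ j) = 1 := by
    rw [← prod_mul_distrib]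
    exact prod_eq_one fun j _ => upFactor_neg_mul_downFactor k _
  rw [frobeniusSeries, prod_mul_distrib]
  unfold centredRoot
  rw [← h2]
  generalize rootSeries (fun t => (t : ℝ) - L + 1 / 2 - k / 2) k = R at *
  linear_combination R * (∏ j ∈ range (diagLen μ), downFactor k (frobB μ j)) * h1 -
    R * (∏ i ∈ range L, upFactor k (frobA μ i)) * h3

lemma beads_sub (μ : YoungDiagram) {L : ℕ} (i : Fin L) :
    (beads μ L i : ℝ) = frobA μ i + (L - 1 / 2) := by
  have := i.2
  rw [beads, staircase, frobA, Fin.val_rev, Nat.cast_add, Nat.cast_sub (by omega)]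
  push_cast; ring

lemma cast_descFactorial (a k : ℕ) : (a.descFactorial k : ℝ) = ∏ t ∈ range k, ((a : ℝ) - t) := by
  induction k with
  | zero => simp
  | succ k ih =>
    rw [Nat.descFactorial_succ, prod_range_succ, ← ih, Nat.cast_mul, mul_comm]
    rcases le_or_gt k a with h | h
    · rw [Nat.cast_sub h]
    · rw [Nat.descFactorial_of_lt h]; simp

/-- The normalized character as a coefficient of Frobenius' generating function. -/
theorem spechtChar_div_spechtDim_eq_coeff (μ : YoungDiagram) {n : ℕ} (h : μ.card = n) {k : ℕ}
    (hk : 0 < k) {σ : Equiv.Perm (Fin n)} (hσ : IsKCycle k σ) :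
    spechtChar μ h σ / spechtDim μ h =
      ((-((n.descFactorial k : ℝ)⁻¹ * (coeff (k + 1) (frobeniusSeries μ k) / k)) : ℝ) : ℂ) := by
  set L := μ.colLen 0 with hL
  rw [spechtChar_div_spechtDim μ h hL.ge hk hσ]
  congr 1
  rw [← mul_neg]
  congr 1
  have hinj : Set.InjOn (fun i : Fin L => frobA μ i) (univ : Finset (Fin L)) := by
    intro i _ j _ hij
    exact Fin.ext ((frobA_strictAnti μ).injective hij)
  have h1 := coeff_rootSeries_mul_prod_upFactor (fun t => (t : ℝ) - L + 1 / 2 - k / 2) k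
    (fun i : Fin L => frobA μ i) univ hinj 0
  rw [Fin.prod_univ_eq_prod_range (fun i => upFactor k (frobA μ i)) L,
    rootSeries_mul_prod_frobA μ k hL.ge, add_zero] at h1
  rw [h1, neg_mul, neg_div, neg_neg, mul_div_cancel_left₀ _ (by positivity)]
  refine sum_congr rfl fun i _ => ?_
  rw [mul_comm]
  congr 1
  · refine prod_congr rfl fun j _ => ?_
    rw [beads_sub, beads_sub]
    congr 1 <;> ring
  · rw [pow_zero, one_mul, cast_descFactorial]
    refine prod_congr rfl fun t _ => ?_
    rw [beads_sub]; ring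

end FrobeniusSeries

/-! ### Sums of Frobenius coordinates. -/

section DiagonalSums

variable (μ : YoungDiagram)

lemma diagLen_sq_le_card : diagLen μ ^ 2 ≤ μ.card := by
  have hsub : range (diagLen μ) ×ˢ range (diagLen μ) ⊆ μ.cells := by
    rintro ⟨i, j⟩ hij
    simp only [mem_product, mem_range] at hij
    have hmax : (max i j, max i j) ∈ μ := (lt_diagLen_iff μ).1 (max_lt hij.1 hij.2)
    exact (YoungDiagram.mem_cells _).2 (μ.up_left_mem (le_max_left _ _) (le_max_right _ _) hmax)
  have := card_le_card hsub
  rw [card_product, card_range] at this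
  rw [pow_two]
  exact this

/-- These cells form the hook at (j, j), of size a + b for the corresponding coordinates. The
diagonal hooks partition the diagram, so the coordinates sum to n. -/
lemma card_filter_min_eq {j : ℕ} (hj : j < diagLen μ) :
    #{c ∈ μ.cells | min c.1 c.2 = j} = (μ.rowLen j - j) + (μ.colLen j - (j + 1)) := by
  have hu : (μ.cells.filter fun c => min c.1 c.2 = j) =
      ((Ico j (μ.rowLen j)).image fun l => (j, l)) ∪
        ((Ico (j + 1) (μ.colLen j)).image fun l => (l, j)) := by
    ext ⟨a, b⟩
    simp only [mem_filter, YoungDiagram.mem_cells, mem_union, mem_image, mem_Ico, Prod.mk.injEq]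
    constructor
    · rintro ⟨h1, h2⟩
      rcases le_or_gt a b with h | h
      · rw [min_eq_left h] at h2
        subst h2
        exact Or.inl ⟨b, ⟨h, YoungDiagram.mem_iff_lt_rowLen.1 h1⟩, rfl, rfl⟩
      · rw [min_eq_right h.le] at h2
        subst h2
        exact Or.inr ⟨a, ⟨h, YoungDiagram.mem_iff_lt_colLen.1 h1⟩, rfl, rfl⟩
    · rintro (⟨l, ⟨h1, h2⟩, rfl, rfl⟩ | ⟨l, ⟨h1, h2⟩, rfl, rfl⟩)
      · exact ⟨YoungDiagram.mem_iff_lt_rowLen.2 h2, min_eq_left h1⟩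
      · exact ⟨YoungDiagram.mem_iff_lt_colLen.2 h2, min_eq_right (by omega)⟩
  rw [hu, card_union_of_disjoint, card_image_of_injective, card_image_of_injective, Nat.card_Ico,
    Nat.card_Ico]
  · intro a b hab; exact (Prod.ext_iff.1 hab).1
  · intro a b hab; exact (Prod.ext_iff.1 hab).2
  · rw [disjoint_left]
    simp only [mem_image, mem_Ico]
    rintro _ ⟨a, ha, rfl⟩ ⟨b, hb, hab⟩
    have := (Prod.ext_iff.1 hab).1
    simp only at this
    omega

lemma sum_frobA_add_frobB :
    ∑ j ∈ range (diagLen μ), (frobA μ j + frobB μ j) = μ.card := by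
  have h := card_eq_sum_card_fiberwise (s := μ.cells) (t := range (diagLen μ))
    (f := fun c => min c.1 c.2) (by
      rintro ⟨a, b⟩ hab
      rw [mem_coe, YoungDiagram.mem_cells] at hab
      rw [mem_coe, mem_range, lt_diagLen_iff]
      exact μ.up_left_mem (min_le_left _ _) (min_le_right _ _) hab)
  rw [YoungDiagram.card, h, Nat.cast_sum]
  refine sum_congr rfl fun j hj => ?_
  have hj := mem_range.1 hj
  have h1 := lt_rowLen_self μ hj
  have h2 := lt_colLen_self μ hj
  rw [card_filter_min_eq μ hj, frobA, frobB, Nat.cast_add, Nat.cast_sub (by omega),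
    Nat.cast_sub (by omega)]
  push_cast; ring

lemma sum_frobA_le : ∑ j ∈ range (diagLen μ), frobA μ j ≤ μ.card := by
  rw [← sum_frobA_add_frobB]
  refine sum_le_sum fun j hj => ?_
  linarith [half_le_frobB μ (mem_range.1 hj)]

lemma sum_frobB_le : ∑ j ∈ range (diagLen μ), frobB μ j ≤ μ.card := by
  rw [← sum_frobA_add_frobB]
  refine sum_le_sum fun j hj => ?_
  linarith [half_le_frobA μ (mem_range.1 hj)]

lemma frobA_le_card {j : ℕ} (hj : j < diagLen μ) : frobA μ j ≤ μ.card :=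
  (single_le_sum (f := frobA μ) (fun i hi => by linarith [half_le_frobA μ (mem_range.1 hi)])
    (mem_range.2 hj)).trans (sum_frobA_le μ)

lemma frobB_le_card {j : ℕ} (hj : j < diagLen μ) : frobB μ j ≤ μ.card :=
  (single_le_sum (f := frobB μ) (fun i hi => by linarith [half_le_frobB μ (mem_range.1 hi)])
    (mem_range.2 hj)).trans (sum_frobB_le μ)

lemma diagLen_pos (h : 0 < μ.card) : 0 < diagLen μ := by
  rw [Nat.pos_iff_ne_zero]
  intro h0
  have := sum_frobA_add_frobB μ
  rw [h0, range_zero, sum_empty] at this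
  exact h.ne (by exact_mod_cast this)

lemma sum_Ico_frobA_add_frobB_le {r : ℕ} (hr : r + μ.rowLen 0 = μ.card) :
    ∑ j ∈ Ico 1 (diagLen μ), (frobA μ j + frobB μ j) ≤ r := by
  rcases Nat.eq_zero_or_pos (diagLen μ) with h0 | hpos
  · rw [h0]; simp
  · have h1 := sum_frobA_add_frobB μ
    rw [range_eq_Ico, sum_eq_sum_Ico_succ_bot hpos] at h1
    have h2 := half_le_frobB μ hpos
    have h3 : (r : ℝ) + μ.rowLen 0 = μ.card := by exact_mod_cast hr
    have h4 : frobA μ 0 = μ.rowLen 0 - 1 / 2 := by rw [frobA]; push_cast; ring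
    rw [zero_add] at h1
    linarith

lemma frobB_zero_le {r : ℕ} (hr : r + μ.rowLen 0 = μ.card) (h : 0 < μ.card) :
    frobB μ 0 ≤ r + 1 / 2 := by
  have hpos := diagLen_pos μ h
  have h1 := sum_frobA_add_frobB μ
  rw [range_eq_Ico, sum_eq_sum_Ico_succ_bot hpos] at h1
  have h2 : 0 ≤ ∑ j ∈ Ico (0 + 1) (diagLen μ), (frobA μ j + frobB μ j) :=
    sum_nonneg fun j hj => by
      have := (mem_Ico.1 hj).2
      linarith [half_le_frobA μ this, half_le_frobB μ this]
  have h3 : (r : ℝ) + μ.rowLen 0 = μ.card := by exact_mod_cast hr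
  have h4 : frobA μ 0 = μ.rowLen 0 - 1 / 2 := by rw [frobA]; push_cast; ring
  linarith

end DiagonalSums

/-! ### Weighted norms of power series in place of contour integrals. -/

section WeightedNorm

open PowerSeries

/-- The weighted `ℓ¹` norm of a power series at radius `x` is at most `B`. -/
def NormLE (x : ℝ) (G : PowerSeries ℝ) (B : ℝ) : Prop :=
  ∀ D : ℕ, ∑ d ∈ range D, |coeff d G| * x ^ d ≤ B

variable {x : ℝ} {G H : PowerSeries ℝ} {B B' : ℝ}

lemma NormLE.nonneg (h : NormLE x G B) : 0 ≤ B := by simpa using h 0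

lemma NormLE.mono (h : NormLE x G B) (hB : B ≤ B') : NormLE x G B' := fun D => (h D).trans hB

lemma NormLE.add (h : NormLE x G B) (h' : NormLE x H B') (hx : 0 ≤ x) :
    NormLE x (G + H) (B + B') := by
  intro D
  refine le_trans ?_ (add_le_add (h D) (h' D))
  rw [← sum_add_distrib]
  refine sum_le_sum fun d _ => ?_
  rw [← add_mul, map_add]
  exact mul_le_mul_of_nonneg_right (abs_add_le _ _) (pow_nonneg hx _)

lemma NormLE.mul (h : NormLE x G B) (h' : NormLE x H B') (hx : 0 ≤ x) :
    NormLE x (G * H) (B * B') := by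
  intro D
  calc ∑ d ∈ range D, |coeff d (G * H)| * x ^ d
      ≤ ∑ d ∈ range D, ∑ p ∈ antidiagonal d,
          (|coeff p.1 G| * x ^ p.1) * (|coeff p.2 H| * x ^ p.2) := by
        refine sum_le_sum fun d _ => ?_
        rw [coeff_mul]
        refine (mul_le_mul_of_nonneg_right (abs_sum_le_sum_abs _ _) (pow_nonneg hx _)).trans ?_
        rw [sum_mul]
        refine sum_le_sum fun p hp => ?_
        rw [← mem_antidiagonal.1 hp, pow_add, abs_mul]
        exact le_of_eq (by ring)
    _ ≤ ∑ p ∈ range D ×ˢ range D, (|coeff p.1 G| * x ^ p.1) * (|coeff p.2 H| * x ^ p.2) := by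
        set S := (range D ×ˢ range D).filter fun p => p.1 + p.2 < D with hS
        have hfib : ∀ d ∈ range D, antidiagonal d = S.filter fun p => p.1 + p.2 = d := by
          intro d hd
          have := mem_range.1 hd
          ext ⟨a, b⟩
          simp only [HasAntidiagonal.mem_antidiagonal, hS, mem_filter, mem_product, mem_range]
          omega
        rw [sum_congr rfl (fun d hd => by rw [hfib d hd]), sum_fiberwise_of_maps_to
          (g := fun p : ℕ × ℕ => p.1 + p.2) (fun p hp => mem_range.2 (mem_filter.1 hp).2)]
        refine sum_le_sum_of_subset_of_nonneg (filter_subset _ _) fun p _ _ => ?_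
        positivity
    _ = (∑ d ∈ range D, |coeff d G| * x ^ d) * ∑ d ∈ range D, |coeff d H| * x ^ d := by
        rw [sum_mul_sum, sum_product]
    _ ≤ B * B' := mul_le_mul (h D) (h' D)
        (sum_nonneg fun d _ => mul_nonneg (abs_nonneg _) (pow_nonneg hx _)) h.nonneg

lemma normLE_one : NormLE x 1 1 := by
  intro D
  simp only [coeff_one]
  rcases Nat.eq_zero_or_pos D with rfl | hD
  · simp
  · rw [sum_eq_single_of_mem 0 (mem_range.2 hD)]
    · simp
    · intro b _ hb; simp [hb]

lemma NormLE.prod {ι : Type*} (s : Finset ι) {G : ι → PowerSeries ℝ} {B : ι → ℝ} (hx : 0 ≤ x)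
    (h : ∀ i ∈ s, NormLE x (G i) (B i)) : NormLE x (∏ i ∈ s, G i) (∏ i ∈ s, B i) := by
  classical
  induction s using Finset.induction_on with
  | empty => simpa using normLE_one
  | insert a s ha ih =>
    rw [prod_insert ha, prod_insert ha]
    exact (h a (by simp)).mul (ih fun i hi => h i (by simp [hi])) hx

lemma NormLE.C_mul (h : NormLE x G B) (c : ℝ) : NormLE x (C c * G) (|c| * B) := by
  intro D
  refine le_trans (le_of_eq ?_) (mul_le_mul_of_nonneg_left (h D) (abs_nonneg c))
  rw [mul_sum]
  refine sum_congr rfl fun d _ => ?_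
  rw [coeff_C_mul, abs_mul]; ring

lemma NormLE.neg (h : NormLE x G B) : NormLE x (-G) B := by
  intro D
  simpa using h D

lemma NormLE.X_mul (h : NormLE x G B) (hx : 0 ≤ x) : NormLE x (X * G) (x * B) := by
  intro D
  cases D with
  | zero => simpa using mul_nonneg hx h.nonneg
  | succ D =>
    rw [sum_range_succ']
    refine le_trans (le_of_eq ?_) (mul_le_mul_of_nonneg_left (h D) hx)
    simp only [coeff_zero_X_mul, abs_zero, zero_mul, add_zero, mul_sum]
    refine sum_congr rfl fun d _ => ?_
    rw [coeff_succ_X_mul]; ring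

lemma normLE_geomSeries {R p P : ℝ} (hp : |p| ≤ P) (hPR : P < R) :
    NormLE R⁻¹ (geomSeries p) (R / (R - P)) := by
  have hP : 0 ≤ P := (abs_nonneg p).trans hp
  have hR : 0 < R := hP.trans_lt hPR
  intro D
  have h1 : ∀ d, |coeff d (geomSeries p)| * R⁻¹ ^ d ≤ (P / R) ^ d := by
    intro d
    rw [coeff_geomSeries, abs_pow, ← mul_pow, ← div_eq_mul_inv]
    gcongr
  have h2 : P / R < 1 := (div_lt_one hR).2 hPR
  refine (sum_le_sum fun d _ => h1 d).trans ?_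
  refine ((summable_geometric_of_lt_one (by positivity) h2).sum_le_tsum _
    (fun d _ => by positivity)).trans (le_of_eq ?_)
  rw [tsum_geometric_of_lt_one (by positivity) h2]
  field_simp

lemma NormLE.coeff_le (h : NormLE x G B) (hx : 0 ≤ x) (d : ℕ) : |coeff d G| * x ^ d ≤ B :=
  (single_le_sum (f := fun d => |coeff d G| * x ^ d)
    (fun _ _ => mul_nonneg (abs_nonneg _) (pow_nonneg hx _)) (self_mem_range_succ d)).trans (h _)

lemma NormLE.abs_coeff_le {R : ℝ} (h : NormLE R⁻¹ G B) (hR : 0 < R) (d : ℕ) :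
    |coeff d G| ≤ B * R ^ d := by
  have := h.coeff_le (by positivity) d
  rwa [inv_pow, ← div_eq_mul_inv, div_le_iff₀ (by positivity)] at this

/-- Removing the constant term `1`. -/
lemma NormLE.sub_one (h : NormLE x G B) (h0 : coeff 0 G = 1) (hB : 1 ≤ B):
    NormLE x (G - 1) (B - 1) := by
  intro D
  cases D with
  | zero => simpa using hB
  | succ D =>
    have := h (D + 1)
    rw [sum_range_succ'] at this ⊢
    simp only [h0, pow_zero, abs_one, mul_one] at this
    simp only [map_sub, h0, coeff_one, sub_self, abs_zero, zero_mul, if_pos, add_zero]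
    simp only [Nat.succ_ne_zero, if_false, sub_zero]
    linarith

lemma normLE_upFactor {k : ℕ} {a R P : ℝ} (hp : |a - k / 2| ≤ P) (hPR : P < R) :
    NormLE R⁻¹ (upFactor k a) (1 + k / (R - P)) := by
  have hR : 0 < R := ((abs_nonneg _).trans hp).trans_lt hPR
  have hRP : 0 < R - P := by linarith
  rw [upFactor, sub_eq_add_neg]
  refine (normLE_one.add ((((normLE_geomSeries hp hPR).X_mul (by positivity)).C_mul k).neg)
    (by positivity)).mono (le_of_eq ?_)
  rw [Nat.abs_cast]
  field_simp

lemma normLE_downFactor {k : ℕ} {b R P : ℝ} (hp : |b - k / 2| ≤ P) (hPR : P < R) :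
    NormLE R⁻¹ (downFactor k b) (1 + k / (R - P)) := by
  have hR : 0 < R := ((abs_nonneg _).trans hp).trans_lt hPR
  have hRP : 0 < R - P := by linarith
  rw [downFactor]
  rw [abs_sub_comm] at hp
  refine (normLE_one.add (((normLE_geomSeries hp hPR).X_mul (by positivity)).C_mul k)
    (by positivity)).mono (le_of_eq ?_)
  rw [Nat.abs_cast]
  field_simp

/-- The first-order terms of a paired row and column factor cancel. The deviation from 1 is
proportional to a + b, and these sums total n over all pairs. -/
lemma upFactor_mul_downFactor (k : ℕ) (a b : ℝ) :
    upFactor k a * downFactor k b =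
      1 - C (k * (a + b)) * ((X * geomSeries (a - k / 2)) * (X * geomSeries (k / 2 - b))) := by
  have h := X_mul_geomSeries_mul (a - k / 2) (k / 2 - b)
  have e : (k : ℝ) * (a + b) = k * (a - k / 2 - (k / 2 - b)) + k * k := by ring
  rw [upFactor, downFactor, e, map_add, map_mul, map_mul]
  linear_combination C (k : ℝ) * h

lemma normLE_upFactor_mul_downFactor {k : ℕ} {a b R P : ℝ} (ha : |a - k / 2| ≤ P)
    (hb : |b - k / 2| ≤ P) (hPR : P < R) (hab : 0 ≤ a + b) :
    NormLE R⁻¹ (upFactor k a * downFactor k b) (1 + k * (a + b) / (R - P) ^ 2) := by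
  have hR : 0 < R := ((abs_nonneg _).trans ha).trans_lt hPR
  have hRP : 0 < R - P := by linarith
  rw [upFactor_mul_downFactor, sub_eq_add_neg]
  rw [abs_sub_comm] at hb
  have hR' : 0 ≤ R⁻¹ := by positivity
  refine (normLE_one.add ((((((normLE_geomSeries ha hPR).X_mul hR').mul
    ((normLE_geomSeries hb hPR).X_mul hR') hR').C_mul (k * (a + b)))).neg) hR').mono (le_of_eq ?_)
  rw [abs_of_nonneg (by positivity)]
  field_simp

lemma abs_centredRoot_le {k t : ℕ} (ht : t < k) : |centredRoot k t| ≤ k / 2 := by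
  have : ((t + 1 : ℕ) : ℝ) ≤ k := by exact_mod_cast ht
  push_cast at this
  rw [centredRoot, abs_le]
  constructor <;> linarith [(Nat.cast_nonneg t : (0 : ℝ) ≤ t)]

lemma normLE_rootSeries {k : ℕ} {R : ℝ} (hR : 0 < R) :
    NormLE R⁻¹ (rootSeries (centredRoot k) k) ((1 + k / 2 / R) ^ k) := by
  have h : ∀ t ∈ range k, NormLE R⁻¹ (1 - C (centredRoot k t) * X) (1 + k / 2 / R) := by
    intro t ht
    have h1 := ((normLE_one (x := R⁻¹)).X_mul (by positivity)).C_mul (centredRoot k t)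
    rw [mul_one, mul_one] at h1
    rw [sub_eq_add_neg]
    refine (normLE_one.add h1.neg (by positivity)).mono ?_
    rw [← div_eq_mul_inv]
    gcongr
    exact abs_centredRoot_le (mem_range.1 ht)
  have := NormLE.prod (range k) (by positivity) h
  rwa [prod_const, card_range] at this

lemma prod_one_add_le_exp {ι : Type*} (s : Finset ι) {y : ι → ℝ} (hy : ∀ i ∈ s, 0 ≤ y i) :
    ∏ i ∈ s, (1 + y i) ≤ Real.exp (∑ i ∈ s, y i) := by
  rw [Real.exp_sum]
  refine prod_le_prod (fun i hi => by linarith [hy i hi]) fun i _ => ?_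
  rw [add_comm]; exact Real.add_one_le_exp _

@[simp] lemma coeff_zero_upFactor (k : ℕ) (a : ℝ) : coeff 0 (upFactor k a) = 1 := by
  simp [upFactor]

@[simp] lemma coeff_zero_downFactor (k : ℕ) (a : ℝ) : coeff 0 (downFactor k a) = 1 := by
  simp [downFactor]

end WeightedNorm

/-! ### Long cycles with short first row and column. -/

lemma sub_pow_le_descFactorial {n k : ℕ} (h : k ≤ n) :
    ((n : ℝ) - k) ^ k ≤ (n.descFactorial k : ℝ) := by
  have h1 : ((n + 1 - k) ^ k : ℕ) ≤ n.descFactorial k := Nat.pow_sub_le_descFactorial n k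
  have h2 : (((n + 1 - k) ^ k : ℕ) : ℝ) ≤ (n.descFactorial k : ℝ) := by exact_mod_cast h1
  refine le_trans ?_ h2
  rw [Nat.cast_pow, Nat.cast_sub (by omega)]
  have h3 : (k : ℝ) ≤ n := by exact_mod_cast h
  have h4 : 0 ≤ (n : ℝ) - k := by linarith
  push_cast
  gcongr
  linarith

lemma abs_sub_half_le {a P : ℝ} {k : ℕ} (ha : 0 ≤ a) (haP : a ≤ P) (hk : (k : ℝ) / 2 ≤ P) :
    |a - k / 2| ≤ P := by
  rw [abs_le]
  constructor <;> linarith [(Nat.cast_nonneg k : (0 : ℝ) ≤ k)]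

lemma one_add_div_pow_mul_pow {x R : ℝ} (hR : 0 < R) (k : ℕ) :
    (1 + x / R) ^ k * R ^ k = (R + x) ^ k := by
  rw [← mul_pow]
  congr 1
  field_simp

lemma normLE_frobeniusSeries (μ : YoungDiagram) {k : ℕ} {R P : ℝ}
    (hA : ∀ j < diagLen μ, frobA μ j ≤ P) (hB : ∀ j < diagLen μ, frobB μ j ≤ P)
    (hk : (k : ℝ) / 2 ≤ P) (hPR : P < R) :
    NormLE R⁻¹ (frobeniusSeries μ k)
      ((1 + k / 2 / R) ^ k * Real.exp (k * μ.card / (R - P) ^ 2)) := by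
  have hP : 0 ≤ P := le_trans (by positivity) hk
  have hR : 0 < R := hP.trans_lt hPR
  refine (normLE_rootSeries hR).mul ?_ (by positivity)
  have hab : ∀ j ∈ range (diagLen μ), 0 ≤ frobA μ j + frobB μ j := fun j hj => by
    linarith [half_le_frobA μ (mem_range.1 hj), half_le_frobB μ (mem_range.1 hj)]
  refine (NormLE.prod _ (by positivity) fun j hj => normLE_upFactor_mul_downFactor
    (abs_sub_half_le (by linarith [half_le_frobA μ (mem_range.1 hj)]) (hA j (mem_range.1 hj)) hk)
    (abs_sub_half_le (by linarith [half_le_frobB μ (mem_range.1 hj)]) (hB j (mem_range.1 hj)) hk)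
    hPR (hab j hj)).mono ?_
  refine (prod_one_add_le_exp _ fun j hj => by have := hab j hj; positivity).trans (le_of_eq ?_)
  rw [← sum_div, ← mul_sum, sum_frobA_add_frobB]

/-- The radius will be ρn, beyond all poles, which lie within e^(-θ) n. Of the bounds on ε, 2e^(-θ)
keeps k/2 within that distance too, (ρ - e^(-θ))² makes the product over pairs at most e, and the
last inequality gives R + k/2 ≤ e^(-2/3)(n - k). -/
lemma exists_small_cycle_ratio {θ : ℝ} (hθ : 2 / 3 < θ) :
    ∃ ρ ε : ℝ, 0 < ε ∧ ε < 1 ∧ Real.exp (-θ) < ρ ∧ ρ ≤ Real.exp (-(2 / 3)) ∧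
      ε ≤ 2 * Real.exp (-θ) ∧ ε ≤ (ρ - Real.exp (-θ)) ^ 2 ∧
      ρ + ε / 2 ≤ Real.exp (-(2 / 3)) * (1 - ε) := by
  have h1 : Real.exp (-θ) < Real.exp (-((θ + 2 / 3) / 2)) := Real.exp_lt_exp.2 (by linarith)
  have h2 : Real.exp (-((θ + 2 / 3) / 2)) < Real.exp (-(2 / 3)) := Real.exp_lt_exp.2 (by linarith)
  set ρ := Real.exp (-((θ + 2 / 3) / 2))
  set g := Real.exp (-(2 / 3))
  have hg : g ≤ 1 := Real.exp_le_one_iff.2 (by norm_num)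
  have hθ0 := Real.exp_pos (-θ)
  have hsq : 0 < (ρ - Real.exp (-θ)) ^ 2 := pow_pos (by linarith) 2
  set ε := min (min (2 * Real.exp (-θ)) ((ρ - Real.exp (-θ)) ^ 2)) (min (1 / 2) ((g - ρ) / 2))
  have e1 : ε ≤ 2 * Real.exp (-θ) := (min_le_left _ _).trans (min_le_left _ _)
  have e2 : ε ≤ (ρ - Real.exp (-θ)) ^ 2 := (min_le_left _ _).trans (min_le_right _ _)
  have e3 : ε ≤ 1 / 2 := (min_le_right _ _).trans (min_le_left _ _)
  have e4 : ε ≤ (g - ρ) / 2 := (min_le_right _ _).trans (min_le_right _ _)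
  have e0 : 0 < ε := lt_min (lt_min (by linarith) hsq) (lt_min (by norm_num) (by linarith))
  refine ⟨ρ, ε, e0, by linarith, h1, h2.le, e1, e2, ?_⟩
  nlinarith

/-- Exponential decay of the normalized character when the cycle is long and neither the first
row nor the first column is. -/
theorem norm_spechtChar_div_spechtDim_le_exp (θ : ℝ) (hθ : 2 / 3 < θ) : ∃ ε : ℝ, 0 < ε ∧
    ∃ N : ℕ, ∀ (n k : ℕ), N ≤ n → 2 ≤ k → k ≤ n →
      6 * Real.log n ≤ k → (k : ℝ) ≤ ε * n →
      ∀ (σ : Equiv.Perm (Fin n)), IsKCycle k σ →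
      ∀ (μ : YoungDiagram) (h : μ.card = n),
      frobB μ 0 ≤ frobA μ 0 → frobA μ 0 ≤ Real.exp (-θ) * n →
      ‖spechtChar μ h σ / spechtDim μ h‖ ≤ Real.exp (-(k : ℝ) / 2) := by
  obtain ⟨ρ, ε, hε0, hε1, hθρ, hρ, hεθ, hεsq, hρε⟩ := exists_small_cycle_ratio hθ
  -- No lower bound on n is needed, since 6 log n ≤ k already absorbs the polynomial factor.
  refine ⟨ε, hε0, 0, ?_⟩
  intro n k _ hk2 hkn hlog hkε σ hσ μ h hba haθ
  have hn0 : 0 < (n : ℝ) := by exact_mod_cast (by omega : 0 < n)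
  have hk2' : (2 : ℝ) ≤ k := by exact_mod_cast hk2
  set P := Real.exp (-θ) * n with hP
  set R := ρ * n with hR
  have hθ0 := Real.exp_pos (-θ)
  have hPR : P < R := mul_lt_mul_of_pos_right hθρ hn0
  have hP0 : 0 < P := mul_pos hθ0 hn0
  have hR0 : 0 < R := hP0.trans hPR
  have hkP : (k : ℝ) / 2 ≤ P := by nlinarith
  have hA : ∀ j < diagLen μ, frobA μ j ≤ P := fun j _ =>
    ((frobA_strictAnti μ).antitone (Nat.zero_le j)).trans haθ
  have hB : ∀ j < diagLen μ, frobB μ j ≤ P := fun j _ =>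
    (((frobB_strictAnti μ).antitone (Nat.zero_le j)).trans hba).trans haθ
  have hnorm := normLE_frobeniusSeries μ hA hB hkP hPR
  have hexp : Real.exp (k * μ.card / (R - P) ^ 2) ≤ Real.exp 1 := by
    rw [Real.exp_le_exp, h]
    have hRP : (R - P) ^ 2 = (ρ - Real.exp (-θ)) ^ 2 * n ^ 2 := by rw [hR, hP]; ring
    rw [div_le_one (pow_pos (by linarith) 2), hRP]
    have : ε * n * n ≤ (ρ - Real.exp (-θ)) ^ 2 * n * n := by gcongr
    nlinarith
  have hcoeff : |PowerSeries.coeff (k + 1) (frobeniusSeries μ k)| ≤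
      Real.exp 1 * R * (Real.exp (-(2 / 3)) * (n - k)) ^ k := by
    refine (hnorm.abs_coeff_le hR0 (k + 1)).trans ?_
    have e : (1 + k / 2 / R) ^ k * Real.exp (k * μ.card / (R - P) ^ 2) * R ^ (k + 1) =
        Real.exp (k * μ.card / (R - P) ^ 2) * R * (R + k / 2) ^ k := by
      rw [← one_add_div_pow_mul_pow hR0]; ring
    rw [e]
    gcongr
    calc R + (k : ℝ) / 2 ≤ (ρ + ε / 2) * n := by rw [hR]; linarith
      _ ≤ Real.exp (-(2 / 3)) * (1 - ε) * n := by gcongr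
      _ ≤ Real.exp (-(2 / 3)) * (n - k) := by
        rw [mul_assoc]
        have : (1 - ε) * n ≤ n - k := by linarith
        gcongr
  have hnk : 0 < (n : ℝ) - k := by nlinarith
  have hdesc := sub_pow_le_descFactorial hkn
  have hdesc0 : 0 < ((n : ℝ) - k) ^ k := pow_pos hnk k
  rw [spechtChar_div_spechtDim_eq_coeff μ h (by omega) hσ, Complex.norm_real, Real.norm_eq_abs,
    abs_neg, abs_mul, abs_inv, abs_div, Nat.abs_cast, Nat.abs_cast]
  -- The coefficient has degree k + 1, which leaves one spare factor R = ρn. Bounding n by e^(k/6)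
  -- reduces the decay e^(-2k/3) to e^(-k/2).
  have hne : (n : ℝ) ≤ Real.exp (k / 6) := by
    rw [← Real.log_le_iff_le_exp hn0]; linarith
  -- The constants left over are e · e^(-2/3), divided by k ≥ 2.
  have hthird : Real.exp (1 / 3) ≤ 2 := by
    rw [← Real.le_log_iff_exp_le (by norm_num)]
    linarith [Real.log_two_gt_d9]
  calc ((n.descFactorial k : ℝ))⁻¹ * (|PowerSeries.coeff (k + 1) (frobeniusSeries μ k)| / k)
      ≤ (((n : ℝ) - k) ^ k)⁻¹ *
          (Real.exp 1 * R * (Real.exp (-(2 / 3)) * (n - k)) ^ k / 2) := by gcongr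
    _ = Real.exp 1 * ρ / 2 * n * Real.exp (-(2 / 3)) ^ k := by
        rw [mul_pow, hR]; field_simp
    _ ≤ Real.exp 1 * Real.exp (-(2 / 3)) / 2 * Real.exp (k / 6) * Real.exp (-(2 / 3)) ^ k := by
        gcongr
    _ = Real.exp (1 / 3) / 2 * Real.exp (-(k : ℝ) / 2) := by
        rw [← Real.exp_add, ← Real.exp_nat_mul, mul_assoc, ← Real.exp_add]
        congr 2 <;> ring_nf
    _ ≤ Real.exp (-(k : ℝ) / 2) := by
        have := Real.exp_pos (-(k : ℝ) / 2)
        nlinarith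

/-! ### Evaluation of power series at a pole, and splitting off its residue. -/

section Evaluation

open PowerSeries

/-- The power series `G` converges absolutely at `y`, with value `v`. -/
def HasValue (y : ℝ) (G : PowerSeries ℝ) (v : ℝ) : Prop :=
  (Summable fun d => ‖coeff d G * y ^ d‖) ∧ ∑' d, coeff d G * y ^ d = v

variable {y : ℝ} {G H : PowerSeries ℝ} {v w : ℝ}

lemma HasValue.add (h : HasValue y G v) (h' : HasValue y H w) : HasValue y (G + H) (v + w) := by
  refine ⟨?_, ?_⟩
  · refine Summable.of_nonneg_of_le (fun _ => norm_nonneg _) (fun d => ?_) (h.1.add h'.1)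
    rw [map_add, add_mul]
    exact norm_add_le _ _
  · rw [← h.2, ← h'.2, ← h.1.of_norm.tsum_add h'.1.of_norm]
    exact tsum_congr fun d => by rw [map_add, add_mul]

lemma HasValue.mul (h : HasValue y G v) (h' : HasValue y H w) : HasValue y (G * H) (v * w) := by
  have e : ∀ d, coeff d (G * H) * y ^ d =
      ∑ p ∈ antidiagonal d, (coeff p.1 G * y ^ p.1) * (coeff p.2 H * y ^ p.2) := by
    intro d
    rw [coeff_mul, sum_mul]
    refine sum_congr rfl fun p hp => ?_
    rw [← HasAntidiagonal.mem_antidiagonal.1 hp, pow_add]; ring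
  refine ⟨?_, ?_⟩
  · simp only [e]
    exact summable_norm_sum_mul_antidiagonal_of_summable_norm
      (f := fun d => coeff d G * y ^ d) (g := fun d => coeff d H * y ^ d) h.1 h'.1
  · rw [tsum_congr e, ← h.2, ← h'.2]
    exact (tsum_mul_tsum_eq_tsum_sum_antidiagonal_of_summable_norm
      (f := fun d => coeff d G * y ^ d) (g := fun d => coeff d H * y ^ d) h.1 h'.1).symm

lemma hasValue_C (c : ℝ) : HasValue y (C c) c := by
  have h0 : ∀ d, d ≠ 0 → coeff d (C c) * y ^ d = 0 := by
    intro d hd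
    rw [coeff_C, if_neg hd, zero_mul]
  refine ⟨summable_of_ne_finset_zero (s := {0}) fun d hd => ?_, ?_⟩
  · rw [h0 d (by simpa using hd), norm_zero]
  · rw [tsum_eq_single 0 h0]; simp

lemma hasValue_one : HasValue y 1 1 := by
  simpa using hasValue_C (y := y) 1

lemma hasValue_X : HasValue y X y := by
  have h0 : ∀ d, d ≠ 1 → coeff d (X : PowerSeries ℝ) * y ^ d = 0 := by
    intro d hd
    rw [coeff_X, if_neg hd, zero_mul]
  refine ⟨summable_of_ne_finset_zero (s := {1}) fun d hd => ?_, ?_⟩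
  · rw [h0 d (by simpa using hd), norm_zero]
  · rw [tsum_eq_single 1 h0]; simp

lemma HasValue.neg (h : HasValue y G v) : HasValue y (-G) (-v) := by
  have := (hasValue_C (y := y) (-1)).mul h
  simpa using this

lemma HasValue.prod {ι : Type*} (s : Finset ι) {G : ι → PowerSeries ℝ} {v : ι → ℝ}
    (h : ∀ i ∈ s, HasValue y (G i) (v i)) : HasValue y (∏ i ∈ s, G i) (∏ i ∈ s, v i) := by
  classical
  induction s using Finset.induction_on with
  | empty => simpa using hasValue_one
  | insert a s ha ih =>
    rw [prod_insert ha, prod_insert ha]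
    exact (h a (by simp)).mul (ih fun i hi => h i (by simp [hi]))

lemma hasValue_geomSeries {p : ℝ} (h : |p * y| < 1) :
    HasValue y (geomSeries p) (1 - p * y)⁻¹ := by
  have e : ∀ d, coeff d (geomSeries p) * y ^ d = (p * y) ^ d := fun d => by
    rw [coeff_geomSeries, mul_pow]
  refine ⟨?_, ?_⟩
  · simp only [e, norm_pow]
    exact summable_geometric_of_lt_one (norm_nonneg _) h
  · simp only [e]
    exact tsum_geometric_of_abs_lt_one h

variable {p : ℝ}

lemma hasValue_upFactor {k : ℕ} {a : ℝ} (hp : |a - k / 2| < p) :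
    HasValue p⁻¹ (upFactor k a) ((p + k / 2 - a - k) / (p + k / 2 - a)) := by
  have hp0 : 0 < p := (abs_nonneg _).trans_lt hp
  have h1 : |(a - k / 2) * p⁻¹| < 1 := by
    rw [abs_mul, abs_inv, abs_of_pos hp0, ← div_eq_mul_inv, div_lt_one hp0]; exact hp
  have h2 : p + k / 2 - a ≠ 0 := by linarith [(abs_lt.1 hp).2]
  have := (hasValue_one (y := p⁻¹)).add
    ((hasValue_C (k : ℝ)).mul (hasValue_X.mul (hasValue_geomSeries h1))).neg
  rw [← sub_eq_add_neg, ← upFactor] at this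
  convert this using 1
  have h3 : 1 - (a - k / 2) * p⁻¹ = (p + k / 2 - a) / p := by field_simp; ring
  rw [h3]
  generalize p + k / 2 - a = q at h2
  field_simp
  ring

lemma hasValue_downFactor {k : ℕ} {b : ℝ} (hp : |b - k / 2| < p) :
    HasValue p⁻¹ (downFactor k b) ((p + k / 2 + b) / (p + k / 2 + b - k)) := by
  have hp0 : 0 < p := (abs_nonneg _).trans_lt hp
  rw [abs_sub_comm] at hp
  have h1 : |(k / 2 - b) * p⁻¹| < 1 := by
    rw [abs_mul, abs_inv, abs_of_pos hp0, ← div_eq_mul_inv, div_lt_one hp0]; exact hp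
  have h2 : p + k / 2 + b - k ≠ 0 := by linarith [(abs_lt.1 hp).2]
  have := (hasValue_one (y := p⁻¹)).add
    ((hasValue_C (k : ℝ)).mul (hasValue_X.mul (hasValue_geomSeries h1)))
  rw [← downFactor] at this
  convert this using 1
  have h3 : 1 - (k / 2 - b) * p⁻¹ = (p + k / 2 + b - k) / p := by field_simp; ring
  rw [h3]
  generalize p + k / 2 + b = q at h2
  field_simp
  ring

lemma hasValue_rootSeries (ρ : ℕ → ℝ) (k : ℕ) (hp : p ≠ 0) :
    HasValue p⁻¹ (rootSeries ρ k) ((∏ t ∈ range k, (p - ρ t)) / p ^ k) := by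
  have h : ∀ t ∈ range k, HasValue p⁻¹ (1 - C (ρ t) * X) ((p - ρ t) / p) := by
    intro t _
    have := (hasValue_one (y := p⁻¹)).add ((hasValue_C (ρ t)).mul hasValue_X).neg
    rw [← sub_eq_add_neg] at this
    convert this using 1
    field_simp
    ring
  have := HasValue.prod _ h
  rwa [prod_div_distrib, prod_const, card_range] at this

lemma coeff_mul_geomSeries (G : PowerSeries ℝ) (p : ℝ) (k : ℕ) :
    coeff k (G * geomSeries p) = ∑ d ∈ range (k + 1), coeff d G * p ^ (k - d) := by
  rw [coeff_mul, Nat.sum_antidiagonal_eq_sum_range_succ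
    (fun i j => coeff i G * coeff j (geomSeries p))]
  simp only [coeff_geomSeries]

/-- Splitting a coefficient of `G (1 - k X / (1 - p X))` into the residue at `p` and the rest. -/
lemma coeff_mul_upFactor_eq {G : PowerSeries ℝ} {k : ℕ} {a v : ℝ} (hk : 0 < k)
    (hp : a - k / 2 ≠ 0) (h : HasValue (a - k / 2)⁻¹ G v) :
    -(coeff (k + 1) (G * upFactor k a) / k) =
      (a - k / 2) ^ k * v - coeff (k + 1) G / k -
        (a - k / 2) ^ k * ∑' d, coeff (d + (k + 1)) G * (a - k / 2)⁻¹ ^ (d + (k + 1)) := by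
  set p := a - (k : ℝ) / 2 with hp_def
  have hk0 : (k : ℝ) ≠ 0 := by positivity
  have e : G * upFactor k a = G - C (k : ℝ) * ((G * geomSeries p) * X) := by
    rw [upFactor]; ring
  -- Multiplied by p^k, the first k + 1 terms of the value of G at 1/p are the coefficient of degree
  -- k of G/(1 - pX). The remaining terms form the tail.
  have hs := h.1.of_norm.sum_add_tsum_nat_add (k + 1)
  rw [h.2] at hs
  have hsum : ∑ d ∈ range (k + 1), coeff d G * p ^ (k - d) =
      p ^ k * ∑ d ∈ range (k + 1), coeff d G * p⁻¹ ^ d := by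
    rw [mul_sum]
    refine sum_congr rfl fun d hd => ?_
    have hd : d ≤ k := by have := mem_range.1 hd; omega
    rw [pow_sub₀ p hp hd, inv_pow]; ring
  rw [e, map_sub, coeff_C_mul, coeff_succ_mul_X, coeff_mul_geomSeries, hsum, ← hs]
  field_simp
  ring

/-- Every degree in the tail exceeds k, so p occurs only to negative powers and may be replaced by
the smaller radius R. -/
lemma abs_pow_mul_tsum_le {G : PowerSeries ℝ} {R B : ℝ} {k : ℕ} (hR : 0 < R) (hRp : R ≤ p)
    (hG : NormLE R⁻¹ G B) :
    |p ^ k * ∑' d, coeff (d + (k + 1)) G * p⁻¹ ^ (d + (k + 1))| ≤ R ^ k * B := by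
  have hp : 0 < p := hR.trans_le hRp
  have hterm : ∀ d, p ^ k * ‖coeff (d + (k + 1)) G * p⁻¹ ^ (d + (k + 1))‖ ≤
      R ^ k * (|coeff (d + (k + 1)) G| * R⁻¹ ^ (d + (k + 1))) := by
    intro d
    rw [norm_mul, Real.norm_eq_abs, norm_pow, Real.norm_eq_abs, abs_of_pos (inv_pos.2 hp)]
    have e : ∀ z : ℝ, 0 < z → z ^ k * z⁻¹ ^ (d + (k + 1)) = z⁻¹ ^ (d + 1) := by
      intro z hz
      rw [show d + (k + 1) = (d + 1) + k by ring, pow_add, mul_left_comm, ← mul_pow,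
        mul_inv_cancel₀ hz.ne', one_pow, mul_one]
    rw [mul_left_comm, e p hp, mul_left_comm (R ^ k), e R hR]
    gcongr
  have hB : ∀ D : ℕ, ∑ d ∈ range D, |coeff (d + (k + 1)) G| * R⁻¹ ^ (d + (k + 1)) ≤ B := by
    intro D
    have h1 := hG (k + 1 + D)
    rw [sum_range_add] at h1
    have h2 : 0 ≤ ∑ d ∈ range (k + 1), |coeff d G| * R⁻¹ ^ d :=
      sum_nonneg fun d _ => by positivity
    simp only [add_comm _ (k + 1)]
    linarith
  have hsumR : Summable fun d => |coeff (d + (k + 1)) G| * R⁻¹ ^ (d + (k + 1)) :=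
    summable_of_sum_range_le (fun d => by positivity) hB
  have hsum : Summable fun d => ‖coeff (d + (k + 1)) G * p⁻¹ ^ (d + (k + 1))‖ := by
    refine Summable.of_nonneg_of_le (fun _ => norm_nonneg _) (fun d => ?_)
      (hsumR.mul_left ((p ^ k)⁻¹ * R ^ k))
    have := hterm d
    rw [← le_div_iff₀' (by positivity)] at this
    refine this.trans (le_of_eq ?_)
    field_simp
  rw [abs_mul, abs_of_pos (pow_pos hp k)]
  calc p ^ k * |∑' d, coeff (d + (k + 1)) G * p⁻¹ ^ (d + (k + 1))|
      ≤ p ^ k * ∑' d, ‖coeff (d + (k + 1)) G * p⁻¹ ^ (d + (k + 1))‖ := by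
        gcongr
        exact norm_tsum_le_tsum_norm hsum
    _ = ∑' d, p ^ k * ‖coeff (d + (k + 1)) G * p⁻¹ ^ (d + (k + 1))‖ := (tsum_mul_left).symm
    _ ≤ ∑' d, R ^ k * (|coeff (d + (k + 1)) G| * R⁻¹ ^ (d + (k + 1))) :=
        (hsum.mul_left _).tsum_le_tsum hterm (hsumR.mul_left _)
    _ = R ^ k * ∑' d, |coeff (d + (k + 1)) G| * R⁻¹ ^ (d + (k + 1)) := tsum_mul_left
    _ ≤ R ^ k * B := by
        gcongr
        exact Real.tsum_le_of_sum_range_le (fun d => by positivity) hB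

end Evaluation

/-! ### The pole of the first row and the vanishing of the other residues. -/

section FirstRow

open PowerSeries

variable (μ : YoungDiagram)

/-- The generating function of Frobenius without the factor of the first row. -/
def firstRowCofactor (k : ℕ) : PowerSeries ℝ :=
  rootSeries (centredRoot k) k * (downFactor k (frobB μ 0) *
    ∏ j ∈ Ico 1 (diagLen μ), upFactor k (frobA μ j) * downFactor k (frobB μ j))

lemma frobeniusSeries_eq_firstRowCofactor_mul (k : ℕ) (h : 0 < μ.card) :
    frobeniusSeries μ k = firstRowCofactor μ k * upFactor k (frobA μ 0) := by
  rw [frobeniusSeries, firstRowCofactor, range_eq_Ico,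
    prod_eq_prod_Ico_succ_bot (diagLen_pos μ h), zero_add]
  ring

lemma isUnit_upFactor (k : ℕ) (a : ℝ) : IsUnit (upFactor k a) := by
  rw [PowerSeries.isUnit_iff_constantCoeff, ← coeff_zero_eq_constantCoeff_apply,
    coeff_zero_upFactor]
  exact isUnit_one

/-- Back in terms of beads, the poles are those of the rows below the first, so the coefficients
beyond degree k become explicit residue sums. -/
lemma firstRowCofactor_eq (k : ℕ) (h : 0 < μ.card) :
    firstRowCofactor μ k =
      rootSeries (fun t => (t : ℝ) - μ.colLen 0 + 1 / 2 - k / 2) k *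
        ∏ i ∈ Ico 1 (μ.colLen 0), upFactor k (frobA μ i) := by
  have h1 := rootSeries_mul_prod_frobA μ k le_rfl
  rw [frobeniusSeries_eq_firstRowCofactor_mul μ k h, range_eq_Ico, prod_eq_prod_Ico_succ_bot
    ((diagLen_pos μ h).trans_le (diagLen_le_colLen_zero μ)), zero_add, mul_left_comm, mul_comm] at h1
  exact ((isUnit_upFactor k _).mul_right_cancel h1).symm

/-- If all rows but the first have fewer than `k` cells in total, moving a later bead by `k` always
hits another bead. -/
lemma exists_bead_of_lt {r k i : ℕ} (hr : r + μ.rowLen 0 = μ.card) (hrk : r < k) (hi : 1 ≤ i)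
    (hiL : i < μ.colLen 0) (hk : k ≤ μ.rowLen i + (μ.colLen 0 - 1 - i)) :
    ∃ j, i < j ∧ j < μ.colLen 0 ∧
      μ.rowLen j + (μ.colLen 0 - 1 - j) + k = μ.rowLen i + (μ.colLen 0 - 1 - i) := by
  by_contra hno
  push Not at hno
  set L := μ.colLen 0 with hL
  have hsum : ∑ j ∈ Ico 1 L, μ.rowLen j = r := by
    have h1 := sum_rowLen μ (n := μ.card) rfl (L := L) le_rfl
    rw [Fin.sum_univ_eq_sum_range (fun j => μ.rowLen j) L, range_eq_Ico,
      sum_eq_sum_Ico_succ_bot (by omega : 0 < L), zero_add] at h1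
    omega
  -- Let j be the last row from i on whose bead lies above the target of bead i. If the target is
  -- vacant, rows i to j contain at least k cells, since rows i + 1 to j are nonempty. This exceeds
  -- r.
  have hne : ((Ico i L).filter fun j => μ.rowLen i + (L - 1 - i) <
      μ.rowLen j + (L - 1 - j) + k).Nonempty :=
    ⟨i, by simp only [mem_filter, mem_Ico]; omega⟩
  obtain ⟨j, hj, hmax⟩ := exists_max_image _ id hne
  simp only [mem_filter, mem_Ico, id] at hj hmax
  have hvac : L - 1 - j + k ≤ μ.rowLen i + (L - 1 - i) := by
    rcases Nat.lt_or_ge (j + 1) L with h1 | h1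
    · have h2 := hno (j + 1) (by omega) h1
      have h3 : ¬ (μ.rowLen i + (L - 1 - i) < μ.rowLen (j + 1) + (L - 1 - (j + 1)) + k) := by
        intro h4
        have := hmax (j + 1) ⟨⟨by omega, h1⟩, h4⟩
        omega
      omega
    · omega
  have hpos : ∀ l ∈ Ico (i + 1) (j + 1), 1 ≤ μ.rowLen l := by
    intro l hl
    have := mem_Ico.1 hl
    exact (lt_rowLen_iff_lt_colLen μ).2 (by omega)
  have h5 : j - i ≤ ∑ l ∈ Ico (i + 1) (j + 1), μ.rowLen l := by
    simpa using card_nsmul_le_sum (Ico (i + 1) (j + 1)) (fun l => μ.rowLen l) 1 hpos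
  have h6 : ∑ l ∈ Ico i (j + 1), μ.rowLen l ≤ ∑ l ∈ Ico 1 L, μ.rowLen l :=
    sum_le_sum_of_subset (Ico_subset_Ico hi (by omega))
  rw [sum_eq_sum_Ico_succ_bot (by omega : i < j + 1)] at h6
  omega

/-- Every residue is zero: a bead lower than k is killed by a root of the falling factorial, and a
higher one lands on another bead. -/
lemma coeff_firstRowCofactor_eq_zero {r k : ℕ} (hr : r + μ.rowLen 0 = μ.card) (hrk : r < k)
    (h : 0 < μ.card) (d : ℕ) : coeff (d + (k + 1)) (firstRowCofactor μ k) = 0 := by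
  rw [firstRowCofactor_eq μ k h, show d + (k + 1) = k + d + 1 by ring,
    coeff_rootSeries_mul_prod_upFactor _ _ _ _ (frobA_strictAnti μ).injective.injOn]
  rw [sum_eq_zero, mul_zero]
  intro i hi
  have hi := mem_Ico.1 hi
  have hcast : ∀ j < μ.colLen 0, ((μ.rowLen j + (μ.colLen 0 - 1 - j) : ℕ) : ℝ) =
      frobA μ j + (μ.colLen 0 - 1 / 2) := by
    intro j hj
    rw [frobA, Nat.cast_add, Nat.cast_sub (by omega), Nat.cast_sub (by omega)]
    push_cast; ring
  have hci := hcast i hi.2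
  rcases Nat.lt_or_ge (μ.rowLen i + (μ.colLen 0 - 1 - i)) k with h1 | h1
  · rw [prod_eq_zero (i := μ.rowLen i + (μ.colLen 0 - 1 - i)) (mem_range.2 h1), mul_zero, mul_zero]
    rw [hci]; ring
  · obtain ⟨j, hij, hjL, he⟩ := exists_bead_of_lt μ hr hrk hi.1 hi.2 h1
    have he' : ((μ.rowLen j + (μ.colLen 0 - 1 - j) : ℕ) : ℝ) + k =
        ((μ.rowLen i + (μ.colLen 0 - 1 - i) : ℕ) : ℝ) := by exact_mod_cast he
    rw [hci, hcast j hjL] at he'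
    rw [prod_eq_zero (i := j) (mem_erase.2 ⟨by omega, mem_Ico.2 ⟨by omega, hjL⟩⟩), zero_mul]
    rw [div_eq_zero_iff]
    left
    linarith

end FirstRow

/-! ### Error bound for a long first row. -/

section LongFirstRow

open PowerSeries

variable (μ : YoungDiagram)

lemma frobA_zero_eq {r : ℕ} (hr : r + μ.rowLen 0 = μ.card) :
    frobA μ 0 = (μ.card : ℝ) - r - 1 / 2 := by
  have h3 : (r : ℝ) + μ.rowLen 0 = μ.card := by exact_mod_cast hr
  rw [frobA]; push_cast; linarith

lemma frobA_le_of_pos {r j : ℕ} (hr : r + μ.rowLen 0 = μ.card) (hj : j ∈ Ico 1 (diagLen μ)) :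
    frobA μ j ≤ r + 1 := by
  have h1 : frobA μ j + frobB μ j ≤ ∑ j ∈ Ico 1 (diagLen μ), (frobA μ j + frobB μ j) :=
    single_le_sum (f := fun j => frobA μ j + frobB μ j) (fun i hi => by
      have := (mem_Ico.1 hi).2
      linarith [half_le_frobA μ this, half_le_frobB μ this]) hj
  have := sum_Ico_frobA_add_frobB_le μ hr
  linarith [half_le_frobB μ (mem_Ico.1 hj).2]

lemma frobB_le_of_rowLen {r : ℕ} (hr : r + μ.rowLen 0 = μ.card) (h : 0 < μ.card) (j : ℕ) :
    frobB μ j ≤ r + 1 := by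
  have := (frobB_strictAnti μ).antitone (Nat.zero_le j)
  linarith [frobB_zero_le μ hr h]

lemma fallingPow_natCast (n k : ℕ) : fallingPow n k = n.descFactorial k := by
  rw [cast_descFactorial, fallingPow]

/-- The cofactor evaluated at the pole of the first row is the main term. The hypotheses say that
this pole is larger in absolute value than all others, so the series converges there. -/
lemma hasValue_firstRowCofactor {k : ℕ} (hp : 0 < frobA μ 0 - k / 2) (h : 0 < μ.card)
    (hk : k ≤ μ.card)
    (hA : ∀ j ∈ Ico 1 (diagLen μ), |frobA μ j - k / 2| < frobA μ 0 - k / 2)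
    (hB : ∀ j < diagLen μ, |frobB μ j - k / 2| < frobA μ 0 - k / 2) :
    ∃ v, HasValue (frobA μ 0 - k / 2)⁻¹ (firstRowCofactor μ k) v ∧
      (frobA μ 0 - k / 2) ^ k * v = μ.card.descFactorial k * residueTerm μ μ.card k := by
  refine ⟨_, (hasValue_rootSeries _ k hp.ne').mul ((hasValue_downFactor
    (hB 0 (diagLen_pos μ h))).mul (HasValue.prod _ fun j hj => (hasValue_upFactor (hA j hj)).mul
      (hasValue_downFactor (hB j (mem_Ico.1 hj).2)))), ?_⟩
  have hd : (μ.card.descFactorial k : ℝ) ≠ 0 := by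
    exact_mod_cast (Nat.descFactorial_pos.2 hk).ne'
  have hsplit : ∏ j ∈ range (diagLen μ), (frobA μ 0 + frobB μ j) / (frobA μ 0 + frobB μ j - k) =
      (frobA μ 0 + frobB μ 0) / (frobA μ 0 + frobB μ 0 - k) *
        ∏ j ∈ Ico 1 (diagLen μ), (frobA μ 0 + frobB μ j) / (frobA μ 0 + frobB μ j - k) := by
    rw [range_eq_Ico, prod_eq_prod_Ico_succ_bot (diagLen_pos μ h)]
  rw [residueTerm, fallingPow_natCast, hsplit, prod_mul_distrib]
  have e1 : ∏ t ∈ range k, (frobA μ 0 - k / 2 - centredRoot k t) =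
      fallingPow (frobA μ 0 - 1 / 2) k := by
    rw [fallingPow]
    refine prod_congr rfl fun t _ => ?_
    rw [centredRoot]; ring
  rw [e1]
  simp only [sub_add_cancel, sub_right_comm _ _ (k : ℝ)]
  have hp' : (frobA μ 0 - k / 2) ^ k ≠ 0 := by positivity
  generalize (frobA μ 0 - k / 2) ^ k = q at hp'
  generalize (frobA μ 0 + frobB μ 0) / (frobA μ 0 + frobB μ 0 - k) = w
  generalize fallingPow (frobA μ 0 - 1 / 2) k = f
  field_simp

/-- With a_1 removed, b_1 is unpaired and costs k over the gap. The remaining pairs sum to at most r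
and cost kr over its square. -/
lemma normLE_firstRow_pairs {r k : ℕ} (hr : r + μ.rowLen 0 = μ.card) (h : 0 < μ.card)
    (hkr : k ≤ r) {R : ℝ} (hR : r + 1 < R) :
    NormLE R⁻¹ (downFactor k (frobB μ 0) *
        ∏ j ∈ Ico 1 (diagLen μ), upFactor k (frobA μ j) * downFactor k (frobB μ j))
      (Real.exp (k / (R - (r + 1)) + k * r / (R - (r + 1)) ^ 2)) := by
  have hR0 : 0 < R := lt_trans (by positivity) hR
  have hRP : 0 < R - (r + 1) := by linarith
  have hkr' : (k : ℝ) ≤ r := by exact_mod_cast hkr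
  have hk2 : (k : ℝ) / 2 ≤ r + 1 := by linarith [(Nat.cast_nonneg k : (0 : ℝ) ≤ k)]
  have hab : ∀ j ∈ Ico 1 (diagLen μ), 0 ≤ frobA μ j + frobB μ j := fun j hj => by
    linarith [half_le_frobA μ (mem_Ico.1 hj).2, half_le_frobB μ (mem_Ico.1 hj).2]
  have h0 := normLE_downFactor (k := k) (abs_sub_half_le
    (by linarith [half_le_frobB μ (diagLen_pos μ h)]) (frobB_le_of_rowLen μ hr h 0) hk2) hR
  have h1 := NormLE.prod (Ico 1 (diagLen μ)) (x := R⁻¹) (by positivity)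
    fun j hj => normLE_upFactor_mul_downFactor (k := k)
    (abs_sub_half_le (by linarith [half_le_frobA μ (mem_Ico.1 hj).2])
      (frobA_le_of_pos μ hr hj) hk2)
    (abs_sub_half_le (by linarith [half_le_frobB μ (mem_Ico.1 hj).2])
      (frobB_le_of_rowLen μ hr h j) hk2) hR (hab j hj)
  refine (h0.mul h1 (by positivity)).mono ?_
  rw [Real.exp_add]
  gcongr
  · exact prod_nonneg fun j hj => by have := hab j hj; positivity
  · rw [add_comm]; exact Real.add_one_le_exp _
  · refine (prod_one_add_le_exp _ fun j hj => by have := hab j hj; positivity).trans ?_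
    rw [← sum_div, ← mul_sum]
    gcongr
    exact sum_Ico_frobA_add_frobB_le μ hr

lemma exp_sub_one_le (x : ℝ) : Real.exp x - 1 ≤ x * Real.exp x := by
  have h := Real.add_one_le_exp (-x)
  have h2 : Real.exp x * Real.exp (-x) = 1 := by rw [← Real.exp_add]; simp
  nlinarith [Real.exp_pos x]

/-- The error after extracting the residue at the first row, for `k ≤ r`. -/
lemma firstRow_error_le {ε : ℝ} (hε : 0 < ε) {r k : ℕ} (hr : r + μ.rowLen 0 = μ.card)
    (h : 0 < μ.card) (hkr : k ≤ r) (hk : 0 < k)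
    (hRp : (1 + ε) * (r + 1) ≤ frobA μ 0 - k / 2) :
    |coeff (k + 1) (firstRowCofactor μ k) / k| + |(frobA μ 0 - k / 2) ^ k *
        ∑' d, coeff (d + (k + 1)) (firstRowCofactor μ k) *
          (frobA μ 0 - k / 2)⁻¹ ^ (d + (k + 1))| ≤
      ((1 + ε) * (1 / ε + 1 / ε ^ 2) + 1) * Real.exp (1 / ε + 1 / ε ^ 2) *
        ((1 + ε) * (k + 1 + r)) ^ k := by
  set c := 1 / ε + 1 / ε ^ 2 with hc
  have hc0 : 0 < c := by positivity
  -- This radius leaves the gap ε(r + 1), so the exponent X is at most c k/(r + 1), where c depends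
  -- on ε alone.
  set R := (1 + ε) * ((r : ℝ) + 1) with hRdef
  have hr1 : (0 : ℝ) < r + 1 := by positivity
  have hR : (r : ℝ) + 1 < R := by rw [hRdef]; nlinarith
  have hR0 : 0 < R := hr1.trans hR
  have hk0 : (0 : ℝ) < k := by exact_mod_cast hk
  have hkr' : (k : ℝ) ≤ r := by exact_mod_cast hkr
  set X := k / (R - (r + 1)) + k * r / (R - ((r : ℝ) + 1)) ^ 2 with hX
  have hRP : R - (r + 1) = ε * (r + 1) := by rw [hRdef]; ring
  have hX1 : X ≤ k / (r + 1) * c := by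
    rw [hX, hRP, hc]
    have e : (k : ℝ) / (r + 1) * (1 / ε + 1 / ε ^ 2) =
        k / (ε * (r + 1)) + k * (r + 1) / (ε * (r + 1)) ^ 2 := by field_simp
    rw [e]
    gcongr
    linarith
  have hX0 : 0 ≤ X := by rw [hX, hRP]; positivity
  have hXc : X ≤ c := by
    refine hX1.trans ?_
    have : (k : ℝ) / (r + 1) ≤ 1 := by rw [div_le_one hr1]; linarith
    nlinarith
  have hpairs := normLE_firstRow_pairs μ hr h hkr hR
  rw [← hX] at hpairs
  set Q := downFactor k (frobB μ 0) *
    ∏ j ∈ Ico 1 (diagLen μ), upFactor k (frobA μ j) * downFactor k (frobB μ j) with hQ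
  have hcof : firstRowCofactor μ k = rootSeries (centredRoot k) k * Q := rfl
  have hQ0 : coeff 0 Q = 1 := by
    rw [coeff_zero_eq_constantCoeff_apply, hQ, map_mul, map_prod]
    simp only [map_mul, ← coeff_zero_eq_constantCoeff_apply, coeff_zero_upFactor,
      coeff_zero_downFactor, mul_one, prod_const_one]
  have hroot := normLE_rootSeries (k := k) hR0
  have hsub := hroot.mul (hpairs.sub_one hQ0 (Real.one_le_exp hX0)) (by positivity)
  have hall := hroot.mul hpairs (by positivity)
  rw [← hcof] at hall
  have hU : (R + k / 2) ^ k ≤ ((1 + ε) * (k + 1 + r)) ^ k := by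
    gcongr
    rw [hRdef]
    nlinarith
  have htail := abs_pow_mul_tsum_le (k := k) hR0 hRp hall
  -- The root polynomial has degree k and does not reach degree k + 1, so Q may be replaced by Q -
  -- 1. The resulting factor e^X - 1 = O(k/(r + 1)) compensates for the spare R/k.
  have hcoeff : |coeff (k + 1) (firstRowCofactor μ k)| ≤
      (1 + k / 2 / R) ^ k * (Real.exp X - 1) * R ^ (k + 1) := by
    have e : coeff (k + 1) (firstRowCofactor μ k) =
        coeff (k + 1) (rootSeries (centredRoot k) k * (Q - 1)) := by
      rw [hcof, mul_sub, mul_one, map_sub, coeff_rootSeries_of_lt _ (Nat.lt_succ_self k), sub_zero]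
    rw [e]
    exact hsub.abs_coeff_le hR0 (k + 1)
  have h1 : |coeff (k + 1) (firstRowCofactor μ k) / k| ≤
      (R + k / 2) ^ k * ((1 + ε) * c * Real.exp c) := by
    rw [abs_div, Nat.abs_cast, div_le_iff₀ hk0]
    refine hcoeff.trans ?_
    have e : (1 + k / 2 / R) ^ k * (Real.exp X - 1) * R ^ (k + 1) =
        (R + k / 2) ^ k * ((Real.exp X - 1) * R) := by
      rw [← one_add_div_pow_mul_pow hR0]; ring
    rw [e, mul_assoc]
    refine mul_le_mul_of_nonneg_left ?_ (by positivity)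
    calc (Real.exp X - 1) * R ≤ X * Real.exp X * R := by
          gcongr
          exact exp_sub_one_le X
      _ ≤ (k / (r + 1) * c) * Real.exp c * R := by gcongr
      _ = (1 + ε) * c * Real.exp c * k := by rw [hRdef]; field_simp
  have h2 : |(frobA μ 0 - k / 2) ^ k * ∑' d, coeff (d + (k + 1)) (firstRowCofactor μ k) *
      (frobA μ 0 - k / 2)⁻¹ ^ (d + (k + 1))| ≤ (R + k / 2) ^ k * Real.exp c := by
    refine htail.trans ?_
    rw [← mul_assoc, mul_comm (R ^ k), one_add_div_pow_mul_pow hR0]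
    gcongr
  calc _ ≤ (R + k / 2) ^ k * ((1 + ε) * c * Real.exp c) + (R + k / 2) ^ k * Real.exp c :=
        add_le_add h1 h2
    _ = ((1 + ε) * c + 1) * Real.exp c * (R + k / 2) ^ k := by ring
    _ ≤ _ := by gcongr

/-- The normalized character for a long first row is the residue at the first row up to a small
error, which vanishes when fewer than `k` cells lie outside the first row. -/
theorem exists_residueTerm_add_error (ε : ℝ) (hε : 0 < ε) (hε2 : ε < 1 / 2) : ∃ K : ℝ, 0 < K ∧
      ∀ (n k : ℕ), 2 ≤ k → k ≤ n →
      ∀ (σ : Equiv.Perm (Fin n)), IsKCycle k σ →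
      ∀ (μ : YoungDiagram) (h : μ.card = n) (r : ℕ), r + μ.rowLen 0 = n →
      (r : ℝ) + k + 1 < (1 / 2 - ε) * n →
      ∃ E : ℝ,
        spechtChar μ h σ / spechtDim μ h = ((residueTerm μ n k + E : ℝ) : ℂ) ∧
        |E| ≤ K * Real.exp (k * (Real.log ((1 + ε) * (k + 1 + r) / (n - k))
                + K * (r : ℝ) ^ (-(1 / 2) : ℝ))) ∧
        (r < k → E = 0) := by
  set c := 1 / ε + 1 / ε ^ 2 with hc
  refine ⟨((1 + ε) * c + 1) * Real.exp c, by positivity, ?_⟩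
  set K := ((1 + ε) * c + 1) * Real.exp c with hK
  have hK0 : 0 < K := by positivity
  intro n k hk2 hkn σ hσ μ h r hr hrk
  subst h
  have hcard : 0 < μ.card := by omega
  have hn0 : (0 : ℝ) < μ.card := by exact_mod_cast hcard
  have hk0 : (0 : ℝ) < k := by exact_mod_cast (by omega : 0 < k)
  have hr0 : (0 : ℝ) ≤ r := by positivity
  set p := frobA μ 0 - (k : ℝ) / 2 with hp
  have hpeq : p = μ.card - r - 1 / 2 - k / 2 := by rw [hp, frobA_zero_eq μ hr]
  have hp1 : (1 / 2 + ε) * μ.card < p := by rw [hpeq]; linarith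
  have hp2 : (r : ℝ) + k + 1 < p := by nlinarith
  -- The pole satisfies p > (1/2 + ε)n, while (1 + ε)(r + 1) is below (1 + ε)(1/2 - ε)n.
  have hRp : (1 + ε) * ((r : ℝ) + 1) ≤ p := by
    have h1 : (1 + ε) * ((r : ℝ) + 1) ≤ (1 + ε) * ((1 / 2 - ε) * μ.card) := by
      gcongr; linarith
    nlinarith [mul_pos hε hn0, mul_pos (mul_pos hε hε) hn0]
  have habs : ∀ z : ℝ, 1 / 2 ≤ z → z ≤ r + 1 → |z - k / 2| < p := by
    intro z h1 h2
    rw [abs_lt]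
    constructor <;> linarith
  have hp0 : 0 < p := by linarith
  obtain ⟨v, hv, hv2⟩ := hasValue_firstRowCofactor μ hp0 hcard hkn
    (fun j hj => habs _ (half_le_frobA μ (mem_Ico.1 hj).2) (frobA_le_of_pos μ hr hj))
    (fun j hj => habs _ (half_le_frobB μ hj) (frobB_le_of_rowLen μ hr hcard j))
  have hdesc : (0 : ℝ) < μ.card.descFactorial k := by
    exact_mod_cast Nat.descFactorial_pos.2 hkn
  have hmain := coeff_mul_upFactor_eq (by omega : 0 < k) hp0.ne' hv
  rw [← frobeniusSeries_eq_firstRowCofactor_mul μ k hcard, hv2] at hmain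
  set e1 := coeff (k + 1) (firstRowCofactor μ k) / k with he1
  set e2 := p ^ k * ∑' d, coeff (d + (k + 1)) (firstRowCofactor μ k) * p⁻¹ ^ (d + (k + 1)) with he2
  have hnk : 0 < (μ.card : ℝ) - k := by nlinarith
  have hzero : r < k → e1 = 0 ∧ e2 = 0 := by
    intro hlt
    have h0 := coeff_firstRowCofactor_eq_zero μ hr hlt hcard
    constructor
    · have := h0 0
      rw [zero_add] at this
      rw [he1, this, zero_div]
    · rw [he2]
      simp [h0]
  refine ⟨(μ.card.descFactorial k : ℝ)⁻¹ * (-e1 - e2), ?_, ?_, ?_⟩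
  · rw [spechtChar_div_spechtDim_eq_coeff μ rfl (by omega) hσ]
    congr 1
    rw [← mul_neg, hmain]
    field_simp
    ring
  · have hu : 0 < (1 + ε) * (k + 1 + r) / (μ.card - k) := by positivity
    -- The error is in fact at most K times the plain k-th power. The term K r^(-1/2) is nonnegative
    -- and is given away.
    have hmono : ((1 + ε) * (k + 1 + r) / (μ.card - k)) ^ k ≤
        Real.exp (k * (Real.log ((1 + ε) * (k + 1 + r) / (μ.card - k))
          + K * (r : ℝ) ^ (-(1 / 2) : ℝ))) := by
      rw [← Real.rpow_natCast, Real.rpow_def_of_pos hu, Real.exp_le_exp, mul_comm]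
      gcongr
      have : 0 ≤ K * (r : ℝ) ^ (-(1 / 2) : ℝ) := by positivity
      linarith
    refine le_trans ?_ (mul_le_mul_of_nonneg_left hmono hK0.le)
    rcases Nat.lt_or_ge r k with hlt | hle
    · rw [(hzero hlt).1, (hzero hlt).2]
      simp only [neg_zero, sub_zero, mul_zero, abs_zero]
      positivity
    · have herr := firstRow_error_le μ hε hr hcard hle (by omega) hRp
      rw [← he1, ← he2, ← hc, ← hK] at herr
      have habs2 : |-e1 - e2| ≤ |e1| + |e2| := by
        have := abs_sub (-e1) e2
        rwa [abs_neg] at this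
      rw [abs_mul, abs_inv, abs_of_pos hdesc, div_pow, mul_div_assoc', inv_mul_le_iff₀ hdesc]
      refine (habs2.trans herr).trans ?_
      rw [mul_div_assoc', le_div_iff₀ (by positivity), mul_comm]
      gcongr
      exact sub_pow_le_descFactorial hkn
  · intro hlt
    rw [(hzero hlt).1, (hzero hlt).2]
    simp

end LongFirstRow

/-! ### Telescoping over large coordinates, and norms of the partial products. -/

/-- Factors are removed in decreasing order of c by f P = P + (f - 1) P. Each large coordinate then
meets only coordinates that do not exceed it, so a radius just beyond its own pole is enough to
control its term. -/
lemma exists_prod_eq_add_sum {ι A : Type*} [DecidableEq ι] [CommRing A] (c : ι → ℝ) (τ : ℝ)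
    (f : ι → A) (s : Finset ι) :
    ∃ T : ι → Finset ι, (∀ i ∈ s, T i ⊆ s.filter fun j => c j ≤ c i) ∧
      ∏ i ∈ s, f i = ∏ i ∈ s.filter (fun i => c i ≤ τ), f i +
        ∑ i ∈ s.filter (fun i => τ < c i), (f i - 1) * ∏ j ∈ T i, f j := by
  induction s using Finset.induction_on_max_value c with
  | empty => exact ⟨fun _ => ∅, by simp, by simp⟩
  | insert a s ha hmax ih =>
    rcases le_or_gt (c a) τ with hle | hlt
    · refine ⟨fun _ => ∅, by simp, ?_⟩
      have h1 : ∀ i ∈ insert a s, c i ≤ τ := by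
        intro i hi
        rcases mem_insert.1 hi with rfl | hi
        · exact hle
        · exact (hmax i hi).trans hle
      rw [filter_true_of_mem h1, filter_false_of_mem fun i hi => not_lt.2 (h1 i hi)]
      simp
    · obtain ⟨T, hT, hprod⟩ := ih
      refine ⟨Function.update T a s, ?_, ?_⟩
      · intro i hi
        rcases mem_insert.1 hi with rfl | hi'
        · rw [Function.update_self]
          exact fun j hj => mem_filter.2 ⟨mem_insert_of_mem hj, hmax j hj⟩
        · rw [Function.update_of_ne (by rintro rfl; exact ha hi')]
          exact (hT i hi').trans (filter_subset_filter _ (subset_insert _ _))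
      · rw [prod_insert ha, filter_insert, if_neg (not_le.2 hlt), filter_insert, if_pos hlt,
          sum_insert (by simp [ha]), Function.update_self]
        have : ∑ i ∈ s.filter (fun i => τ < c i), (f i - 1) * ∏ j ∈ Function.update T a s i, f j =
            ∑ i ∈ s.filter (fun i => τ < c i), (f i - 1) * ∏ j ∈ T i, f j := by
          refine sum_congr rfl fun i hi => ?_
          rw [Function.update_of_ne]
          rintro rfl
          exact ha (mem_filter.1 hi).1
        rw [this]
        linear_combination hprod

section Coordinates

open PowerSeries

variable (μ : YoungDiagram)

/-- All Frobenius coordinates in one family. -/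
def coordinate : ℕ ⊕ ℕ → ℝ := Sum.elim (frobA μ) (frobB μ)

/-- The indices of the Frobenius coordinates. -/
def coordinates : Finset (ℕ ⊕ ℕ) := (range (diagLen μ)).disjSum (range (diagLen μ))

/-- The factor of Frobenius' generating function of a coordinate. -/
def coordinateFactor (k : ℕ) : ℕ ⊕ ℕ → PowerSeries ℝ :=
  Sum.elim (fun i => upFactor k (frobA μ i)) fun i => downFactor k (frobB μ i)

lemma frobeniusSeries_eq_prod_coordinateFactor (k : ℕ) :
    frobeniusSeries μ k =
      rootSeries (centredRoot k) k * ∏ i ∈ coordinates μ, coordinateFactor μ k i := by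
  rw [frobeniusSeries, prod_mul_distrib, coordinates, prod_disjSum]
  rfl

variable {μ}

lemma half_le_coordinate {i : ℕ ⊕ ℕ} (hi : i ∈ coordinates μ) : 1 / 2 ≤ coordinate μ i := by
  rcases i with i | i
  · exact half_le_frobA μ (mem_range.1 (inl_mem_disjSum.1 hi))
  · exact half_le_frobB μ (mem_range.1 (inr_mem_disjSum.1 hi))

variable (μ) in
lemma sum_coordinate : ∑ i ∈ coordinates μ, coordinate μ i = μ.card := by
  rw [← sum_frobA_add_frobB, sum_add_distrib, coordinates, sum_disjSum]
  rfl

variable (μ) in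
lemma card_coordinates_le : (#(coordinates μ) : ℝ) ≤ 2 * √μ.card := by
  have h : (diagLen μ : ℝ) ≤ √μ.card := by
    apply Real.le_sqrt_of_sq_le
    exact_mod_cast diagLen_sq_le_card μ
  rw [coordinates, card_disjSum, card_range]
  push_cast
  linarith

lemma normLE_coordinateFactor {k : ℕ} {R P : ℝ} {i : ℕ ⊕ ℕ} (hP : |coordinate μ i - k / 2| ≤ P)
    (hPR : P < R) : NormLE R⁻¹ (coordinateFactor μ k i) (1 + k / (R - P)) := by
  rcases i with i | i
  · exact normLE_upFactor hP hPR
  · exact normLE_downFactor hP hPR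

lemma coeff_zero_rootSeries (ρ : ℕ → ℝ) (k : ℕ) : coeff 0 (rootSeries ρ k) = 1 := by
  rw [coeff_zero_eq_constantCoeff_apply, rootSeries, map_prod]
  simp

lemma coeff_zero_mul_prod_coordinateFactor (k : ℕ) (T : Finset (ℕ ⊕ ℕ)) :
    coeff 0 (rootSeries (centredRoot k) k * ∏ i ∈ T, coordinateFactor μ k i) = 1 := by
  have h : ∀ i, constantCoeff (coordinateFactor μ k i) = 1 := by
    rintro (i | i)
    · rw [← coeff_zero_eq_constantCoeff_apply]; exact coeff_zero_upFactor k _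
    · rw [← coeff_zero_eq_constantCoeff_apply]; exact coeff_zero_downFactor k _
  rw [coeff_zero_eq_constantCoeff_apply, map_mul, ← coeff_zero_eq_constantCoeff_apply,
    coeff_zero_rootSeries, map_prod]
  simp [h]

/-- The small coordinates contribute little at radius `2 k √n`. -/
lemma abs_coeff_bulk_le {k : ℕ} (hk : 0 < k) (hkn : (k : ℝ) ≤ √μ.card) :
    |coeff (k + 1) (rootSeries (centredRoot k) k * ∏ i ∈ (coordinates μ).filter
      (fun i => coordinate μ i ≤ k * √μ.card), coordinateFactor μ k i)| ≤
      Real.exp 3 * (2 * (k * √μ.card)) ^ (k + 1) := by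
  set q := √(μ.card : ℝ) with hq
  set τ := k * q with hτ
  have hk0 : (1 : ℝ) ≤ k := by exact_mod_cast hk
  have hq1 : 1 ≤ q := hk0.trans hkn
  have hτk : (k : ℝ) ≤ τ := by rw [hτ]; nlinarith
  have hτ0 : 0 < τ := by linarith
  have hR0 : 0 < 2 * τ := by linarith
  -- At radius 2τ the gap is τ = k√n, so each of the at most 2√n factors costs 1 + 1/√n. They
  -- contribute e² in total, and the roots contribute at most e.
  have h1 := NormLE.prod ((coordinates μ).filter fun i => coordinate μ i ≤ τ) (x := (2 * τ)⁻¹)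
    (by positivity) fun i hi => normLE_coordinateFactor (k := k) (P := τ) (R := 2 * τ)
    (abs_sub_half_le (by linarith [half_le_coordinate (mem_filter.1 hi).1]) (mem_filter.1 hi).2
      (by linarith)) (by linarith)
  have h2 := ((normLE_rootSeries (k := k) hR0).mul h1 (by positivity)).mono
    (B' := Real.exp 3) (by
      rw [show (3 : ℝ) = 1 + 2 by norm_num, Real.exp_add]
      have e1 : (1 + (k : ℝ) / 2 / (2 * τ)) ^ k ≤ Real.exp 1 := by
        have h3 : 1 + (k : ℝ) / 2 / (2 * τ) ≤ Real.exp (k / 2 / (2 * τ)) := by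
          rw [add_comm]; exact Real.add_one_le_exp _
        refine (pow_le_pow_left₀ (by positivity) h3 k).trans ?_
        rw [← Real.exp_nat_mul, Real.exp_le_exp]
        have : (k : ℝ) * (k / 2 / (2 * τ)) = k / q / 4 := by rw [hτ]; field_simp; ring
        rw [this]
        have : (k : ℝ) / q ≤ 1 := (div_le_one (by linarith)).2 hkn
        linarith
      have e2 : ∏ i ∈ (coordinates μ).filter (fun i => coordinate μ i ≤ τ),
          (1 + k / (2 * τ - τ)) ≤ Real.exp 2 := by
        have hy : (0 : ℝ) ≤ k / (2 * τ - τ) := div_nonneg (by linarith) (by linarith)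
        refine (prod_one_add_le_exp _ fun _ _ => hy).trans ?_
        rw [Real.exp_le_exp, sum_const, nsmul_eq_mul]
        have h4 : ((#((coordinates μ).filter fun i => coordinate μ i ≤ τ) : ℕ) : ℝ) ≤ 2 * q :=
          le_trans (by exact_mod_cast card_filter_le _ _) (card_coordinates_le μ)
        have h5 : (k : ℝ) / (2 * τ - τ) = 1 / q := by rw [hτ]; field_simp; ring
        rw [h5]
        calc _ ≤ 2 * q * (1 / q) := by gcongr
          _ = 2 := by field_simp
      gcongr
      exact prod_nonneg fun _ _ =>
        add_nonneg zero_le_one (div_nonneg (by linarith) (by linarith)))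
  exact h2.abs_coeff_le hR0 (k + 1)

/-- The coordinates below a large coordinate `a` contribute little at a radius slightly larger
than `a`. -/
lemma normLE_below_large {k : ℕ} {a : ℝ} {T : Finset (ℕ ⊕ ℕ)} (hk : 2 ≤ k)
    (hkn : (k : ℝ) ≤ √μ.card) (ha : k * √μ.card < a)
    (hT : T ⊆ (coordinates μ).filter fun j => coordinate μ j ≤ a) :
    NormLE ((a - k / 2) * (1 + 1 / k))⁻¹
      (rootSeries (centredRoot k) k * ∏ i ∈ T, coordinateFactor μ k i)
      (Real.exp (12 * (k * √μ.card / a))) := by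
  set q := √(μ.card : ℝ) with hq
  have hk2 : (2 : ℝ) ≤ k := by exact_mod_cast hk
  have ha2 : 2 * (k : ℝ) ≤ a := by nlinarith
  have ha0 : 0 < a := by linarith
  -- The radius is the pole enlarged by 1 + 1/k. Such a factor costs only e over k degrees, and it
  -- leaves a gap of at least 3a/(4k).
  set R := (a - k / 2) * (1 + 1 / (k : ℝ)) with hR
  have hRe : R = (a - k / 2) + (a - k / 2) / k := by rw [hR]; ring
  have hpk : 3 * a / (4 * k) ≤ (a - k / 2) / k := by
    rw [div_le_div_iff₀ (by linarith) (by linarith)]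
    nlinarith
  have hpk0 : 0 < 3 * a / (4 * k) := by positivity
  have hR34 : 3 * a / 4 ≤ R := by linarith
  have hR0 : 0 < R := by linarith
  have hq0 : 0 < q := by linarith
  have hj : ∀ j ∈ T, NormLE R⁻¹ (coordinateFactor μ k j)
      (1 + (4 * k / a + 3 * k ^ 2 * coordinate μ j / a ^ 2)) := by
    intro j hj
    have hj' := mem_filter.1 (hT hj)
    have hhalf := half_le_coordinate hj'.1
    -- Coordinates up to a/2 have gap a/4 and are counted by number, at most 2√n. Those beyond a/2
    -- have only the small gap and are weighed by size, using that all coordinates sum to n.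
    rcases le_or_gt (coordinate μ j) (a / 2) with h1 | h1
    · refine (normLE_coordinateFactor (P := a / 2) (abs_sub_half_le (by linarith) h1
        (by linarith)) (by linarith)).mono ?_
      have e : (k : ℝ) / (R - a / 2) ≤ k / (a / 4) := by
        gcongr
        linarith
      have e2 : (k : ℝ) / (a / 4) = 4 * k / a := by field_simp
      have e3 : 0 ≤ 3 * k ^ 2 * coordinate μ j / a ^ 2 := by positivity
      linarith
    · refine (normLE_coordinateFactor (P := a - k / 2) (by
        rw [abs_le]; constructor <;> linarith) (by linarith)).mono ?_
      have e : (k : ℝ) / (R - (a - k / 2)) ≤ k / (3 * a / (4 * k)) := by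
        gcongr
        linarith
      have e2 : (k : ℝ) / (3 * a / (4 * k)) = 4 * k ^ 2 * (a / 3) / a ^ 2 := by field_simp
      have e3 : 4 * (k : ℝ) ^ 2 * (a / 3) / a ^ 2 ≤ 3 * k ^ 2 * coordinate μ j / a ^ 2 := by
        gcongr ?_ / _
        nlinarith [sq_nonneg (k : ℝ)]
      have e4 : 0 ≤ 4 * (k : ℝ) / a := by positivity
      linarith
  refine ((normLE_rootSeries (k := k) hR0).mul (NormLE.prod T (by positivity) hj)
    (by positivity)).mono ?_
  have hy : ∀ j ∈ coordinates μ, 0 ≤ 4 * k / a + 3 * k ^ 2 * coordinate μ j / a ^ 2 := by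
    intro j hj
    have := half_le_coordinate hj
    positivity
  have hTs : T ⊆ coordinates μ := hT.trans (filter_subset _ _)
  set t := k * q / a with ht
  have ht0 : 0 < t := by positivity
  have ht1 : t ≤ 1 := by rw [ht, div_le_one ha0]; exact ha.le
  have e1 : (1 + (k : ℝ) / 2 / R) ^ k ≤ Real.exp t := by
    have h3 : 1 + (k : ℝ) / 2 / R ≤ Real.exp (k / 2 / R) := by
      rw [add_comm]; exact Real.add_one_le_exp _
    refine (pow_le_pow_left₀ (by positivity) h3 k).trans ?_
    rw [← Real.exp_nat_mul, Real.exp_le_exp, ht]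
    have : (k : ℝ) * (k / 2 / R) = k * k / (2 * R) := by field_simp
    rw [this]
    gcongr
    linarith
  have e2 : ∏ j ∈ T, (1 + (4 * k / a + 3 * k ^ 2 * coordinate μ j / a ^ 2)) ≤
      Real.exp (11 * t) := by
    refine (prod_one_add_le_exp _ fun j hj => hy j (hTs hj)).trans ?_
    rw [Real.exp_le_exp]
    calc ∑ j ∈ T, (4 * k / a + 3 * k ^ 2 * coordinate μ j / a ^ 2)
        ≤ ∑ j ∈ coordinates μ, (4 * k / a + 3 * k ^ 2 * coordinate μ j / a ^ 2) :=
          sum_le_sum_of_subset_of_nonneg hTs fun j hj _ => hy j hj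
      _ = #(coordinates μ) * (4 * k / a) + 3 * k ^ 2 * μ.card / a ^ 2 := by
          rw [sum_add_distrib, sum_const, nsmul_eq_mul, ← sum_div, ← mul_sum, sum_coordinate]
      _ ≤ (2 * q) * (4 * k / a) + 3 * k ^ 2 * μ.card / a ^ 2 := by
          gcongr
          exact card_coordinates_le μ
      _ = 8 * t + 3 * (t * t) := by
          rw [ht, ← Real.mul_self_sqrt (Nat.cast_nonneg μ.card : (0 : ℝ) ≤ μ.card), ← hq]
          field_simp
          ring
      _ ≤ 11 * t := by nlinarith
  calc _ ≤ Real.exp t * Real.exp (11 * t) := by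
        gcongr
        exact prod_nonneg fun j hj => by have := hy j (hTs hj); linarith
    _ = Real.exp (12 * t) := by rw [← Real.exp_add]; ring_nf

end Coordinates

/-! ### Contributions of large coordinates and the asymptotic expansion. -/

section Expansion

open PowerSeries

lemma abs_mul_sub_one_le {x y A B t : ℝ} (hx : |x - 1| ≤ A * t) (hy : |y - 1| ≤ B * t)
    (ht0 : 0 ≤ t) (ht1 : t ≤ 1) (hA : 0 ≤ A) (hB : 0 ≤ B) :
    |x * y - 1| ≤ (A + B + A * B) * t := by
  have e : x * y - 1 = (x - 1) * (y - 1) + ((x - 1) + (y - 1)) := by ring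
  have h1 : |(x - 1) * (y - 1)| ≤ (A * t) * (B * t) := by
    rw [abs_mul]; gcongr
  have h2 : |(x - 1) + (y - 1)| ≤ A * t + B * t := (abs_add_le _ _).trans (add_le_add hx hy)
  have h3 : (A * t) * (B * t) ≤ A * B * t := by
    have : A * B * (t * t) ≤ A * B * t := by
      gcongr
      nlinarith
    linarith
  rw [e]
  refine (abs_add_le _ _).trans ?_
  linarith

lemma pow_div_descFactorial_bounds {n k : ℕ} (hk : 2 ≤ k) (hkn : (k : ℝ) ≤ √n) :
    1 ≤ (n : ℝ) ^ k / n.descFactorial k ∧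
      (n : ℝ) ^ k / n.descFactorial k ≤ Real.exp (2 * (k ^ 2 / n)) ∧ (k : ℝ) ^ 2 / n ≤ 1 := by
  have hk2 : (2 : ℝ) ≤ k := by exact_mod_cast hk
  have hsq : (k : ℝ) ^ 2 ≤ n := by
    have := Real.sq_sqrt (Nat.cast_nonneg n : (0 : ℝ) ≤ n)
    calc (k : ℝ) ^ 2 ≤ √(n : ℝ) ^ 2 := by gcongr
      _ = (n : ℝ) := this
  have hkn2 : 2 * (k : ℝ) ≤ n := by nlinarith
  have hn0 : (0 : ℝ) < n := by linarith
  have hkn' : k ≤ n := by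
    have : (k : ℝ) ≤ n := by linarith
    exact_mod_cast this
  have hdesc : (0 : ℝ) < n.descFactorial k := by exact_mod_cast Nat.descFactorial_pos.2 hkn'
  have hnk : 0 < (n : ℝ) - k := by linarith
  refine ⟨?_, ?_, ?_⟩
  · rw [le_div_iff₀ hdesc, one_mul]
    exact_mod_cast Nat.descFactorial_le_pow n k
  · calc (n : ℝ) ^ k / n.descFactorial k ≤ (n : ℝ) ^ k / (n - k) ^ k := by
          gcongr
          exact sub_pow_le_descFactorial hkn'
      _ = (k / (n - k) + 1) ^ k := by
          rw [← div_pow]; congr 1; field_simp; ring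
      _ ≤ Real.exp (k / (n - k)) ^ k := by
          gcongr
          exact Real.add_one_le_exp _
      _ ≤ Real.exp (2 * (k ^ 2 / n)) := by
          rw [← Real.exp_nat_mul, Real.exp_le_exp]
          have e : 2 * ((k : ℝ) ^ 2 / n) = k * (k / (n / 2)) := by field_simp
          rw [e]
          gcongr
          linarith
  · rw [div_le_one hn0]; exact hsq

/-- The sum `∑ g_d π ^ (k - d)` is close to its first term. -/
lemma abs_sum_coeff_sub_pow_le {G : PowerSeries ℝ} {π B : ℝ} {k : ℕ} (hk : 0 < k) (hπ : π ≠ 0)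
    (h0 : coeff 0 G = 1) (hB : 1 ≤ B) (hG : NormLE (|π| * (1 + 1 / k))⁻¹ G B) :
    |∑ d ∈ range (k + 1), coeff d G * π ^ (k - d) - π ^ k| ≤ |π| ^ k * (Real.exp 1 * (B - 1)) := by
  have hk0 : (0 : ℝ) < k := by exact_mod_cast hk
  have hπ0 : 0 < |π| := abs_pos.2 hπ
  set R := |π| * (1 + 1 / (k : ℝ)) with hR
  have e1 : ∑ d ∈ range (k + 1), coeff d G * π ^ (k - d) - π ^ k =
      ∑ d ∈ range (k + 1), coeff d (G - 1) * π ^ (k - d) := by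
    simp only [map_sub, sub_mul, sum_sub_distrib]
    congr 1
    rw [sum_eq_single_of_mem 0 (by simp)]
    · simp
    · intro d _ hd
      rw [coeff_one, if_neg hd, zero_mul]
  have hsub := hG.sub_one h0 hB
  rw [e1]
  calc |∑ d ∈ range (k + 1), coeff d (G - 1) * π ^ (k - d)|
      ≤ ∑ d ∈ range (k + 1), |π| ^ k * Real.exp 1 * (|coeff d (G - 1)| * R⁻¹ ^ d) := by
        refine (abs_sum_le_sum_abs _ _).trans (sum_le_sum fun d hd => ?_)
        have hd : d ≤ k := by have := mem_range.1 hd; omega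
        have e2 : |π| ^ (k - d) = |π| ^ k * ((1 + 1 / (k : ℝ)) ^ d * R⁻¹ ^ d) := by
          rw [pow_sub₀ _ hπ0.ne' hd, ← mul_pow, hR, ← inv_pow]
          congr 2
          field_simp
        -- Passing from the radius |π|(1 + 1/k) back to |π| costs at most e, because only degrees d
        -- ≤ k occur.
        have e3 : (1 + 1 / (k : ℝ)) ^ d ≤ Real.exp 1 := by
          calc (1 + 1 / (k : ℝ)) ^ d ≤ (1 + 1 / (k : ℝ)) ^ k :=
                pow_le_pow_right₀ (by linarith [one_div_pos.2 hk0]) hd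
            _ ≤ Real.exp (1 / k) ^ k := by
                gcongr
                rw [add_comm]; exact Real.add_one_le_exp _
            _ = Real.exp 1 := by rw [← Real.exp_nat_mul]; congr 1; field_simp
        rw [abs_mul, abs_pow, e2]
        calc _ = |π| ^ k * (1 + 1 / (k : ℝ)) ^ d * (|coeff d (G - 1)| * R⁻¹ ^ d) := by ring
          _ ≤ _ := by gcongr
    _ = |π| ^ k * Real.exp 1 * ∑ d ∈ range (k + 1), |coeff d (G - 1)| * R⁻¹ ^ d := by
        rw [mul_sum]
    _ ≤ |π| ^ k * Real.exp 1 * (B - 1) := by gcongr; exact hsub _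
    _ = _ := by ring

variable (μ : YoungDiagram)

/-- The constant in the relative error of the contribution of a large coordinate. -/
def largeConst : ℝ :=
  (2 * Real.exp 2 + 1 + 2 * Real.exp 2 * 1) + 12 * Real.exp 13 +
    (2 * Real.exp 2 + 1 + 2 * Real.exp 2 * 1) * (12 * Real.exp 13)

lemma largeConst_pos : 0 < largeConst := by
  unfold largeConst; positivity

/-- The contribution of a large coordinate. -/
lemma exists_large_contribution {k : ℕ} {a δ : ℝ} {T : Finset (ℕ ⊕ ℕ)} (hk : 2 ≤ k)
    (hkn : (k : ℝ) ≤ √μ.card) (ha : k * √μ.card < a) (han : a ≤ μ.card)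
    (hT : T ⊆ (coordinates μ).filter fun j => coordinate μ j ≤ a) (hδ : |δ| = 1) :
    ∃ α : ℝ, |α| ≤ largeConst * (k * √μ.card / a) ∧
      (μ.card.descFactorial k : ℝ)⁻¹ * ∑ d ∈ range (k + 1),
        coeff d (rootSeries (centredRoot k) k * ∏ i ∈ T, coordinateFactor μ k i) *
          (δ * (a - k / 2)) ^ (k - d) = δ ^ k * (a ^ k / (μ.card : ℝ) ^ k * (1 + α)) := by
  have hnorm := normLE_below_large hk hkn ha hT
  have h0 := coeff_zero_mul_prod_coordinateFactor (μ := μ) k T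
  set G := rootSeries (centredRoot k) k * ∏ i ∈ T, coordinateFactor μ k i with hG
  set q := √(μ.card : ℝ) with hq
  have hk2 : (2 : ℝ) ≤ k := by exact_mod_cast hk
  have hk0 : (0 : ℝ) < k := by linarith
  have hq0 : 0 < q := by linarith
  have ha2 : 2 * (k : ℝ) ≤ a := by nlinarith
  have ha0 : 0 < a := by linarith
  have hn0 : (0 : ℝ) < μ.card := ha0.trans_le han
  obtain ⟨hx1, hx2, hx3⟩ := pow_div_descFactorial_bounds hk hkn
  set t := k * q / a with ht
  have ht0 : 0 < t := div_pos (mul_pos hk0 hq0) ha0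
  have ht1 : t ≤ 1 := by rw [ht, div_le_one ha0]; exact ha.le
  have hkt : (k : ℝ) ^ 2 / μ.card ≤ t := by
    calc (k : ℝ) ^ 2 / μ.card ≤ k * q / μ.card := by
          rw [pow_two]; gcongr
      _ ≤ t := by rw [ht]; gcongr
  have hp : 0 < a - (k : ℝ) / 2 := by linarith
  have hδ0 : δ ≠ 0 := by rintro rfl; simp at hδ
  set π := δ * (a - k / 2) with hπ
  have hπ0 : π ≠ 0 := mul_ne_zero hδ0 hp.ne'
  have hπabs : |π| = a - k / 2 := by rw [hπ, abs_mul, hδ, one_mul, abs_of_pos hp]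
  rw [← hπabs] at hnorm
  have hS := abs_sum_coeff_sub_pow_le (by omega) hπ0 h0 (Real.one_le_exp (by positivity)) hnorm
  set S := ∑ d ∈ range (k + 1), coeff d G * π ^ (k - d) with hSdef
  have hdesc : (0 : ℝ) < μ.card.descFactorial k := by
    by_contra hle
    have h3 : (μ.card.descFactorial k : ℝ) = 0 := le_antisymm (not_lt.1 hle) (Nat.cast_nonneg _)
    rw [h3, div_zero] at hx1
    linarith
  -- The factor 1 + α is the product of three corrections, each 1 + O(t): x for powers against
  -- falling factorials, y for the shift of the pole by k/2, and z for the terms of positive degree.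
  set x := (μ.card : ℝ) ^ k / μ.card.descFactorial k with hx
  set y := ((a - k / 2) / a) ^ k with hy
  set z := S / π ^ k with hz
  have bx : |x - 1| ≤ (2 * Real.exp 2) * t := by
    rw [abs_of_nonneg (by linarith)]
    calc x - 1 ≤ Real.exp (2 * (k ^ 2 / μ.card)) - 1 := by linarith
      _ ≤ 2 * (k ^ 2 / μ.card) * Real.exp (2 * (k ^ 2 / μ.card)) := exp_sub_one_le _
      _ ≤ 2 * t * Real.exp 2 := by
          gcongr
          linarith
      _ = 2 * Real.exp 2 * t := by ring
  have hyk : (k : ℝ) / (2 * a) ≤ 1 := by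
    rw [div_le_one (by linarith)]; linarith
  have hye : (a - (k : ℝ) / 2) / a = 1 + -(k / (2 * a)) := by field_simp; ring
  have by' : |y - 1| ≤ 1 * t := by
    have h1 : y ≤ 1 := by
      rw [hy, hye]
      exact pow_le_one₀ (by linarith) (by linarith [div_pos hk0 (by linarith : 0 < 2 * a)])
    have h2 : 1 + k * -((k : ℝ) / (2 * a)) ≤ y := by
      rw [hy, hye]
      exact one_add_mul_le_pow (by linarith) k
    rw [abs_sub_comm, abs_of_nonneg (by linarith), one_mul]
    have h3 : k * ((k : ℝ) / (2 * a)) ≤ t := by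
      rw [ht, mul_div_assoc']
      gcongr
      linarith
    linarith
  have bz : |z - 1| ≤ (12 * Real.exp 13) * t := by
    have hπk : π ^ k ≠ 0 := pow_ne_zero _ hπ0
    have e : z - 1 = (S - π ^ k) / π ^ k := by rw [hz]; field_simp
    rw [e, abs_div, abs_pow, div_le_iff₀ (by positivity)]
    refine hS.trans ?_
    rw [mul_comm]
    refine mul_le_mul_of_nonneg_right ?_ (by positivity)
    calc Real.exp 1 * (Real.exp (12 * t) - 1) ≤ Real.exp 1 * (12 * t * Real.exp (12 * t)) := by
          gcongr
          exact exp_sub_one_le _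
      _ ≤ Real.exp 1 * (12 * t * Real.exp 12) := by
          gcongr
          linarith
      _ = 12 * Real.exp 13 * t := by
          rw [show (13 : ℝ) = 1 + 12 by norm_num, Real.exp_add]; ring
  refine ⟨x * y * z - 1, ?_, ?_⟩
  · exact abs_mul_sub_one_le (abs_mul_sub_one_le bx by' ht0.le ht1 (by positivity) (by norm_num))
      bz ht0.le ht1 (by positivity) (by positivity)
  · have hSe : S = δ ^ k * (a - k / 2) ^ k * z := by
      rw [← mul_pow, ← hπ, hz]
      field_simp
    rw [hSe, hx, hy, div_pow]
    have hak : a ^ k ≠ 0 := (pow_pos ha0 k).ne'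
    have hnk : (μ.card : ℝ) ^ k ≠ 0 := (pow_pos hn0 k).ne'
    clear_value z
    clear * - hak hnk
    generalize (a - (k : ℝ) / 2) ^ k = u
    generalize a ^ k = w at *
    generalize (μ.card : ℝ) ^ k = N at *
    generalize (μ.card.descFactorial k : ℝ) = D
    field_simp
    ring

/-- This lets the factors (log n)² of the stated error absorb the constant 2 in (2k/√n)^k. -/
lemma two_le_log_sq {n : ℕ} (hn : 5 ≤ n) : 2 ≤ Real.log n ^ 2 := by
  have h1 : (3 : ℝ) ≤ Real.log 25 := by
    rw [Real.le_log_iff_exp_le (by norm_num), show (3 : ℝ) = (3 : ℕ) * 1 by norm_num,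
      Real.exp_nat_mul]
    have := Real.exp_one_lt_d9
    calc Real.exp 1 ^ 3 ≤ 2.72 ^ 3 := by
          gcongr
          linarith
      _ ≤ 25 := by norm_num
  have h2 : Real.log 25 = 2 * Real.log 5 := by
    rw [show (25 : ℝ) = 5 ^ 2 by norm_num, Real.log_pow]; norm_num
  have h3 : Real.log 5 ≤ Real.log n := Real.log_le_log (by norm_num) (by exact_mod_cast hn)
  nlinarith

lemma coeff_mul_upFactor_sub_one (F Q : PowerSeries ℝ) (k : ℕ) (a : ℝ) :
    coeff (k + 1) (F * ((upFactor k a - 1) * Q)) =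
      -k * ∑ d ∈ range (k + 1), coeff d (F * Q) * (a - k / 2) ^ (k - d) := by
  have e : F * ((upFactor k a - 1) * Q) =
      -(C (k : ℝ) * (((F * Q) * geomSeries (a - k / 2)) * X)) := by
    rw [upFactor]; ring
  rw [e, map_neg, coeff_C_mul, coeff_succ_mul_X, coeff_mul_geomSeries, neg_mul]

lemma coeff_mul_downFactor_sub_one (F Q : PowerSeries ℝ) (k : ℕ) (b : ℝ) :
    coeff (k + 1) (F * ((downFactor k b - 1) * Q)) =
      k * ∑ d ∈ range (k + 1), coeff d (F * Q) * (k / 2 - b) ^ (k - d) := by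
  have e : F * ((downFactor k b - 1) * Q) =
      C (k : ℝ) * (((F * Q) * geomSeries (k / 2 - b)) * X) := by
    rw [downFactor]; ring
  rw [e, coeff_C_mul, coeff_succ_mul_X, coeff_mul_geomSeries]

/-- The asymptotic expansion of the normalized character of a short cycle in terms of the large
Frobenius coordinates, with relative errors `O(k √n / a)`. -/
theorem exists_expansion {k : ℕ} (hk : 2 ≤ k) (hkn : (k : ℝ) ≤ √μ.card)
    {σ : Equiv.Perm (Fin μ.card)} (hσ : IsKCycle k σ) :
    ∃ (α β : ℕ → ℝ) (E : ℝ),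
      (∀ i < diagLen μ, k * √μ.card < frobA μ i →
        |α i| ≤ largeConst * (k * √μ.card / frobA μ i)) ∧
      (∀ i < diagLen μ, k * √μ.card < frobB μ i →
        |β i| ≤ largeConst * (k * √μ.card / frobB μ i)) ∧
      |E| ≤ 2 * Real.exp 5 * √μ.card * (2 * k / √μ.card) ^ k ∧
      spechtChar μ rfl σ / spechtDim μ rfl =
        (((∑ i ∈ (range (diagLen μ)).filter (fun i => k * √μ.card < frobA μ i),
            frobA μ i ^ k / (μ.card : ℝ) ^ k * (1 + α i))
          + (-1) ^ (k - 1) *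
            (∑ i ∈ (range (diagLen μ)).filter (fun i => k * √μ.card < frobB μ i),
              frobB μ i ^ k / (μ.card : ℝ) ^ k * (1 + β i))
          + E : ℝ) : ℂ) := by
  have hk2 : (2 : ℝ) ≤ k := by exact_mod_cast hk
  have hk0 : (0 : ℝ) < k := by linarith
  have hq0 : 0 < √(μ.card : ℝ) := by linarith
  set τ := k * √(μ.card : ℝ) with hτ
  set F := rootSeries (centredRoot k) k with hF
  -- Rows and columns are ordered together by size, so that the set T of a large coordinate may
  -- contain coordinates of both kinds.
  obtain ⟨T, hT, hprod⟩ := exists_prod_eq_add_sum (coordinate μ) τ (coordinateFactor μ k)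
    (coordinates μ)
  have hα : ∀ i, ∃ α : ℝ, i < diagLen μ → τ < frobA μ i →
      |α| ≤ largeConst * (τ / frobA μ i) ∧ (μ.card.descFactorial k : ℝ)⁻¹ *
        ∑ d ∈ range (k + 1), coeff d (F * ∏ j ∈ T (Sum.inl i), coordinateFactor μ k j) *
          (frobA μ i - k / 2) ^ (k - d) = frobA μ i ^ k / (μ.card : ℝ) ^ k * (1 + α) := by
    intro i
    by_cases h : i < diagLen μ ∧ τ < frobA μ i
    · obtain ⟨α, h1, h2⟩ := exists_large_contribution μ (δ := 1) hk hkn h.2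
        (frobA_le_card μ h.1) (hT (Sum.inl i) (inl_mem_disjSum.2 (mem_range.2 h.1))) (by simp)
      refine ⟨α, fun _ _ => ⟨h1, ?_⟩⟩
      rwa [one_mul, one_pow, one_mul] at h2
    · exact ⟨0, fun h1 h2 => absurd ⟨h1, h2⟩ h⟩
  have hβ : ∀ i, ∃ β : ℝ, i < diagLen μ → τ < frobB μ i →
      |β| ≤ largeConst * (τ / frobB μ i) ∧ (μ.card.descFactorial k : ℝ)⁻¹ *
        ∑ d ∈ range (k + 1), coeff d (F * ∏ j ∈ T (Sum.inr i), coordinateFactor μ k j) *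
          (k / 2 - frobB μ i) ^ (k - d) =
            (-1) ^ k * (frobB μ i ^ k / (μ.card : ℝ) ^ k * (1 + β)) := by
    intro i
    by_cases h : i < diagLen μ ∧ τ < frobB μ i
    · obtain ⟨β, h1, h2⟩ := exists_large_contribution μ (δ := -1) hk hkn h.2
        (frobB_le_card μ h.1) (hT (Sum.inr i) (inr_mem_disjSum.2 (mem_range.2 h.1))) (by simp)
      refine ⟨β, fun _ _ => ⟨h1, ?_⟩⟩
      rwa [neg_one_mul, neg_sub] at h2
    · exact ⟨0, fun h1 h2 => absurd ⟨h1, h2⟩ h⟩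
  choose α hα using hα
  choose β hβ using hβ
  set W := coeff (k + 1) (F * ∏ i ∈ (coordinates μ).filter (fun i => coordinate μ i ≤ τ),
    coordinateFactor μ k i) with hW
  refine ⟨α, β, -((μ.card.descFactorial k : ℝ)⁻¹ * (W / k)), fun i h1 h2 => (hα i h1 h2).1,
    fun i h1 h2 => (hβ i h1 h2).1, ?_, ?_⟩
  · have hWle : |W| ≤ Real.exp 3 * (2 * τ) ^ (k + 1) := abs_coeff_bulk_le (by omega) hkn
    obtain ⟨hx1, hx2, hx3⟩ := pow_div_descFactorial_bounds hk hkn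
    have hx4 : (μ.card : ℝ) ^ k / μ.card.descFactorial k ≤ Real.exp 2 := by
      refine hx2.trans (Real.exp_le_exp.2 ?_)
      linarith
    have hn0 : (0 : ℝ) < μ.card := Real.sqrt_pos.1 hq0
    have hinv : (μ.card.descFactorial k : ℝ)⁻¹ ≤ Real.exp 2 / (μ.card : ℝ) ^ k := by
      rw [le_div_iff₀ (by positivity), mul_comm, ← div_eq_mul_inv]
      exact hx4
    rw [abs_neg, abs_mul, abs_inv, abs_div, Nat.abs_cast, Nat.abs_cast]
    calc (μ.card.descFactorial k : ℝ)⁻¹ * (|W| / k)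
        ≤ Real.exp 2 / (μ.card : ℝ) ^ k * (Real.exp 3 * (2 * τ) ^ (k + 1) / k) := by gcongr
      _ = 2 * Real.exp 5 * √μ.card * (2 * k / √μ.card) ^ k := by
          have e1 : (μ.card : ℝ) ^ k = √μ.card ^ k * √μ.card ^ k := by
            rw [← mul_pow, Real.mul_self_sqrt hn0.le]
          rw [show (5 : ℝ) = 2 + 3 by norm_num, Real.exp_add, e1, hτ, pow_succ, mul_pow, mul_pow,
            div_pow, mul_pow]
          generalize √(μ.card : ℝ) = q at *
          field_simp
  · rw [spechtChar_div_spechtDim_eq_coeff μ rfl (by omega) hσ]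
    congr 1
    rw [frobeniusSeries_eq_prod_coordinateFactor, ← hF, hprod, mul_add, map_add, mul_sum, map_sum,
      ← hW, sum_filter, coordinates, sum_disjSum, ← sum_filter, ← sum_filter]
    have hdesc : (μ.card.descFactorial k : ℝ) ≠ 0 := by
      intro h0
      have := (pow_div_descFactorial_bounds hk hkn).1
      rw [h0, div_zero] at this
      linarith
    have hA : ∀ i ∈ (range (diagLen μ)).filter (fun i => τ < frobA μ i),
        coeff (k + 1) (F * ((coordinateFactor μ k (Sum.inl i) - 1) *
          ∏ j ∈ T (Sum.inl i), coordinateFactor μ k j)) =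
        -(k * μ.card.descFactorial k) * (frobA μ i ^ k / (μ.card : ℝ) ^ k * (1 + α i)) := by
      intro i hi
      have hi := mem_filter.1 hi
      rw [← (hα i (mem_range.1 hi.1) hi.2).2]
      refine (coeff_mul_upFactor_sub_one F _ k (frobA μ i)).trans ?_
      rw [neg_mul, neg_mul, mul_assoc, mul_inv_cancel_left₀ hdesc]
    have hB : ∀ i ∈ (range (diagLen μ)).filter (fun i => τ < frobB μ i),
        coeff (k + 1) (F * ((coordinateFactor μ k (Sum.inr i) - 1) *
          ∏ j ∈ T (Sum.inr i), coordinateFactor μ k j)) =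
        (k * μ.card.descFactorial k * (-1) ^ k) *
          (frobB μ i ^ k / (μ.card : ℝ) ^ k * (1 + β i)) := by
      intro i hi
      have hi := mem_filter.1 hi
      rw [mul_assoc _ ((-1 : ℝ) ^ k), ← (hβ i (mem_range.1 hi.1) hi.2).2]
      refine (coeff_mul_downFactor_sub_one F _ k (frobB μ i)).trans ?_
      rw [mul_assoc, mul_inv_cancel_left₀ hdesc]
    have hsign : (-1 : ℝ) ^ k = -(-1) ^ (k - 1) := by
      obtain ⟨l, rfl⟩ : ∃ l, k = l + 1 := ⟨k - 1, by omega⟩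
      rw [pow_succ]; simp
    have hA' := sum_congr rfl hA
    have hB' := sum_congr rfl hB
    rw [← mul_sum] at hA' hB'
    refine (congrArg (fun x => -((μ.card.descFactorial k : ℝ)⁻¹ * ((W + x) / k)))
      (congrArg₂ (· + ·) hA' hB')).trans ?_
    rw [hsign]
    field_simp
    ring

end Expansion

/-! ### Short cycles in the stated range, and assembly of the theorem. -/

/-- The asymptotic expansion for `k < n ^ (1 / 2 - ε)`. -/
theorem exists_short_cycle_expansion (ε : ℝ) (hε : 0 < ε) (hε2 : ε < 1 / 2) : ∃ K : ℝ, 0 < K ∧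
      ∀ (n k : ℕ), 2 ≤ k → k ≤ n → (k : ℝ) < (n : ℝ) ^ (1 / 2 - ε) →
      ∀ (σ : Equiv.Perm (Fin n)), IsKCycle k σ →
      ∀ (μ : YoungDiagram) (h : μ.card = n),
      ∃ (α β : ℕ → ℝ) (E : ℝ),
        (∀ i < diagLen μ, k * Real.sqrt n < frobA μ i →
          |α i| ≤ K * (k * (n : ℝ) ^ (3 / 4 + ε) / frobA μ i)) ∧
        (∀ i < diagLen μ, k * Real.sqrt n < frobB μ i →
          |β i| ≤ K * (k * (n : ℝ) ^ (3 / 4 + ε) / frobB μ i)) ∧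
        |E| ≤ K * (Real.sqrt n * Real.log n ^ 2 * (k * Real.log n ^ 2 / Real.sqrt n) ^ k) ∧
        spechtChar μ h σ / spechtDim μ h =
          (((∑ i ∈ (Finset.range (diagLen μ)).filter (fun i => k * Real.sqrt n < frobA μ i),
              frobA μ i ^ k / (n : ℝ) ^ k * (1 + α i))
            + (-1) ^ (k - 1) *
              (∑ i ∈ (Finset.range (diagLen μ)).filter (fun i => k * Real.sqrt n < frobB μ i),
                frobB μ i ^ k / (n : ℝ) ^ k * (1 + β i))
            + E : ℝ) : ℂ) := by
  refine ⟨largeConst + 2 * Real.exp 5, add_pos largeConst_pos (by positivity), ?_⟩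
  intro n k hk2 hkn hkε σ hσ μ h
  subst h
  have hn1 : (1 : ℝ) ≤ μ.card := by exact_mod_cast (by omega : 1 ≤ μ.card)
  have hkq : (k : ℝ) < √μ.card := by
    refine hkε.trans_le ?_
    rw [Real.sqrt_eq_rpow]
    exact Real.rpow_le_rpow_of_exponent_le hn1 (by linarith)
  -- The relative errors obtained are of order k√n/a, which is stronger than required.
  have hq34 : √(μ.card : ℝ) ≤ (μ.card : ℝ) ^ (3 / 4 + ε) := by
    rw [Real.sqrt_eq_rpow]
    exact Real.rpow_le_rpow_of_exponent_le hn1 (by linarith)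
  have hk2' : (2 : ℝ) ≤ k := by exact_mod_cast hk2
  obtain ⟨α, β, E, hα, hβ, hE, hmain⟩ := exists_expansion μ hk2 hkq.le hσ
  have hC := largeConst_pos
  have hle : ∀ a : ℝ, 0 < a → largeConst * (k * √μ.card / a) ≤
      (largeConst + 2 * Real.exp 5) * (k * (μ.card : ℝ) ^ (3 / 4 + ε) / a) := by
    intro a ha
    have : largeConst ≤ largeConst + 2 * Real.exp 5 := by linarith [Real.exp_pos 5]
    gcongr
  refine ⟨α, β, E, ?_, ?_, ?_, hmain⟩
  · intro i h1 h2
    exact (hα i h1 h2).trans (hle _ (by linarith [half_le_frobA μ h1]))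
  · intro i h1 h2
    exact (hβ i h1 h2).trans (hle _ (by linarith [half_le_frobB μ h1]))
  -- From 2 ≤ k < √n it follows that n > 4, which is where (log n)² ≥ 2 becomes available.
  · have hn5 : 5 ≤ μ.card := by
      have h4 : (4 : ℝ) < μ.card := by
        have h5 : (2 : ℝ) < √μ.card := by linarith
        rw [Real.lt_sqrt (by norm_num)] at h5
        linarith
      have : 4 < μ.card := by exact_mod_cast h4
      omega
    have hlog := two_le_log_sq hn5
    refine hE.trans ?_
    have h6 : 2 * Real.exp 5 * √(μ.card : ℝ) ≤
        (largeConst + 2 * Real.exp 5) * (√μ.card * Real.log μ.card ^ 2) := by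
      have h7 : √(μ.card : ℝ) * 1 ≤ √μ.card * Real.log μ.card ^ 2 := by
        gcongr
        linarith
      rw [mul_one] at h7
      have h8 : 2 * Real.exp 5 ≤ largeConst + 2 * Real.exp 5 := by linarith
      gcongr
    rw [← mul_assoc]
    have h9 : 2 * (k : ℝ) / √μ.card ≤ k * Real.log μ.card ^ 2 / √μ.card := by
      rw [mul_comm]
      gcongr
    gcongr

end

theorem theorem3p1 :
    -- a. long first row
    (∀ ε : ℝ, 0 < ε → ε < 1 / 2 → ∃ K : ℝ, 0 < K ∧
      ∀ (n k : ℕ), 2 ≤ k → k ≤ n →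
      ∀ (σ : Equiv.Perm (Fin n)), IsKCycle k σ →
      ∀ (μ : YoungDiagram) (h : μ.card = n) (r : ℕ), r + μ.rowLen 0 = n →
      (r : ℝ) + k + 1 < (1 / 2 - ε) * n →
      ∃ E : ℝ,
        spechtChar μ h σ / spechtDim μ h = ((residueTerm μ n k + E : ℝ) : ℂ) ∧
        |E| ≤ K * Real.exp (k * (Real.log ((1 + ε) * (k + 1 + r) / (n - k))
                + K * (r : ℝ) ^ (-(1 / 2) : ℝ))) ∧
        (r < k → E = 0)) ∧
    -- b. large cycle, short first row and column
    (∀ θ : ℝ, 2 / 3 < θ → ∃ ε : ℝ, 0 < ε ∧ ∃ N : ℕ,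
      ∀ (n k : ℕ), N ≤ n → 2 ≤ k → k ≤ n →
      6 * Real.log n ≤ k → (k : ℝ) ≤ ε * n →
      ∀ (σ : Equiv.Perm (Fin n)), IsKCycle k σ →
      ∀ (μ : YoungDiagram) (h : μ.card = n),
      frobB μ 0 ≤ frobA μ 0 → frobA μ 0 ≤ Real.exp (-θ) * n →
      ‖spechtChar μ h σ / spechtDim μ h‖ ≤ Real.exp (-(k : ℝ) / 2)) ∧
    -- c. asymptotic expansion
    (∀ ε : ℝ, 0 < ε → ε < 1 / 2 → ∃ K : ℝ, 0 < K ∧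
      ∀ (n k : ℕ), 2 ≤ k → k ≤ n → (k : ℝ) < (n : ℝ) ^ (1 / 2 - ε) →
      ∀ (σ : Equiv.Perm (Fin n)), IsKCycle k σ →
      ∀ (μ : YoungDiagram) (h : μ.card = n),
      ∃ (α β : ℕ → ℝ) (E : ℝ),
        (∀ i < diagLen μ, k * Real.sqrt n < frobA μ i →
          |α i| ≤ K * (k * (n : ℝ) ^ (3 / 4 + ε) / frobA μ i)) ∧
        (∀ i < diagLen μ, k * Real.sqrt n < frobB μ i →
          |β i| ≤ K * (k * (n : ℝ) ^ (3 / 4 + ε) / frobB μ i)) ∧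
        |E| ≤ K * (Real.sqrt n * Real.log n ^ 2 * (k * Real.log n ^ 2 / Real.sqrt n) ^ k) ∧
        spechtChar μ h σ / spechtDim μ h =
          (((∑ i ∈ (Finset.range (diagLen μ)).filter (fun i => k * Real.sqrt n < frobA μ i),
              frobA μ i ^ k / (n : ℝ) ^ k * (1 + α i))
            + (-1) ^ (k - 1) *
              (∑ i ∈ (Finset.range (diagLen μ)).filter (fun i => k * Real.sqrt n < frobB μ i),
                frobB μ i ^ k / (n : ℝ) ^ k * (1 + β i))
            + E : ℝ) : ℂ)) := by
  exact ⟨exists_residueTerm_add_error, norm_spechtChar_div_spechtDim_le_exp,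
    exists_short_cycle_expansion⟩
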